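/- Let $(\overline M,g)$ be a compact non-trapping smooth Riemannian manifold of dimension $d\ge 2$ with smooth strictly convex boundary $\partial M$, and let $M$ be its interior. Let $SM=\{(x,v): x\in M,\ v\in T_xM,\ |v|_g=1\}$, let $\partial_\pm SM$ be the set of unit vectors $v\in T_x\overline M$ with $x\in\partial M$ and $\pm\langle n(x),v\rangle_g>0$, where $n(x)$ is the outer unit normal, let $\phi_t$ be the geodesic flow and $X$ its generating vector field on $SM$, and write $SM_T=(0,T)\times SM$ and $\partial_\pm SM_T=(0,T)\times\partial_\pm SM$. There is $T_0>0$, depending only on $(\overline M,g)$, such that the following holds for every $T\ge T_0$. For $j=1,2$ let $\sigma_j\in L^\infty(SM)$ satisfy $0\le\sigma_j\le\sigma^0_j$ a.e. for some constant $\sigma^0_j>0$, and let $N_j:SM\times\mathbb R\to\mathbb R$ be such that $z\mapsto N_j(\cdot,\cdot,z)$ is real analytic on $\mathbb R$, both pointwise for almost every $(x,v)\in SM$ and as a map into $L^\infty(SM)$, and $N_j(x,v,0)=\partial_zN_j(x,v,0)=0$ for almost every $(x,v)\in SM$. For $h\in L^\infty(SM)$ let $f_j\in L^\infty(SM_T)$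 be the solution of $$\partial_tf_j+Xf_j+\sigma_jf_j+N_j(x,v,f_j)=0\ \text{ in } SM_T,\qquad f_j=h\ \text{ on }\{0\}\times SM,\qquad f_j=0\ \text{ on }\partial_-SM_T,$$ (which exists and is unique if $\|h\|_{L^\infty(SM)}$ is small; $\partial_t+X$ is the derivative $\frac{d}{ds}f_j(t+s,\phi_s(x,v))$ along the geodesic flow, $f_j$ is absolutely continuous along almost every orbit with the equation holding almost everywhere on it, and initial and boundary values are limits along almost every orbit), and let $\mathcal A_{\sigma_j,N_j}(h,0)=f_j|_{\partial_+SM_T}$. If for some $\delta>0$, however small, $\mathcal A_{\sigma_1,N_1}(h,0)=\mathcal A_{\sigma_2,N_2}(h,0)$ a.e. on $\partial_+SM_T$ for every $h\in L^\infty(SM)$ with $\|h\|_{L^\infty(SM)}\le\delta$ for which both solutions exist, then $$\sigma_1(x,v)=\sigma_2(x,v)\quad\text{and}\quad N_1(x,v,z)=N_2(x,v,z)\ \text{ for all } z\in\mathbb R,$$ for almost every $(x,v)\in SM$. -/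

import Mathlib

open MeasureTheory Set Filter Topology
open scoped Manifold ContDiff Bundle ENNReal

namespace Transport

noncomputable section

/-! ### Riemannian manifolds with boundary, in coordinates

The compact manifold `M` below plays the role of the manifold with boundary; its dimension is
`n + 1`, and its charts take values in the half space where the coordinate `0` is nonnegative. Its
interior and boundary are `(𝓡∂ (n + 1)).interior M` and `(𝓡∂ (n + 1)).boundary M`. As in all of
Mathlib, the tangent space at `x` is identified with the coordinate space by the preferred chart
at `x`. -/

/-- The coordinate space of dimension `n + 1`. -/
abbrev Coord (n : ℕ) : Type := EuclideanSpace ℝ (Fin (n + 1))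

/-- The `i`-th vector of the standard basis of the coordinate space. -/
def basisVec (n : ℕ) (i : Fin (n + 1)) : Coord n := EuclideanSpace.single i 1

section Manifold

variable {n : ℕ} {M : Type*} [TopologicalSpace M] [ChartedSpace (EuclideanHalfSpace (n + 1)) M]

/-- The tangent bundle of `M`. -/
abbrev TBundle (n : ℕ) (M : Type*) [TopologicalSpace M]
    [ChartedSpace (EuclideanHalfSpace (n + 1)) M] [IsManifold (𝓡∂ (n + 1)) ∞ M] : Type _ :=
  TangentBundle (𝓡∂ (n + 1)) M

/-- Smooth Riemannian metrics on `M` (smooth up to the boundary). -/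
abbrev RMetric (n : ℕ) (M : Type*) [TopologicalSpace M]
    [ChartedSpace (EuclideanHalfSpace (n + 1)) M] [IsManifold (𝓡∂ (n + 1)) ∞ M] : Type _ :=
  Bundle.ContMDiffRiemannianMetric (𝓡∂ (n + 1)) ∞ (Coord n)
    (fun x : M ↦ TangentSpace (𝓡∂ (n + 1)) x)

/-- The `i`-th component of a tangent vector at `x` in the preferred chart at `x`. -/
def comp {x : M} (v : TangentSpace (𝓡∂ (n + 1)) x) (i : Fin (n + 1)) : ℝ :=
  (show Coord n from v) i

variable [IsManifold (𝓡∂ (n + 1)) ∞ M]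

instance : MeasurableSpace (TBundle n M) := borel _

instance : BorelSpace (TBundle n M) := ⟨rfl⟩

/-- The tangent vector with coordinates `(y, w)` in the chart at `x₀`: its base point is the point
with coordinates `y`, and it has components `w` in that chart. -/
def ofCoord (x₀ : M) (z : Coord n × Coord n) : TBundle n M :=
  ⟨(extChartAt (𝓡∂ (n + 1)) x₀).symm z.1,
    tangentCoordChange (𝓡∂ (n + 1)) x₀ ((extChartAt (𝓡∂ (n + 1)) x₀).symm z.1)
      ((extChartAt (𝓡∂ (n + 1)) x₀).symm z.1) z.2⟩

/-- The matrix `g_ij(y)` of the metric in the chart at `x₀`. -/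
def metricMatrix (g : RMetric n M) (x₀ : M) (y : Coord n) :
    Matrix (Fin (n + 1)) (Fin (n + 1)) ℝ :=
  Matrix.of fun i j ↦ g.inner ((extChartAt (𝓡∂ (n + 1)) x₀).symm y)
    (ofCoord x₀ (y, basisVec n i)).2 (ofCoord x₀ (y, basisVec n j)).2

/-- The partial derivative `∂_k g_ij` at the point `x`, in the preferred chart at `x` (one-sided in
the direction transversal to the boundary if `x` is a boundary point). -/
def metricDeriv (g : RMetric n M) (x : M) (k i j : Fin (n + 1)) : ℝ :=
  fderivWithin ℝ (fun y ↦ metricMatrix g x y i j) (range (𝓡∂ (n + 1)))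
    (extChartAt (𝓡∂ (n + 1)) x x) (basisVec n k)

/-- The Christoffel symbol `Γ^k_ij` of the Levi-Civita connection at the point `x`, in the preferred
chart at `x`. -/
def christoffel (g : RMetric n M) (x : M) (k i j : Fin (n + 1)) : ℝ :=
  (1 / 2) * ∑ l, (metricMatrix g x (extChartAt (𝓡∂ (n + 1)) x x))⁻¹ k l *
    (metricDeriv g x i j l + metricDeriv g x j i l - metricDeriv g x l i j)

/-- The vector `Γ(v, v)`, with components `∑ Γ^k_ij v^i v^j`. -/
def christoffelVec (g : RMetric n M) (x : M) (v : TangentSpace (𝓡∂ (n + 1)) x) : Coord n :=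
  WithLp.toLp 2 fun k ↦ ∑ i, ∑ j, christoffel g x k i j * comp v i * comp v j

/-! ### Geodesics, non-trapping, strict convexity -/

/-- The geodesic vector field `X` on the tangent bundle, that is `X = (v, -Γ(v, v))` in coordinates:
its integral curves are the curves `(γ, γ')` with `γ` a geodesic. -/
def geodesicField (g : RMetric n M) (p : TBundle n M) :
    TangentSpace (𝓡∂ (n + 1)).tangent p :=
  ((p.2 : Coord n), -christoffelVec g p.1 p.2)

/-- The unit sphere bundle `SM` of the interior of the manifold. -/
def sphereBundle (g : RMetric n M) : Set (TBundle n M) :=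
  {p | p.1 ∈ (𝓡∂ (n + 1)).interior M ∧ g.inner p.1 p.2 p.2 = 1}

/-- `c = (γ, γ') : [a, b] → TM` is the orbit of the geodesic flow through `p` at time `0`, where the
geodesic `γ` runs in the interior of the manifold, from the boundary to the boundary. If the boundary
is strictly convex, such a geodesic meets the boundary transversally at its end points, so that it is
a maximal geodesic of the manifold. Thus `c s = φ_s(p)`, `b = τ_+(p)` and `a = -τ_-(p)`. -/
structure IsMaxGeodesic (g : RMetric n M) (p : TBundle n M) (c : ℝ → TBundle n M) (a b : ℝ) :
    Prop where
  lt : a < b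
  zero_mem : (0 : ℝ) ∈ Icc a b
  start : c 0 = p
  geodesic : IsMIntegralCurveOn c (geodesicField g) (Icc a b)
  interior : ∀ s ∈ Ioo a b, (c s).1 ∈ (𝓡∂ (n + 1)).interior M
  left : (c a).1 ∈ (𝓡∂ (n + 1)).boundary M
  right : (c b).1 ∈ (𝓡∂ (n + 1)).boundary M

/-- The manifold is non-trapping: each geodesic `γ_{x,v}` is defined on a finite interval
`[-τ_-(x,v), τ_+(x,v)]` and reaches the boundary at both ends. -/
def NonTrapping (g : RMetric n M) : Prop :=
  ∀ p ∈ sphereBundle g, ∃ c a b, IsMaxGeodesic g p c a b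

/-- `ν` is the outer unit normal vector at the boundary point `x`. The vectors tangent to the
boundary are those with vanishing component `0`, and the outward pointing ones are those with negative
component `0`. -/
structure IsOuterNormal (g : RMetric n M) (x : M) (ν : TangentSpace (𝓡∂ (n + 1)) x) : Prop where
  unit : g.inner x ν ν = 1
  normal : ∀ w : TangentSpace (𝓡∂ (n + 1)) x, comp w 0 = 0 → g.inner x ν w = 0
  outward : comp ν 0 < 0

/-- The boundary is strictly convex: its second fundamental form
`II(w, w) = ⟨∇_w ν, w⟩ = -⟨ν, ∇_w W⟩ = -⟨ν, Γ(w, w)⟩` is positive definite (`W` is an extension of `w`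
that is tangent to the boundary, and `∇_w W - Γ(w, w)` is tangent to the boundary). -/
def StrictlyConvexBoundary (g : RMetric n M) : Prop :=
  ∀ x ∈ (𝓡∂ (n + 1)).boundary M, ∀ ν : TangentSpace (𝓡∂ (n + 1)) x, IsOuterNormal g x ν →
    ∀ w : TangentSpace (𝓡∂ (n + 1)) x, w ≠ 0 → comp w 0 = 0 →
      0 < -g.inner x ν (christoffelVec g x w)

/-- The outgoing boundary `∂_+SM`. -/
def outgoing (g : RMetric n M) : Set (TBundle n M) :=
  {p | p.1 ∈ (𝓡∂ (n + 1)).boundary M ∧ g.inner p.1 p.2 p.2 = 1 ∧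
    ∃ ν, IsOuterNormal g p.1 ν ∧ 0 < g.inner p.1 ν p.2}

/-- The incoming boundary `∂_-SM`. -/
def incoming (g : RMetric n M) : Set (TBundle n M) :=
  {p | p.1 ∈ (𝓡∂ (n + 1)).boundary M ∧ g.inner p.1 p.2 p.2 = 1 ∧
    ∃ ν, IsOuterNormal g p.1 ν ∧ g.inner p.1 ν p.2 < 0}

/-! ### Volume measures -/

/-- The radial projection `(x, v) ↦ (x, v / |v|)`. -/
def normalize (g : RMetric n M) (p : TBundle n M) : TBundle n M :=
  ⟨p.1, (Real.sqrt (g.inner p.1 p.2 p.2))⁻¹ • p.2⟩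

/-- The punctured open unit ball bundle. -/
def puncturedBall (g : RMetric n M) : Set (TBundle n M) :=
  {p | 0 < g.inner p.1 p.2 p.2 ∧ g.inner p.1 p.2 p.2 < 1}

/-- The volume of the tangent bundle: Riemannian volume of `M` times Lebesgue measure of the fibres,
that is `√(det g) dy √(det g) dw = det g dy dw` in every chart. The measures of the charts agree on
the overlaps, so that their supremum is the measure glued from them. -/
def tangentVolume (g : RMetric n M) : Measure (TBundle n M) :=
  ⨆ x₀ : M, Measure.map (ofCoord x₀)
    (((volume : Measure (Coord n × Coord n)).restrict
      ((extChartAt (𝓡∂ (n + 1)) x₀).target ×ˢ univ)).withDensity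
        fun z ↦ ENNReal.ofReal (metricMatrix g x₀ z.1).det)

/-- The volume measure `dΣ` of `SM`: Riemannian volume of the base times the standard measure of the
unit spheres (obtained from Lebesgue measure of the unit balls by radial projection, with the
factor `dim M`). It is a measure on the tangent bundle that is carried by `SM`. -/
def sphereVolume (g : RMetric n M) : Measure (TBundle n M) :=
  Measure.map (normalize g) (((n + 1 : ℕ) : ℝ≥0∞) •
    (tangentVolume g).restrict {p | p.1 ∈ (𝓡∂ (n + 1)).interior M ∧ p ∈ puncturedBall g})

/-- The point of the boundary hyperplane with coordinates `y'`. -/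
def boundaryCoord (y : EuclideanSpace ℝ (Fin n)) : Coord n := WithLp.toLp 2 (Fin.cons 0 y.ofLp)

/-- The volume of the tangent bundle over the boundary: Riemannian volume of the boundary (with the
induced metric `(g_ij)_{i,j ≥ 1}`) times Lebesgue measure of the fibres `T_xM`. -/
def boundaryTangentVolume (g : RMetric n M) : Measure (TBundle n M) :=
  ⨆ x₀ : M, Measure.map (fun z : EuclideanSpace ℝ (Fin n) × Coord n ↦
      ofCoord x₀ (boundaryCoord z.1, z.2))
    (((volume : Measure (EuclideanSpace ℝ (Fin n) × Coord n)).restrict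
      {z | boundaryCoord z.1 ∈ (extChartAt (𝓡∂ (n + 1)) x₀).target}).withDensity
        fun z ↦ ENNReal.ofReal
          (Real.sqrt ((metricMatrix g x₀ (boundaryCoord z.1)).submatrix Fin.succ Fin.succ).det *
            Real.sqrt (metricMatrix g x₀ (boundaryCoord z.1)).det))

/-- The volume measure of `∂SM`: Riemannian volume of the boundary times the standard measure of the
unit spheres of `T_xM`. On `∂_±SM` it has the same null sets, hence the same `L^∞` space, as its
product with the positive weight `|⟨ν, v⟩|`. -/
def boundaryVolume (g : RMetric n M) : Measure (TBundle n M) :=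
  Measure.map (normalize g) (((n + 1 : ℕ) : ℝ≥0∞) •
    (boundaryTangentVolume g).restrict (puncturedBall g))

/-- The product of Lebesgue measure on `(0, T)` and a measure on the tangent bundle. -/
def timesInterval (T : ℝ) (m : Measure (TBundle n M)) : Measure (ℝ × TBundle n M) :=
  ((volume : Measure ℝ).restrict (Ioo 0 T)).prod m

/-! ### The transport equation -/

/-- The absorption coefficient `σ ∈ L^∞(SM)` satisfies `0 ≤ σ ≤ σ⁰` for a positive constant `σ⁰`. -/
def IsAbsorption (g : RMetric n M) (σ : TBundle n M → ℝ) : Prop :=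
  MemLp σ ∞ (sphereVolume g) ∧ ∃ σ₀ : ℝ, 0 < σ₀ ∧ ∀ᵐ p ∂sphereVolume g, 0 ≤ σ p ∧ σ p ≤ σ₀

/-- The nonlinear term: `z ↦ N(·, ·, z)` is (real) analytic on `ℝ`, pointwise at almost every point of
`SM` and as a map with values in `L^∞(SM)`, and `N(x, v, 0) = ∂_z N(x, v, 0) = 0`. -/
structure IsNonlinearity (g : RMetric n M) (N : TBundle n M → ℝ → ℝ) : Prop where
  analytic : ∀ᵐ p ∂sphereVolume g, AnalyticOnNhd ℝ (N p) univ
  analytic_Linfty : ∃ F : ℝ → Lp ℝ ∞ (sphereVolume g), AnalyticOnNhd ℝ F univ ∧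
    ∀ z, F z =ᵐ[sphereVolume g] fun p ↦ N p z
  zero : ∀ᵐ p ∂sphereVolume g, N p 0 = 0
  deriv_zero : ∀ᵐ p ∂sphereVolume g, deriv (N p) 0 = 0

/-- `u ∈ L^∞(SM_T)` is a solution of the initial boundary value problem
`∂_t u + X u + σ u + N(x, v, u) = 0` in `SM_T`, `u = f₀` on `{0} × SM`, `u = fb` on `∂_-SM_T`.
The derivative `(∂_t + X) u (t, p)` is the derivative of `s ↦ u(t + s, φ_s(p))`: along almost every
orbit of the geodesic flow, `u` is locally absolutely continuous and the equation holds at almost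
every time, and the initial and boundary values are attained as limits along almost every orbit.
Here `u` is the representative of its class that is continuous along almost every orbit; up to null
sets of orbits there is only one. -/
structure IsSolution (g : RMetric n M) (T : ℝ) (σ : TBundle n M → ℝ) (N : TBundle n M → ℝ → ℝ)
    (f₀ : TBundle n M → ℝ) (fb : ℝ × TBundle n M → ℝ) (u : ℝ × TBundle n M → ℝ) : Prop where
  bounded : MemLp u ∞ (timesInterval T (sphereVolume g))
  equation : ∀ᵐ q ∂timesInterval T (sphereVolume g), ∀ c a b, IsMaxGeodesic g q.2 c a b →
    (∀ s₁ ∈ Ioo (max a (-q.1)) (min b (T - q.1)), ∀ s₂ ∈ Ioo (max a (-q.1)) (min b (T - q.1)),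
      AbsolutelyContinuousOnInterval (fun s ↦ u (q.1 + s, c s)) s₁ s₂) ∧
    ∀ᵐ s, s ∈ Ioo (max a (-q.1)) (min b (T - q.1)) →
      HasDerivAt (fun s ↦ u (q.1 + s, c s))
        (-(σ (c s) * u (q.1 + s, c s)) - N (c s) (u (q.1 + s, c s))) s
  initial : ∀ᵐ p ∂sphereVolume g, ∀ c a b, IsMaxGeodesic g p c a b →
    Tendsto (fun s ↦ u (s, c s)) (𝓝[>] 0) (𝓝 (f₀ p))
  boundary : ∀ᵐ q ∂timesInterval T ((boundaryVolume g).restrict (incoming g)),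
    ∀ c a b, IsMaxGeodesic g q.2 c a b →
      Tendsto (fun s ↦ u (q.1 + s, c s)) (𝓝[>] 0) (𝓝 (fb q))

/-- `r` is the restriction (trace) of the solution `u` to `∂_+SM_T`, attained as limit along almost
every orbit of the geodesic flow. -/
def IsOutgoingTrace (g : RMetric n M) (T : ℝ) (u r : ℝ × TBundle n M → ℝ) : Prop :=
  ∀ᵐ q ∂timesInterval T ((boundaryVolume g).restrict (outgoing g)),
    ∀ c a b, IsMaxGeodesic g q.2 c a b →
      Tendsto (fun s ↦ u (q.1 + s, c s)) (𝓝[<] 0) (𝓝 (r q))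

/-- The graph of the measurement operator: `𝒜_{σ,N}(f₀, fb) = r`. -/
def IsMeasurement (g : RMetric n M) (T : ℝ) (σ : TBundle n M → ℝ) (N : TBundle n M → ℝ → ℝ)
    (f₀ : TBundle n M → ℝ) (fb r : ℝ × TBundle n M → ℝ) : Prop :=
  ∃ u, IsSolution g T σ N f₀ fb u ∧ IsOutgoingTrace g T u r

/-- The measurements `𝒜_{σ₁,N₁}(h, 0)` and `𝒜_{σ₂,N₂}(h, 0)` are equal in `L^∞(∂_+SM_T)` for all
`h ∈ L^∞(SM)` of norm at most `δ`. -/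
def SameMeasurements (g : RMetric n M) (T : ℝ) (σ₁ : TBundle n M → ℝ) (N₁ : TBundle n M → ℝ → ℝ)
    (σ₂ : TBundle n M → ℝ) (N₂ : TBundle n M → ℝ → ℝ) (δ : ℝ) : Prop :=
  ∀ h : TBundle n M → ℝ, MemLp h ∞ (sphereVolume g) →
    eLpNorm h ∞ (sphereVolume g) ≤ ENNReal.ofReal δ →
    ∀ r₁ r₂ : ℝ × TBundle n M → ℝ,
      IsMeasurement g T σ₁ N₁ h 0 r₁ → IsMeasurement g T σ₂ N₂ h 0 r₂ →
        r₁ =ᵐ[timesInterval T ((boundaryVolume g).restrict (outgoing g))] r₂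

end Manifold

end

end Transport

/-! Only constant initial values are needed. Along an orbit of the geodesic flow the transport
equation is the scalar equation `w' = -(σ w + N(w))` with coefficients evaluated at `φ_s(p)`. With
initial value `z` and no inflow, the outgoing trace at time `τ_+(p)` at the exit point of `p` is the
end value of the solution that starts at `p` with value `z`. The exit time is bounded
(`exists_exitTime_le`), so if `T` exceeds the bound, every orbit that starts in the interior at time
zero is observed when it leaves. Null sets of the outgoing boundary correspond to null sets of
starting points (`nullS_exit`), hence the measurements determine the end values for almost every `p`
and every small constant `z` (`ae_exit_eq`).

The coefficients do not depend on time. A solution that starts at `φ_s(p)` is therefore a solution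
along the orbit of `p` that starts at time `s`. Let `y₁`, `y₂` solve the two equations with the same
small initial value. If `y₁ < r < y₂` somewhere with `r` rational, this persists on an open set of
times. At almost every such time `s` the solutions of the two equations that start from `r` have the
same end value. Solutions of a scalar equation do not cross, so this common value is larger than the
end value of `y₁` and smaller than that of `y₂`, although these are equal (`IsSol.le_of_end_eq`).
Thus `y₁ = y₂` along almost every orbit, and comparing derivatives gives `σ₁ w + N₁(w) = σ₂ w +
N₂(w)` at `φ_s(p)` with `w = y₁(s)` (`ae_ae_coeff_eq`). Initial values that tend to zero produce
nonzero `w` that tend to zero. The identity theorem then gives equality for all arguments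
(`ae_coeff_eq`), and `∂_z N = 0` at zero separates `σ` from `N`.

The geometric part consists of almost everywhere statements, for which it is enough that the flow
and the exit map respect null sets. Lipschitz maps preserve null sets, so Grönwall estimates in
charts replace differentiability of the flow, Liouville's theorem and Santaló's formula
(`measure_range_eq_zero_of_dist_le`, `nullS_flow`, `nullS_exit`). Sets of unit vectors are measured
through the cones over them. All dilations of unit speed geodesics are trajectories of a single
field `unitField`, so the estimates take place in the full chart of the tangent bundle. Strict
convexity makes geodesics cross the boundary transversally (`exists_exit_lt`, `IsArc.snd_neg`). -/

namespace Transport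

noncomputable section

/-! ### Charts of the tangent bundle -/

section Charts

variable {n : ℕ} {M : Type*} [TopologicalSpace M] [ChartedSpace (EuclideanHalfSpace (n + 1)) M]
  [IsManifold (𝓡∂ (n + 1)) ∞ M]

/-- The coordinates of a tangent vector in the chart at `x₀`. -/
def coordMap (x₀ : M) (p : TBundle n M) : Coord n × Coord n :=
  (extChartAt (𝓡∂ (n + 1)) x₀ p.1, tangentCoordChange (𝓡∂ (n + 1)) p.1 x₀ p.1 p.2)

/-- The domain in the chart at `x₀` of the tangent bundle. -/
def coordSource (n : ℕ) {M : Type*} [TopologicalSpace M]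
    [ChartedSpace (EuclideanHalfSpace (n + 1)) M] [IsManifold (𝓡∂ (n + 1)) ∞ M]
    (x₀ : M) : Set (TBundle n M) :=
  {p | p.1 ∈ (extChartAt (𝓡∂ (n + 1)) x₀).source}

/-- The range of the chart at `x₀` of the tangent bundle. -/
def coordTarget (n : ℕ) {M : Type*} [TopologicalSpace M]
    [ChartedSpace (EuclideanHalfSpace (n + 1)) M]
    (x₀ : M) : Set (Coord n × Coord n) :=
  (extChartAt (𝓡∂ (n + 1)) x₀).target ×ˢ univ

/-- This and the next two lemmas identify `coordMap x₀` and `ofCoord x₀` with the extended chart of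
the tangent bundle at the zero vector over `x₀`, from which continuity and smoothness are inherited.
-/
lemma coordSource_eq (x₀ : M) :
    coordSource n x₀ = (extChartAt (𝓡∂ (n + 1)).tangent (⟨x₀, 0⟩ : TBundle n M)).source := by
  ext q
  simp [coordSource]

lemma ofCoord_eq (x₀ : M) :
    ofCoord x₀ = (extChartAt (𝓡∂ (n + 1)).tangent (⟨x₀, 0⟩ : TBundle n M)).symm := by
  ext z : 1
  rfl

lemma coordTarget_eq (x₀ : M) :
    coordTarget n x₀ = (extChartAt (𝓡∂ (n + 1)).tangent (⟨x₀, 0⟩ : TBundle n M)).target := by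
  ext ⟨y, w⟩
  have h1 : (((𝓡∂ (n + 1)).tangent).symm (y, w)
      ∈ (chartAt (ModelProd (EuclideanHalfSpace (n + 1)) (Coord n))
        (⟨x₀, 0⟩ : TBundle n M)).target) ↔
      (𝓡∂ (n + 1)).symm y ∈ (chartAt (EuclideanHalfSpace (n + 1)) x₀).target :=
    TangentBundle.mem_chart_target_iff _ _
  have h2 : (y, w) ∈ range (𝓡∂ (n + 1)).tangent ↔ y ∈ range (𝓡∂ (n + 1)) := by
    rw [ModelWithCorners.range_prod]; simp
  rw [coordTarget, extChartAt_target, extChartAt_target]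
  simp only [mem_prod, mem_inter_iff, mem_preimage, mem_univ, and_true]
  rw [h1, h2]

lemma ofCoord_coordMap {x₀ : M} {p : TBundle n M} (hp : p ∈ coordSource n x₀) :
    ofCoord x₀ (coordMap x₀ p) = p := by
  rw [coordSource_eq] at hp
  rw [ofCoord_eq]
  exact PartialEquiv.left_inv _ hp

lemma coordMap_ofCoord {x₀ : M} {z : Coord n × Coord n} (hz : z ∈ coordTarget n x₀) :
    coordMap x₀ (ofCoord x₀ z : TBundle n M) = z := by
  rw [coordTarget_eq] at hz
  rw [ofCoord_eq]
  exact PartialEquiv.right_inv _ hz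

lemma coordMap_mem {x₀ : M} {p : TBundle n M} (hp : p ∈ coordSource n x₀) :
    coordMap x₀ p ∈ coordTarget n x₀ :=
  ⟨(extChartAt (𝓡∂ (n + 1)) x₀).map_source hp, mem_univ _⟩

lemma ofCoord_mem {x₀ : M} {z : Coord n × Coord n} (hz : z ∈ coordTarget n x₀) :
    (ofCoord x₀ z : TBundle n M) ∈ coordSource n x₀ :=
  (extChartAt (𝓡∂ (n + 1)) x₀).map_target hz.1

lemma isOpen_coordSource (x₀ : M) : IsOpen (coordSource n x₀) := by
  rw [coordSource_eq]; exact isOpen_extChartAt_source _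

lemma mem_coordSource_self (p : TBundle n M) : p ∈ coordSource n p.1 :=
  mem_extChartAt_source p.1

lemma continuousOn_coordMap (x₀ : M) :
    ContinuousOn (coordMap x₀ : TBundle n M → _) (coordSource n x₀) := by
  rw [coordSource_eq]
  exact continuousOn_extChartAt (⟨x₀, 0⟩ : TBundle n M)

lemma continuousOn_ofCoord (x₀ : M) :
    ContinuousOn (ofCoord x₀ : _ → TBundle n M) (coordTarget n x₀) := by
  rw [coordTarget_eq, ofCoord_eq]
  exact continuousOn_extChartAt_symm (⟨x₀, 0⟩ : TBundle n M)

omit [IsManifold (𝓡∂ (n + 1)) ∞ M] in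
lemma measurableSet_target (x₀ : M) :
    MeasurableSet (extChartAt (𝓡∂ (n + 1)) x₀).target := by
  rw [extChartAt_target]
  exact ((chartAt _ x₀).open_target.preimage (𝓡∂ (n + 1)).continuous_symm).measurableSet.inter
    (𝓡∂ (n + 1)).isClosed_range.measurableSet

omit [IsManifold (𝓡∂ (n + 1)) ∞ M] in
lemma measurableSet_coordTarget (x₀ : M) : MeasurableSet (coordTarget n x₀) :=
  (measurableSet_target x₀).prod MeasurableSet.univ

/-- The fibre component of `ofCoord` as a continuous linear map. -/
lemma coordMap_snd (x₀ : M) (p : TBundle n M) :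
    (coordMap x₀ p).2 = tangentCoordChange (𝓡∂ (n + 1)) p.1 x₀ p.1 p.2 := rfl

lemma ofCoord_snd_comp {x₀ : M} {y : Coord n} (hy : y ∈ (extChartAt (𝓡∂ (n + 1)) x₀).target)
    (w : Coord n) :
    tangentCoordChange (𝓡∂ (n + 1)) ((extChartAt (𝓡∂ (n + 1)) x₀).symm y) x₀
      ((extChartAt (𝓡∂ (n + 1)) x₀).symm y) (ofCoord x₀ (y, w) : TBundle n M).2 = w := by
  have := coordMap_ofCoord (M := M) (x₀ := x₀) (z := (y, w)) ⟨hy, mem_univ _⟩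
  exact congrArg Prod.snd this

/-- The metric in the chart at `x₀` as a bilinear form. -/
def coordMetric (g : RMetric n M) (x₀ : M) (y : Coord n) : Coord n →L[ℝ] Coord n →L[ℝ] ℝ :=
  ContinuousLinearMap.bilinearComp (E := Coord n) (F := Coord n)
    (g.inner ((extChartAt (𝓡∂ (n + 1)) x₀).symm y))
    (tangentCoordChange (𝓡∂ (n + 1)) x₀ ((extChartAt (𝓡∂ (n + 1)) x₀).symm y)
      ((extChartAt (𝓡∂ (n + 1)) x₀).symm y))
    (tangentCoordChange (𝓡∂ (n + 1)) x₀ ((extChartAt (𝓡∂ (n + 1)) x₀).symm y)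
      ((extChartAt (𝓡∂ (n + 1)) x₀).symm y))

lemma coordMetric_apply (g : RMetric n M) (x₀ : M) (y a b : Coord n) :
    coordMetric g x₀ y a b = g.inner ((extChartAt (𝓡∂ (n + 1)) x₀).symm y)
      (ofCoord x₀ (y, a)).2 (ofCoord x₀ (y, b)).2 := rfl

lemma metricMatrix_apply (g : RMetric n M) (x₀ : M) (y : Coord n) (i j : Fin (n + 1)) :
    metricMatrix g x₀ y i j = coordMetric g x₀ y (basisVec n i) (basisVec n j) := rfl

lemma coordMetric_symm (g : RMetric n M) (x₀ : M) (y a b : Coord n) :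
    coordMetric g x₀ y a b = coordMetric g x₀ y b a := by
  rw [coordMetric_apply, coordMetric_apply]
  exact g.symm _ _ _

lemma coordMetric_pos (g : RMetric n M) {x₀ : M} {y : Coord n}
    (hy : y ∈ (extChartAt (𝓡∂ (n + 1)) x₀).target) {a : Coord n} (ha : a ≠ 0) :
    0 < coordMetric g x₀ y a a := by
  rw [coordMetric_apply]
  refine g.pos _ _ fun h ↦ ha ?_
  have h2 := ofCoord_snd_comp (M := M) hy a
  change (ofCoord x₀ (y, a) : TBundle n M).2 = 0 at h
  rw [← h2, h]
  exact map_zero _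

lemma coordMetric_coordMap (g : RMetric n M) {x₀ : M} {p : TBundle n M}
    (hp : p ∈ coordSource n x₀) :
    coordMetric g x₀ (coordMap x₀ p).1 (coordMap x₀ p).2 (coordMap x₀ p).2
      = g.inner p.1 p.2 p.2 := by
  rw [coordMetric_apply]
  have h := ofCoord_coordMap hp
  have key : ∀ q : TBundle n M, q = p → g.inner q.1 q.2 q.2 = g.inner p.1 p.2 p.2 := by
    rintro q rfl; rfl
  exact key _ h

/-- A constant coordinate vector is a smooth section along the inverse chart, and the inner product
of two smooth sections is smooth. This includes boundary points. -/
lemma contDiffOn_coordMetric (g : RMetric n M) (x₀ : M) (a b : Coord n) :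
    ContDiffOn ℝ ∞ (fun y ↦ coordMetric g x₀ y a b) (extChartAt (𝓡∂ (n + 1)) x₀).target := by
  let _ : Bundle.RiemannianBundle (fun x : M ↦ TangentSpace (𝓡∂ (n + 1)) x) :=
    ⟨g.toRiemannianMetric⟩
  have key : ∀ a : Coord n, ContMDiffOn 𝓘(ℝ, Coord n) ((𝓡∂ (n + 1)).tangent) ∞
      (fun y : Coord n ↦ (ofCoord x₀ (y, a) : TBundle n M))
      (extChartAt (𝓡∂ (n + 1)) x₀).target := by
    intro a
    have h1 : ContMDiffOn 𝓘(ℝ, Coord n × Coord n) ((𝓡∂ (n + 1)).tangent) ∞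
        (ofCoord x₀ : _ → TBundle n M) (coordTarget n x₀) := by
      rw [ofCoord_eq, coordTarget_eq]
      exact contMDiffOn_extChartAt_symm _
    have h2 : ContMDiffOn 𝓘(ℝ, Coord n) 𝓘(ℝ, Coord n × Coord n) ∞
        (fun y : Coord n ↦ (y, a)) (extChartAt (𝓡∂ (n + 1)) x₀).target :=
      ContDiff.contMDiff (by fun_prop) |>.contMDiffOn
    have h3 : (extChartAt (𝓡∂ (n + 1)) x₀).target ⊆
        (fun y : Coord n ↦ (y, a)) ⁻¹' coordTarget n x₀ := fun y hy ↦ ⟨hy, mem_univ _⟩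
    exact ContMDiffOn.comp h1 h2 h3
  have := ContMDiffOn.inner_bundle (F := Coord n) (IB := 𝓡∂ (n + 1)) (n := ∞)
    (E := fun x : M ↦ TangentSpace (𝓡∂ (n + 1)) x)
    (b := fun y ↦ (extChartAt (𝓡∂ (n + 1)) x₀).symm y)
    (v := fun y ↦ (ofCoord x₀ (y, a)).2) (w := fun y ↦ (ofCoord x₀ (y, b)).2) (key a) (key b)
  rw [contMDiffOn_iff_contDiffOn] at this
  exact this

end Charts

end

end Transport

namespace Transport

noncomputable section

/-! ### Christoffel symbols in charts -/

lemma sum_basisVec {n : ℕ} (a : Coord n) : ∑ i, a i • basisVec n i = a := by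
  ext j
  simp [basisVec, Finset.sum_apply, Pi.single_apply]

lemma bilin_eq_sum {n : ℕ} (B : Coord n →L[ℝ] Coord n →L[ℝ] ℝ) (a b : Coord n) :
    B a b = ∑ i, ∑ j, a i * b j * B (basisVec n i) (basisVec n j) := by
  conv_lhs => rw [← sum_basisVec a, ← sum_basisVec b]
  simp only [map_sum, map_smul, sum_apply, smul_apply,
    smul_eq_mul, Finset.mul_sum]
  rw [Finset.sum_comm]
  exact Finset.sum_congr rfl fun i _ ↦ Finset.sum_congr rfl fun j _ ↦ by ring

lemma contDiffOn_matrix_det {E : Type*} [NormedAddCommGroup E] [NormedSpace ℝ E]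
    {ι : Type*} [Fintype ι] [DecidableEq ι] {A : E → Matrix ι ι ℝ} {s : Set E} {m : WithTop ℕ∞}
    (hA : ∀ i j, ContDiffOn ℝ m (fun y ↦ A y i j) s) : ContDiffOn ℝ m (fun y ↦ (A y).det) s := by
  simp only [Matrix.det_apply]
  refine ContDiffOn.sum fun σ _ ↦ ?_
  exact (contDiffOn_prod fun i _ ↦ hA _ _).const_smul _

/-- Cramer's rule: the entries of the adjugate are determinants of matrices with one constant row.
-/
lemma contDiffOn_matrix_inv {E : Type*} [NormedAddCommGroup E] [NormedSpace ℝ E]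
    {ι : Type*} [Fintype ι] [DecidableEq ι] {A : E → Matrix ι ι ℝ} {s : Set E} {m : WithTop ℕ∞}
    (hA : ∀ i j, ContDiffOn ℝ m (fun y ↦ A y i j) s) (hdet : ∀ y ∈ s, (A y).det ≠ 0) (i j : ι) :
    ContDiffOn ℝ m (fun y ↦ (A y)⁻¹ i j) s := by
  have h : ∀ y, (A y)⁻¹ i j = (A y).det⁻¹ * (A y).adjugate i j := by
    intro y
    rw [Matrix.inv_def, Matrix.smul_apply, Ring.inverse_eq_inv', smul_eq_mul]
  simp only [h]
  refine ((contDiffOn_matrix_det hA).inv hdet).mul ?_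
  simp only [Matrix.adjugate_apply]
  refine contDiffOn_matrix_det fun k l ↦ ?_
  by_cases hk : k = j
  · subst hk
    simp only [Matrix.updateRow_self]
    exact contDiffOn_const
  · simp only [Matrix.updateRow_ne hk]
    exact hA k l

section Charts

variable {n : ℕ} {M : Type*} [TopologicalSpace M] [ChartedSpace (EuclideanHalfSpace (n + 1)) M]
  [IsManifold (𝓡∂ (n + 1)) ∞ M]

lemma posDef_metricMatrix (g : RMetric n M) {x₀ : M} {y : Coord n}
    (hy : y ∈ (extChartAt (𝓡∂ (n + 1)) x₀).target) : (metricMatrix g x₀ y).PosDef := by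
  refine Matrix.PosDef.of_dotProduct_mulVec_pos ?_ fun v hv ↦ ?_
  · ext i j
    change star (metricMatrix g x₀ y j i) = _
    rw [star_trivial, metricMatrix_apply, metricMatrix_apply]
    exact coordMetric_symm _ _ _ _ _
  · have h := coordMetric_pos g hy (a := WithLp.toLp 2 v) (fun h ↦ hv (by simpa using h))
    rw [bilin_eq_sum] at h
    refine h.trans_eq ?_
    simp only [dotProduct, Matrix.mulVec, Finset.mul_sum, metricMatrix_apply, Pi.star_apply,
      star_trivial]
    exact Finset.sum_congr rfl fun i _ ↦ Finset.sum_congr rfl fun j _ ↦ by ring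

lemma contDiffOn_metricMatrix (g : RMetric n M) (x₀ : M) (i j : Fin (n + 1)) :
    ContDiffOn ℝ ∞ (fun y ↦ metricMatrix g x₀ y i j) (extChartAt (𝓡∂ (n + 1)) x₀).target := by
  simp only [metricMatrix_apply]
  exact contDiffOn_coordMetric g x₀ _ _

/-- The derivative at `y` of the function `g(a, b)` in the chart at `x₀`. -/
def coordMetricDeriv (g : RMetric n M) (x₀ : M) (y a b : Coord n) : Coord n →L[ℝ] ℝ :=
  fderivWithin ℝ (fun y ↦ coordMetric g x₀ y a b) (range (𝓡∂ (n + 1))) y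

omit [IsManifold (𝓡∂ (n + 1)) ∞ M] in
lemma target_mem_nhdsWithin {x₀ : M} {y : Coord n}
    (hy : y ∈ (extChartAt (𝓡∂ (n + 1)) x₀).target) :
    (extChartAt (𝓡∂ (n + 1)) x₀).target ∈ 𝓝[range (𝓡∂ (n + 1))] y := by
  rw [extChartAt_target] at hy ⊢
  rw [inter_comm]
  exact inter_mem_nhdsWithin _
    (((chartAt _ x₀).open_target.preimage (𝓡∂ (n + 1)).continuous_symm).mem_nhds hy.1)

omit [IsManifold (𝓡∂ (n + 1)) ∞ M] in
lemma target_subset_range (x₀ : M) :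
    (extChartAt (𝓡∂ (n + 1)) x₀).target ⊆ range (𝓡∂ (n + 1)) := by
  rw [extChartAt_target]; exact inter_subset_right

lemma contDiffWithinAt_coordMetric (g : RMetric n M) {x₀ : M} {y : Coord n}
    (hy : y ∈ (extChartAt (𝓡∂ (n + 1)) x₀).target) (a b : Coord n) :
    ContDiffWithinAt ℝ ∞ (fun y ↦ coordMetric g x₀ y a b) (range (𝓡∂ (n + 1))) y :=
  (contDiffOn_coordMetric g x₀ a b y hy).mono_of_mem_nhdsWithin (target_mem_nhdsWithin hy)

lemma contDiffOn_coordMetricDeriv (g : RMetric n M) (x₀ : M) (a b : Coord n) :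
    ContDiffOn ℝ ∞ (fun y ↦ coordMetricDeriv g x₀ y a b)
      (extChartAt (𝓡∂ (n + 1)) x₀).target := by
  intro y hy
  exact ((contDiffWithinAt_coordMetric g hy a b).fderivWithin_right
    (𝓡∂ (n + 1)).uniqueDiffOn (by simp) (target_subset_range x₀ hy)).mono (target_subset_range x₀)

lemma hasFDerivWithinAt_coordMetric (g : RMetric n M) {x₀ : M} {y : Coord n}
    (hy : y ∈ (extChartAt (𝓡∂ (n + 1)) x₀).target) (a b : Coord n) :
    HasFDerivWithinAt (fun y ↦ coordMetric g x₀ y a b) (coordMetricDeriv g x₀ y a b)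
      (range (𝓡∂ (n + 1))) y :=
  ((contDiffWithinAt_coordMetric g hy a b).differentiableWithinAt (by simp)).hasFDerivWithinAt

/-- Bilinearity in `a` and `b` is inherited from the metric because derivatives within the half
space are unique. -/
lemma coordMetricDeriv_eq_sum (g : RMetric n M) {x₀ : M} {y : Coord n}
    (hy : y ∈ (extChartAt (𝓡∂ (n + 1)) x₀).target) (a b c : Coord n) :
    coordMetricDeriv g x₀ y a b c = ∑ i, ∑ j, a i * b j *
      coordMetricDeriv g x₀ y (basisVec n i) (basisVec n j) c := by
  have hu := (𝓡∂ (n + 1)).uniqueDiffOn _ (target_subset_range x₀ hy)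
  have h : HasFDerivWithinAt (fun y ↦ coordMetric g x₀ y a b)
      (∑ i, ∑ j, (a i * b j) • coordMetricDeriv g x₀ y (basisVec n i) (basisVec n j))
      (range (𝓡∂ (n + 1))) y := by
    simp only [bilin_eq_sum (coordMetric g x₀ _) a b]
    refine HasFDerivWithinAt.fun_sum fun i _ ↦ HasFDerivWithinAt.fun_sum fun j _ ↦ ?_
    exact (hasFDerivWithinAt_coordMetric g hy _ _).const_mul _
  rw [hu.eq (hasFDerivWithinAt_coordMetric g hy a b) h]
  simp [sum_apply]

/-- The Christoffel symbols in the chart at `x₀`, at the point with coordinates `y`. -/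
def coordChristoffel (g : RMetric n M) (x₀ : M) (y : Coord n) (k i j : Fin (n + 1)) : ℝ :=
  (1 / 2) * ∑ l, (metricMatrix g x₀ y)⁻¹ k l *
    (coordMetricDeriv g x₀ y (basisVec n j) (basisVec n l) (basisVec n i)
      + coordMetricDeriv g x₀ y (basisVec n i) (basisVec n l) (basisVec n j)
      - coordMetricDeriv g x₀ y (basisVec n i) (basisVec n j) (basisVec n l))

/-- The vector `Γ(w, w)` in the chart at `x₀`, at the point with coordinates `y`. -/
def coordGamma (g : RMetric n M) (x₀ : M) (y w : Coord n) : Coord n :=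
  WithLp.toLp 2 fun k ↦ ∑ i, ∑ j, coordChristoffel g x₀ y k i j * w i * w j

lemma metricDeriv_eq (g : RMetric n M) (x : M) (k i j : Fin (n + 1)) :
    metricDeriv g x k i j = coordMetricDeriv g x (extChartAt (𝓡∂ (n + 1)) x x)
      (basisVec n i) (basisVec n j) (basisVec n k) := rfl

lemma christoffelVec_eq (g : RMetric n M) (x : M) (v : TangentSpace (𝓡∂ (n + 1)) x) :
    christoffelVec g x v = coordGamma g x (extChartAt (𝓡∂ (n + 1)) x x) v := by
  ext k
  simp only [christoffelVec, christoffel, metricDeriv_eq]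
  rfl

/-- The Koszul formula. -/
lemma coordMetric_coordGamma (g : RMetric n M) {x₀ : M} {y : Coord n}
    (hy : y ∈ (extChartAt (𝓡∂ (n + 1)) x₀).target) (w b : Coord n) :
    coordMetric g x₀ y (coordGamma g x₀ y w) b
      = coordMetricDeriv g x₀ y w b w - 1 / 2 * coordMetricDeriv g x₀ y w w b := by
  set D : Fin (n + 1) → Fin (n + 1) → Fin (n + 1) → ℝ := fun i j l ↦
    coordMetricDeriv g x₀ y (basisVec n i) (basisVec n j) (basisVec n l) with hD
  set A := metricMatrix g x₀ y with hA
  have hdet := (posDef_metricMatrix g hy).det_pos.ne'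
  have hDsum : ∀ a b c, coordMetricDeriv g x₀ y a b c
      = ∑ i, ∑ j, ∑ l, a i * b j * c l * D i j l := by
    intro a b c
    rw [coordMetricDeriv_eq_sum g hy]
    refine Finset.sum_congr rfl fun i _ ↦ Finset.sum_congr rfl fun j _ ↦ ?_
    conv_lhs => rw [← sum_basisVec c]
    simp only [map_sum, map_smul, smul_eq_mul, Finset.mul_sum, hD]
    exact Finset.sum_congr rfl fun l _ ↦ by ring
  have hGsum : ∀ a b, coordMetric g x₀ y a b = ∑ m, b m * ∑ k, A m k * a k := by
    intro a b
    rw [coordMetric_symm, bilin_eq_sum]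
    simp only [Finset.mul_sum, hA, metricMatrix_apply]
    exact Finset.sum_congr rfl fun i _ ↦ Finset.sum_congr rfl fun j _ ↦ by ring
  have hΓ : ∀ k, coordGamma g x₀ y w k = ∑ l, A⁻¹ k l * (∑ i, ∑ j, w i * w j *
      (1 / 2 * (D j l i + D i l j - D i j l))) := by
    intro k
    simp only [coordGamma, coordChristoffel, Finset.mul_sum, Finset.sum_mul]
    rw [Finset.sum_comm' (t' := Finset.univ) (s' := fun _ ↦ Finset.univ) (by simp)]
    rw [Finset.sum_comm]
    conv_rhs => rw [Finset.sum_comm]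
    refine Finset.sum_congr rfl fun i _ ↦ ?_
    rw [Finset.sum_comm]
    refine Finset.sum_congr rfl fun l _ ↦ ?_
    refine Finset.sum_congr rfl fun j _ ↦ ?_
    simp only [hD, hA]
    ring
  have hAΓ : ∀ m, ∑ k, A m k * coordGamma g x₀ y w k = ∑ i, ∑ j, w i * w j *
      (1 / 2 * (D j m i + D i m j - D i j m)) := by
    intro m
    have h1 : coordGamma g x₀ y w = WithLp.toLp 2 (A⁻¹.mulVec fun l ↦ ∑ i, ∑ j, w i * w j *
      (1 / 2 * (D j l i + D i l j - D i j l))) := by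
      ext k; exact hΓ k
    have h2 : ∑ k, A m k * coordGamma g x₀ y w k = A.mulVec (coordGamma g x₀ y w).ofLp m := rfl
    rw [h2, h1, Matrix.mulVec_mulVec, Matrix.mul_nonsing_inv _ (isUnit_iff_ne_zero.2 hdet),
      Matrix.one_mulVec]
  rw [hGsum]
  simp only [hAΓ]
  have e1 : coordMetricDeriv g x₀ y w b w = ∑ m, b m * ∑ i, ∑ j, w i * w j * D i m j := by
    rw [hDsum]
    simp only [Finset.mul_sum]
    rw [Finset.sum_comm]
    exact Finset.sum_congr rfl fun m _ ↦ Finset.sum_congr rfl fun i _ ↦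
      Finset.sum_congr rfl fun j _ ↦ by ring
  have e2 : coordMetricDeriv g x₀ y w b w = ∑ m, b m * ∑ i, ∑ j, w i * w j * D j m i := by
    rw [e1]
    refine Finset.sum_congr rfl fun m _ ↦ ?_
    rw [Finset.sum_comm]
    congr 1
    exact Finset.sum_congr rfl fun i _ ↦ Finset.sum_congr rfl fun j _ ↦ by ring
  have e3 : coordMetricDeriv g x₀ y w w b = ∑ m, b m * ∑ i, ∑ j, w i * w j * D i j m := by
    rw [hDsum]
    simp only [Finset.mul_sum]
    conv_lhs => enter [2, i]; rw [Finset.sum_comm]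
    rw [Finset.sum_comm]
    exact Finset.sum_congr rfl fun m _ ↦ Finset.sum_congr rfl fun i _ ↦
      Finset.sum_congr rfl fun j _ ↦ by ring
  -- As `w i * w j` is symmetric, two of the three terms in the Christoffel symbol contribute
  -- equally; each carries the factor `1 / 2`.
  have e4 : coordMetricDeriv g x₀ y w b w = 1 / 2 * (∑ m, b m * ∑ i, ∑ j, w i * w j * D j m i)
      + 1 / 2 * (∑ m, b m * ∑ i, ∑ j, w i * w j * D i m j) := by
    rw [← e1, ← e2]; ring
  rw [e4, e3]
  simp only [Finset.mul_sum, ← Finset.sum_add_distrib, ← Finset.sum_sub_distrib]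
  exact Finset.sum_congr rfl fun m _ ↦ Finset.sum_congr rfl fun i _ ↦
      Finset.sum_congr rfl fun j _ ↦ by ring

lemma contDiffOn_coordGamma (g : RMetric n M) (x₀ : M) :
    ContDiffOn ℝ ∞ (fun z : Coord n × Coord n ↦ coordGamma g x₀ z.1 z.2) (coordTarget n x₀) := by
  rw [contDiffOn_euclidean]
  intro k
  simp only [coordGamma]
  refine ContDiffOn.sum fun i _ ↦ ContDiffOn.sum fun j _ ↦ ?_
  have hw : ∀ i, ContDiffOn ℝ ∞ (fun z : Coord n × Coord n ↦ z.2 i) (coordTarget n x₀) := by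
    intro i
    exact (contDiff_euclidean.1 contDiff_snd i).contDiffOn
  refine (ContDiffOn.mul ?_ (hw i)).mul (hw j)
  have hΓ : ContDiffOn ℝ ∞ (fun y ↦ coordChristoffel g x₀ y k i j)
      (extChartAt (𝓡∂ (n + 1)) x₀).target := by
    refine contDiffOn_const.mul (ContDiffOn.sum fun l _ ↦ ?_)
    refine (contDiffOn_matrix_inv (contDiffOn_metricMatrix g x₀)
      (fun y hy ↦ (posDef_metricMatrix g hy).det_pos.ne') k l).mul ?_
    have hD : ∀ a b c, ContDiffOn ℝ ∞ (fun y ↦ coordMetricDeriv g x₀ y a b c)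
        (extChartAt (𝓡∂ (n + 1)) x₀).target := fun a b c ↦
      (contDiffOn_coordMetricDeriv g x₀ a b).clm_apply contDiffOn_const
    exact ((hD _ _ _).add (hD _ _ _)).sub (hD _ _ _)
  exact hΓ.comp contDiffOn_fst fun z hz ↦ hz.1

end Charts

lemma hasDerivAt_coord {n : ℕ} {u : ℝ → Coord n} {u' : Coord n} {t : ℝ} (hu : HasDerivAt u u' t)
    (i : Fin (n + 1)) : HasDerivAt (fun s ↦ u s i) (u' i) t :=
  (EuclideanSpace.proj i : Coord n →L[ℝ] ℝ).hasFDerivAt.comp_hasDerivAt t hu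

/-- The derivative of a bilinear form along a curve. -/
lemma hasDerivAt_bilin {n : ℕ} {B : ℝ → Coord n →L[ℝ] Coord n →L[ℝ] ℝ} {D : Coord n → Coord n → ℝ}
    {t : ℝ} (hB : ∀ a b, HasDerivAt (fun s ↦ B s a b) (D a b) t) {u v : ℝ → Coord n}
    {u' v' : Coord n} (hu : HasDerivAt u u' t) (hv : HasDerivAt v v' t) :
    HasDerivAt (fun s ↦ B s (u s) (v s)) (D (u t) (v t) + B t u' (v t) + B t (u t) v') t := by
  -- Nothing is assumed about the dependence of `D` on `a` and `b`; uniqueness of derivatives forces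
  -- it to be bilinear.
  have hD : ∀ a b, D a b = ∑ i, ∑ j, a i * b j * D (basisVec n i) (basisVec n j) := by
    intro a b
    refine (hB a b).unique ?_
    simp only [bilin_eq_sum (B _) a b]
    exact HasDerivAt.fun_sum fun i _ ↦ HasDerivAt.fun_sum fun j _ ↦ (hB _ _).const_mul _
  have hui : ∀ i, HasDerivAt (fun s ↦ u s i) (u' i) t := fun i ↦ hasDerivAt_coord hu i
  have hvi : ∀ i, HasDerivAt (fun s ↦ v s i) (v' i) t := fun i ↦ hasDerivAt_coord hv i
  simp only [bilin_eq_sum (B _) (u _) (v _)]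
  rw [hD, bilin_eq_sum (B t) u', bilin_eq_sum (B t) _ v']
  simp only [← Finset.sum_add_distrib]
  refine HasDerivAt.fun_sum fun i _ ↦ HasDerivAt.fun_sum fun j _ ↦ ?_
  refine (((hui i).mul (hvi j)).mul (hB (basisVec n i) (basisVec n j))).congr_deriv ?_
  change (u' i * v t j + u t i * v' j) * B t (basisVec n i) (basisVec n j)
    + u t i * v t j * D (basisVec n i) (basisVec n j) = _
  ring

/-- The transformation law of the Christoffel symbols. -/
lemma koszul_transform {n : ℕ}
    {ψ : Coord n → Coord n} {G G' : Coord n → Coord n →L[ℝ] Coord n →L[ℝ] ℝ} {y : Coord n}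
    (hψ : ContDiffAt ℝ 2 ψ y)
    {D D' : Coord n → Coord n → Coord n →L[ℝ] ℝ}
    (hG : ∀ a b, HasFDerivAt (fun y ↦ G y a b) (D a b) y)
    (hG' : ∀ a b, HasFDerivAt (fun y ↦ G' y a b) (D' a b) (ψ y))
    (hGG' : ∀ᶠ y' in 𝓝 y, ∀ a b, G y' a b = G' (ψ y') (fderiv ℝ ψ y' a) (fderiv ℝ ψ y' b))
    (hsymm : ∀ a b, G' (ψ y) a b = G' (ψ y) b a)
    (hpos : ∀ a, (∀ b, G' (ψ y) a (fderiv ℝ ψ y b) = 0) → a = 0) {w Γ Γ' : Coord n}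
    (hΓ : ∀ b, G y Γ b = D w b w - 1 / 2 * D w w b)
    (hΓ' : ∀ b, G' (ψ y) Γ' b = D' (fderiv ℝ ψ y w) b (fderiv ℝ ψ y w)
      - 1 / 2 * D' (fderiv ℝ ψ y w) (fderiv ℝ ψ y w) b) :
    Γ' = fderiv ℝ ψ y Γ - fderiv ℝ (fderiv ℝ ψ) y w w := by
  have hd : DifferentiableAt ℝ ψ y := hψ.differentiableAt (by norm_num)
  have hdd : DifferentiableAt ℝ (fderiv ℝ ψ) y :=
    (hψ.fderiv_right (m := 1) (by norm_num)).differentiableAt (by norm_num)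
  have hsym2 : ∀ a b, fderiv ℝ (fderiv ℝ ψ) y a b = fderiv ℝ (fderiv ℝ ψ) y b a :=
    fun a b ↦ (hψ.isSymmSndFDerivAt (by simp)) a b
  -- The product rule for the pulled back metric, along the line `y + t • c`.
  have hDer : ∀ c a b, D a b c = D' (fderiv ℝ ψ y a) (fderiv ℝ ψ y b) (fderiv ℝ ψ y c)
      + G' (ψ y) (fderiv ℝ (fderiv ℝ ψ) y c a) (fderiv ℝ ψ y b)
      + G' (ψ y) (fderiv ℝ ψ y a) (fderiv ℝ (fderiv ℝ ψ) y c b) := by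
    intro c a b
    have hline : HasDerivAt (fun t : ℝ ↦ y + t • c) c 0 := by
      simpa using ((hasDerivAt_id (0 : ℝ)).smul_const c).const_add y
    have h0 : y + (0 : ℝ) • c = y := by simp
    have hψl : HasDerivAt (fun t : ℝ ↦ ψ (y + t • c)) (fderiv ℝ ψ y c) 0 :=
      hd.hasFDerivAt.comp_hasDerivAt_of_eq 0 hline h0.symm
    have h1 : HasDerivAt (fun t : ℝ ↦ G (y + t • c) a b) (D a b c) 0 :=
      (hG a b).comp_hasDerivAt_of_eq 0 hline h0.symm
    have h2 : ∀ e, HasDerivAt (fun t : ℝ ↦ fderiv ℝ ψ (y + t • c) e)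
        (fderiv ℝ (fderiv ℝ ψ) y c e) 0 := by
      intro e
      have h3 : HasDerivAt (fun t : ℝ ↦ fderiv ℝ ψ (y + t • c)) (fderiv ℝ (fderiv ℝ ψ) y c) 0 :=
        hdd.hasFDerivAt.comp_hasDerivAt_of_eq 0 hline h0.symm
      exact ((ContinuousLinearMap.apply ℝ (Coord n) e).hasFDerivAt.comp_hasDerivAt 0 h3)
    have h3 : ∀ a b, HasDerivAt (fun t : ℝ ↦ G' (ψ (y + t • c)) a b)
        (D' a b (fderiv ℝ ψ y c)) 0 := by
      intro a b
      exact (hG' a b).comp_hasDerivAt_of_eq 0 hψl (by rw [h0])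
    have h4 := hasDerivAt_bilin h3 (h2 a) (h2 b)
    have h5 : (fun t : ℝ ↦ G (y + t • c) a b) =ᶠ[𝓝 0] fun t : ℝ ↦
        G' (ψ (y + t • c)) (fderiv ℝ ψ (y + t • c) a) (fderiv ℝ ψ (y + t • c) b) := by
      have hc : Tendsto (fun t : ℝ ↦ y + t • c) (𝓝 0) (𝓝 y) := by
        simpa using hline.continuousAt.tendsto
      filter_upwards [hc.eventually hGG'] with t ht
      exact ht a b
    have := h1.unique (h4.congr_of_eventuallyEq h5)
    simp only [h0] at this
    exact this
  -- The two Koszul formulas are subtracted. By symmetry of the second derivative of `ψ` and of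
  -- `G'`, all second order terms cancel except the one with `w, w`. The difference of the two sides
  -- is thus orthogonal to the whole image of the derivative of `ψ`.
  rw [← sub_eq_zero]
  refine hpos _ fun b ↦ ?_
  have hΓb := hΓ b
  rw [hGG'.self_of_nhds, hDer, hDer] at hΓb
  have e1 := hsym2 w b
  have e2 := hsymm (fderiv ℝ ψ y w) (fderiv ℝ (fderiv ℝ ψ) y b w)
  rw [e1] at hΓb
  have e3 := hΓ' (fderiv ℝ ψ y b)
  rw [map_sub, map_sub, sub_apply, sub_apply]
  linarith

end

end Transport

/-! ### Changes of coordinates, and the geodesic equation in an arbitrary chart -/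

namespace Transport

noncomputable section

section Charts

variable {n : ℕ} {M : Type*} [TopologicalSpace M] [ChartedSpace (EuclideanHalfSpace (n + 1)) M]

lemma mem_range_iff {y : Coord n} : y ∈ range (𝓡∂ (n + 1)) ↔ 0 ≤ y 0 := by
  rw [range_modelWithCornersEuclideanHalfSpace]; rfl

lemma target_nonneg {x₀ : M} {y : Coord n} (hy : y ∈ (extChartAt (𝓡∂ (n + 1)) x₀).target) :
    0 ≤ y 0 := mem_range_iff.1 (target_subset_range x₀ hy)

lemma range_mem_nhds {y : Coord n} (hy : 0 < y 0) : range (𝓡∂ (n + 1)) ∈ 𝓝 y := by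
  have h : Continuous fun y : Coord n ↦ y 0 := by fun_prop
  filter_upwards [(isOpen_lt continuous_const h).mem_nhds hy] with z hz
  exact mem_range_iff.2 (le_of_lt hz)

lemma target_mem_nhds {x₀ : M} {y : Coord n} (hy : y ∈ (extChartAt (𝓡∂ (n + 1)) x₀).target)
    (h0 : 0 < y 0) : (extChartAt (𝓡∂ (n + 1)) x₀).target ∈ 𝓝 y := by
  have := target_mem_nhdsWithin hy
  rwa [nhdsWithin_eq_nhds.2 (range_mem_nhds h0)] at this

variable [IsManifold (𝓡∂ (n + 1)) ∞ M]

/-- Being an interior point may be tested in any chart of the atlas, and every chart takes values in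
the half space. -/
lemma mem_interior_iff {x₀ m : M} (hm : m ∈ (extChartAt (𝓡∂ (n + 1)) x₀).source) :
    m ∈ (𝓡∂ (n + 1)).interior M ↔ 0 < extChartAt (𝓡∂ (n + 1)) x₀ m 0 := by
  have h := ModelWithCorners.isInteriorPoint_iff_of_mem_atlas (I := 𝓡∂ (n + 1)) (n := ∞)
    (by simp) (chart_mem_atlas _ x₀) (by simpa using hm)
  change (𝓡∂ (n + 1)).IsInteriorPoint m ↔ _
  rw [h]
  change extChartAt (𝓡∂ (n + 1)) x₀ m ∈ interior (extChartAt (𝓡∂ (n + 1)) x₀).target ↔ _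
  constructor
  · intro hi
    have := interior_mono (target_subset_range x₀) hi
    rw [interior_range_modelWithCornersEuclideanHalfSpace] at this
    exact this
  · intro h0
    exact mem_interior_iff_mem_nhds.2
      (target_mem_nhds ((extChartAt (𝓡∂ (n + 1)) x₀).map_source hm) h0)

lemma mem_boundary_iff {x₀ m : M} (hm : m ∈ (extChartAt (𝓡∂ (n + 1)) x₀).source) :
    m ∈ (𝓡∂ (n + 1)).boundary M ↔ extChartAt (𝓡∂ (n + 1)) x₀ m 0 = 0 := by
  rw [← (𝓡∂ (n + 1)).compl_interior, mem_compl_iff, mem_interior_iff hm, not_lt]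
  exact ⟨fun h ↦ h.antisymm (target_nonneg ((extChartAt (𝓡∂ (n + 1)) x₀).map_source hm)),
    fun h ↦ h.le⟩

/-- The coordinate change from the chart at `x` to the chart at `x₀`. -/
def transition (x x₀ : M) : Coord n → Coord n :=
  extChartAt (𝓡∂ (n + 1)) x₀ ∘ (extChartAt (𝓡∂ (n + 1)) x).symm

/-- The domain of the coordinate change. -/
def transitionSource (n : ℕ) {M : Type*} [TopologicalSpace M]
    [ChartedSpace (EuclideanHalfSpace (n + 1)) M] (x x₀ : M) : Set (Coord n) :=
  (extChartAt (𝓡∂ (n + 1)) x).target ∩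
    (extChartAt (𝓡∂ (n + 1)) x).symm ⁻¹' (extChartAt (𝓡∂ (n + 1)) x₀).source

omit [IsManifold (𝓡∂ (n + 1)) ∞ M] in
lemma mem_transitionSource_iff {x x₀ : M} {y : Coord n} : y ∈ transitionSource n x x₀ ↔
    y ∈ ((extChartAt (𝓡∂ (n + 1)) x).symm ≫ extChartAt (𝓡∂ (n + 1)) x₀).source := by
  rw [PartialEquiv.trans_source]; rfl

lemma contDiffWithinAt_transition {x x₀ : M} {y : Coord n} (hy : y ∈ transitionSource n x x₀) :
    ContDiffWithinAt ℝ ∞ (transition x x₀) (range (𝓡∂ (n + 1))) y :=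
  contDiffWithinAt_ext_coord_change x₀ x (mem_transitionSource_iff.1 hy)

lemma tangentCoordChange_symm {x x₀ : M} {y : Coord n} (hy : y ∈ transitionSource n x x₀) :
    tangentCoordChange (𝓡∂ (n + 1)) x x₀ ((extChartAt (𝓡∂ (n + 1)) x).symm y)
      = fderivWithin ℝ (transition x x₀) (range (𝓡∂ (n + 1))) y := by
  rw [tangentCoordChange_def, (extChartAt (𝓡∂ (n + 1)) x).right_inv hy.1]
  rfl

lemma coordMap_ofCoord_transition {x x₀ : M} {z : Coord n × Coord n}
    (hy : z.1 ∈ transitionSource n x x₀) :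
    coordMap x₀ (ofCoord x z : TBundle n M)
      = (transition x x₀ z.1, fderivWithin ℝ (transition x x₀) (range (𝓡∂ (n + 1))) z.1 z.2) := by
  refine Prod.ext rfl ?_
  rw [← tangentCoordChange_symm hy]
  exact tangentCoordChange_comp ⟨⟨(extChartAt (𝓡∂ (n + 1)) x).map_target hy.1,
    mem_extChartAt_source _⟩, hy.2⟩

lemma coordMetric_extChartAt (g : RMetric n M) {x₀ m : M}
    (hm : m ∈ (extChartAt (𝓡∂ (n + 1)) x₀).source) (a b : Coord n) :
    coordMetric g x₀ (extChartAt (𝓡∂ (n + 1)) x₀ m) a b = g.inner m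
      (tangentCoordChange (𝓡∂ (n + 1)) x₀ m m a) (tangentCoordChange (𝓡∂ (n + 1)) x₀ m m b) := by
  have key : ∀ m', m' = m → g.inner m'
      (tangentCoordChange (𝓡∂ (n + 1)) x₀ m' m' a) (tangentCoordChange (𝓡∂ (n + 1)) x₀ m' m' b)
      = g.inner m
      (tangentCoordChange (𝓡∂ (n + 1)) x₀ m m a)
      (tangentCoordChange (𝓡∂ (n + 1)) x₀ m m b) := by
    rintro _ rfl; rfl
  rw [coordMetric_apply]
  exact key _ ((extChartAt (𝓡∂ (n + 1)) x₀).left_inv hm)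

lemma coordMetric_transition (g : RMetric n M) {x x₀ : M} {y : Coord n}
    (hy : y ∈ transitionSource n x x₀) (a b : Coord n) :
    coordMetric g x y a b = coordMetric g x₀ (transition x x₀ y)
      (fderivWithin ℝ (transition x x₀) (range (𝓡∂ (n + 1))) y a)
      (fderivWithin ℝ (transition x x₀) (range (𝓡∂ (n + 1))) y b) := by
  rw [← tangentCoordChange_symm hy]
  have h1 := coordMetric_extChartAt g ((extChartAt (𝓡∂ (n + 1)) x).map_target hy.1) a b
  rw [(extChartAt (𝓡∂ (n + 1)) x).right_inv hy.1] at h1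
  rw [h1]
  refine Eq.trans ?_ (coordMetric_extChartAt g hy.2 _ _).symm
  have h2 : ∀ a : Coord n, tangentCoordChange (𝓡∂ (n + 1)) x₀
      ((extChartAt (𝓡∂ (n + 1)) x).symm y) ((extChartAt (𝓡∂ (n + 1)) x).symm y)
      (tangentCoordChange (𝓡∂ (n + 1)) x x₀ ((extChartAt (𝓡∂ (n + 1)) x).symm y) a)
      = tangentCoordChange (𝓡∂ (n + 1)) x
      ((extChartAt (𝓡∂ (n + 1)) x).symm y) ((extChartAt (𝓡∂ (n + 1)) x).symm y) a := fun a ↦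
    tangentCoordChange_comp ⟨⟨(extChartAt (𝓡∂ (n + 1)) x).map_target hy.1, hy.2⟩,
      mem_extChartAt_source _⟩
  rw [h2, h2]

omit [IsManifold (𝓡∂ (n + 1)) ∞ M] in
lemma transition_transition {x x₀ : M} {y : Coord n} (hy : y ∈ transitionSource n x x₀) :
    transition x₀ x (transition x x₀ y) = y := by
  simp only [transition, Function.comp_apply]
  rw [(extChartAt (𝓡∂ (n + 1)) x₀).left_inv hy.2, (extChartAt (𝓡∂ (n + 1)) x).right_inv hy.1]

omit [IsManifold (𝓡∂ (n + 1)) ∞ M] in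
lemma transition_mem {x x₀ : M} {y : Coord n} (hy : y ∈ transitionSource n x x₀) :
    transition x x₀ y ∈ transitionSource n x₀ x := by
  refine ⟨(extChartAt (𝓡∂ (n + 1)) x₀).map_source hy.2, ?_⟩
  simp only [transition, Function.comp_apply, mem_preimage]
  rw [(extChartAt (𝓡∂ (n + 1)) x₀).left_inv hy.2]
  exact (extChartAt (𝓡∂ (n + 1)) x).map_target hy.1

lemma fderivWithin_transition_comp {x x₀ : M} {y : Coord n} (hy : y ∈ transitionSource n x x₀)
    (a : Coord n) : fderivWithin ℝ (transition x₀ x) (range (𝓡∂ (n + 1))) (transition x x₀ y)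
      (fderivWithin ℝ (transition x x₀) (range (𝓡∂ (n + 1))) y a) = a := by
  rw [← tangentCoordChange_symm hy, ← tangentCoordChange_symm (transition_mem hy)]
  have h : (extChartAt (𝓡∂ (n + 1)) x₀).symm (transition x x₀ y)
      = (extChartAt (𝓡∂ (n + 1)) x).symm y := (extChartAt (𝓡∂ (n + 1)) x₀).left_inv hy.2
  rw [h, tangentCoordChange_comp ⟨⟨(extChartAt (𝓡∂ (n + 1)) x).map_target hy.1, hy.2⟩,
    (extChartAt (𝓡∂ (n + 1)) x).map_target hy.1⟩]
  exact tangentCoordChange_self ((extChartAt (𝓡∂ (n + 1)) x).map_target hy.1)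

omit [IsManifold (𝓡∂ (n + 1)) ∞ M] in
lemma transitionSource_mem_nhds {x x₀ : M} {y : Coord n} (hy : y ∈ transitionSource n x x₀)
    (h0 : 0 < y 0) : transitionSource n x x₀ ∈ 𝓝 y :=
  inter_mem (target_mem_nhds hy.1 h0)
    (((continuousOn_extChartAt_symm x).continuousAt (target_mem_nhds hy.1 h0)).preimage_mem_nhds
      ((isOpen_extChartAt_source x₀).mem_nhds hy.2))

lemma fderivWithin_range_eq {E : Type*} [NormedAddCommGroup E] [NormedSpace ℝ E]
    {f : Coord n → E} {y : Coord n} (h0 : 0 < y 0) :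
    fderivWithin ℝ f (range (𝓡∂ (n + 1))) y = fderiv ℝ f y :=
  fderivWithin_of_mem_nhds (range_mem_nhds h0)

lemma eventually_pos {y : Coord n} (h0 : 0 < y 0) : ∀ᶠ y' in 𝓝 y, 0 < y' 0 := by
  have h : Continuous fun y : Coord n ↦ y 0 := by fun_prop
  exact (isOpen_lt continuous_const h).mem_nhds h0

lemma transition_pos {x x₀ : M} {y : Coord n} (hy : y ∈ transitionSource n x x₀) (h0 : 0 < y 0) :
    0 < transition x x₀ y 0 := by
  have h := mem_interior_iff ((extChartAt (𝓡∂ (n + 1)) x).map_target hy.1)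
  rw [(extChartAt (𝓡∂ (n + 1)) x).right_inv hy.1] at h
  exact (mem_interior_iff hy.2).1 (h.2 h0)

/-- At interior points the derivative within the half space is the ordinary one, so that
`koszul_transform` applies. This suffices, since the geodesic equation is used only at interior
points. -/
lemma coordGamma_transition (g : RMetric n M) {x x₀ : M} {y : Coord n}
    (hy : y ∈ transitionSource n x x₀) (h0 : 0 < y 0) (w : Coord n) :
    coordGamma g x₀ (transition x x₀ y) (fderiv ℝ (transition x x₀) y w)
      = fderiv ℝ (transition x x₀) y (coordGamma g x y w)
        - fderiv ℝ (fderiv ℝ (transition x x₀)) y w w := by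
  have hψ : ContDiffAt ℝ ∞ (transition x x₀) y :=
    (contDiffWithinAt_transition hy).contDiffAt (range_mem_nhds h0)
  have hy' := transition_mem hy
  have h0' := transition_pos hy h0
  refine koszul_transform (G := coordMetric g x) (G' := coordMetric g x₀)
    (D := coordMetricDeriv g x y)
    (D' := coordMetricDeriv g x₀ (transition x x₀ y)) (hψ.of_le ENat.LEInfty.out)
    (fun a b ↦ (hasFDerivWithinAt_coordMetric g hy.1 a b).hasFDerivAt (range_mem_nhds h0))
    (fun a b ↦ (hasFDerivWithinAt_coordMetric g hy'.1 a b).hasFDerivAt (range_mem_nhds h0'))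
    ?_ (coordMetric_symm g x₀ _) ?_ (coordMetric_coordGamma g hy.1 w)
    (coordMetric_coordGamma g hy'.1 _)
  · filter_upwards [transitionSource_mem_nhds hy h0, eventually_pos h0] with y' hy' h0' a b
    rw [coordMetric_transition g hy', fderivWithin_range_eq h0']
  · intro a ha
    by_contra hne
    have h1 := coordMetric_pos g hy'.1 hne
    have h2 := ha (fderivWithin ℝ (transition x₀ x) (range (𝓡∂ (n + 1))) (transition x x₀ y) a)
    have h3 := fderivWithin_transition_comp hy' a
    rw [transition_transition hy, fderivWithin_range_eq h0] at h3
    rw [h3] at h2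
    exact h1.ne' h2

/-- The geodesic equation in the chart at `x₀`. -/
lemma hasDerivAt_coordMap (g : RMetric n M) {c : ℝ → TBundle n M} {s : ℝ} {S : Set ℝ}
    (hc : IsMIntegralCurveOn c (geodesicField g) S) (hs : S ∈ 𝓝 s)
    (hint : (c s).1 ∈ (𝓡∂ (n + 1)).interior M) {x₀ : M} (hx : c s ∈ coordSource n x₀) :
    HasDerivAt (fun r ↦ coordMap x₀ (c r))
      ((coordMap x₀ (c s)).2, -coordGamma g x₀ (coordMap x₀ (c s)).1 (coordMap x₀ (c s)).2) s := by
  set x := (c s).1 with hx_def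
  have h1 := ((hc s (mem_of_mem_nhds hs)).hasMFDerivAt hs)
  have hcont : ContinuousAt c s := h1.continuousAt
  -- The definition of an integral curve gives the derivative at `s` in the chart at the base point
  -- of `c s` itself. The chart at `x₀` is reached by the chain rule for `transition`.
  have h2 : HasFDerivAt (fun r ↦ coordMap x (c r))
      ((1 : ℝ →L[ℝ] ℝ).smulRight (geodesicField g (c s) : Coord n × Coord n)) s := by
    have := h1.2
    simp only [writtenInExtChartAt, extChartAt_model_space_eq_id, modelWithCornersSelf_coe,
      range_id] at this
    rw [← hasFDerivWithinAt_univ]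
    exact this
  have h3 : HasDerivAt (fun r ↦ coordMap x (c r)) (geodesicField g (c s) : Coord n × Coord n) s := by
    refine h2.hasDerivAt.congr_deriv ?_
    change (1 : ℝ) • (geodesicField g (c s) : Coord n × Coord n) = _
    exact one_smul _ _
  have hself : coordMap x (c s) = (extChartAt (𝓡∂ (n + 1)) x x, (c s).2) :=
    Prod.ext rfl (tangentCoordChange_self (mem_extChartAt_source x))
  set y : Coord n := extChartAt (𝓡∂ (n + 1)) x x with hy_def
  set w : Coord n := (c s).2 with hw_def
  have hy : y ∈ transitionSource n x x₀ := by
    refine ⟨mem_extChartAt_target x, ?_⟩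
    rw [mem_preimage, hy_def, extChartAt_to_inv x]
    exact hx
  have h0 : 0 < y 0 := (mem_interior_iff (mem_extChartAt_source x)).1 hint
  have hψ : ContDiffAt ℝ ∞ (transition x x₀) y :=
    (contDiffWithinAt_transition hy).contDiffAt (range_mem_nhds h0)
  have hd := (hψ.differentiableAt (by simp)).hasFDerivAt
  have hdd := (((hψ.of_le (m := 2) ENat.LEInfty.out).fderiv_right (m := 1)
    (by norm_num)).differentiableAt (by norm_num)).hasFDerivAt
  have h3' : HasDerivAt (fun r ↦ coordMap x (c r)) (w, -coordGamma g x y w) s :=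
    h3.congr_deriv (Prod.ext rfl (congrArg Neg.neg (christoffelVec_eq g x w)))
  have hfst : HasDerivAt (fun r ↦ (coordMap x (c r)).1) w s :=
    (ContinuousLinearMap.fst ℝ (Coord n) (Coord n)).hasFDerivAt.comp_hasDerivAt s h3'
  have hsnd : HasDerivAt (fun r ↦ (coordMap x (c r)).2) (-coordGamma g x y w) s :=
    (ContinuousLinearMap.snd ℝ (Coord n) (Coord n)).hasFDerivAt.comp_hasDerivAt s h3'
  have hy1 : y = (coordMap x (c s)).1 := by rw [hself]
  have h4 : HasDerivAt (fun r ↦ transition x x₀ (coordMap x (c r)).1)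
      (fderiv ℝ (transition x x₀) y w) s := hd.comp_hasDerivAt_of_eq s hfst hy1
  have h5 : HasDerivAt (fun r ↦ fderiv ℝ (transition x x₀) (coordMap x (c r)).1)
      (fderiv ℝ (fderiv ℝ (transition x x₀)) y w) s := hdd.comp_hasDerivAt_of_eq s hfst hy1
  have h6 := h5.clm_apply hsnd
  have h7 : HasDerivAt (fun r ↦ (transition x x₀ (coordMap x (c r)).1,
      fderiv ℝ (transition x x₀) (coordMap x (c r)).1 (coordMap x (c r)).2))
      ((coordMap x₀ (c s)).2, -coordGamma g x₀ (coordMap x₀ (c s)).1 (coordMap x₀ (c s)).2) s := by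
    have hcs : coordMap x₀ (c s) = (transition x x₀ y, fderiv ℝ (transition x x₀) y w) := by
      have := coordMap_ofCoord_transition (x := x) (x₀ := x₀) (z := coordMap x (c s))
        (by rw [hself]; exact hy)
      rw [ofCoord_coordMap (mem_coordSource_self (c s)), hself] at this
      rw [this, fderivWithin_range_eq h0]
    rw [hcs]
    refine (h4.prodMk h6).congr_deriv (Prod.ext rfl ?_)
    simp only [hself]
    rw [coordGamma_transition g hy h0]
    simp only [map_neg]
    abel
  -- Near `s` the curve lies in both charts and over the interior, where `transition` and its
  -- derivative relate the coordinates.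
  refine h7.congr_of_eventuallyEq ?_
  have e1 : ∀ᶠ r in 𝓝 s, c r ∈ coordSource n x :=
    hcont.eventually ((isOpen_coordSource x).mem_nhds (mem_coordSource_self (c s)))
  have e2 : ∀ᶠ r in 𝓝 s, c r ∈ coordSource n x₀ :=
    hcont.eventually ((isOpen_coordSource x₀).mem_nhds hx)
  have e3 : ∀ᶠ r in 𝓝 s, 0 < (coordMap x (c r)).1 0 := by
    have : ContinuousAt (fun r ↦ (coordMap x (c r)).1) s := hfst.continuousAt
    have h8 : 0 < (coordMap x (c s)).1 0 := by rw [← hy1]; exact h0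
    exact this.eventually (eventually_pos h8)
  filter_upwards [e1, e2, e3] with r hr1 hr2 hr3
  have hmem : (coordMap x (c r)).1 ∈ transitionSource n x x₀ := by
    refine ⟨(coordMap_mem hr1).1, ?_⟩
    have : (extChartAt (𝓡∂ (n + 1)) x).symm (coordMap x (c r)).1 = (c r).1 :=
      (extChartAt (𝓡∂ (n + 1)) x).left_inv hr1
    rw [mem_preimage, this]
    exact hr2
  have := coordMap_ofCoord_transition (x := x) (x₀ := x₀) (z := coordMap x (c r)) hmem
  rw [ofCoord_coordMap hr1, fderivWithin_range_eq hr3] at this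
  exact this

end Charts

end

end Transport

namespace Transport

noncomputable section

open scoped NNReal

/-! ### Grönwall estimates -/

section Gronwall

variable {F : Type*} [NormedAddCommGroup F] [NormedSpace ℝ F]

/-- `f` solves `f' = v(f)` on `[a, b]` and stays in `K`. -/
structure IsTrajectory (v : F → F) (K : Set F) (f : ℝ → F) (a b : ℝ) : Prop where
  cont : ContinuousOn f (Icc a b)
  deriv : ∀ s ∈ Ioo a b, HasDerivAt f (v (f s)) s
  mem : ∀ s ∈ Icc a b, f s ∈ K

lemma IsTrajectory.mono {v : F → F} {K : Set F} {f : ℝ → F} {a b a' b' : ℝ}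
    (h : IsTrajectory v K f a b) (ha : a ≤ a') (hb : b' ≤ b) : IsTrajectory v K f a' b' :=
  ⟨h.cont.mono (Icc_subset_Icc ha hb), fun s hs ↦ h.deriv s (Ioo_subset_Ioo ha hb hs),
    fun s hs ↦ h.mem s (Icc_subset_Icc ha hb hs)⟩

lemma IsTrajectory.neg {v : F → F} {K : Set F} {f : ℝ → F} {a b : ℝ}
    (h : IsTrajectory v K f a b) :
    IsTrajectory (fun z ↦ -v z) K (fun s ↦ f (-s)) (-b) (-a) := by
  refine ⟨h.cont.comp (by fun_prop) fun s hs ↦ ?_, fun s hs ↦ ?_, fun s hs ↦ ?_⟩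
  · exact ⟨by linarith [hs.2], by linarith [hs.1]⟩
  · have := (h.deriv (-s) ⟨by linarith [hs.2], by linarith [hs.1]⟩).scomp s (hasDerivAt_neg s)
    exact this.congr_deriv (by simp)
  · exact h.mem _ ⟨by linarith [hs.2], by linarith [hs.1]⟩

/-- Grönwall's inequality on `[s, b]` with `s > a`, followed by `s → a`. The limit is taken because
the equation is assumed only in the open interval: geodesics may reach the boundary at their end
points. -/
lemma IsTrajectory.dist_le {v : F → F} {K : Set F} {L : ℝ≥0} (hv : LipschitzOnWith L v K)
    {f f' : ℝ → F} {a b : ℝ} (hab : a ≤ b) (h : IsTrajectory v K f a b)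
    (h' : IsTrajectory v K f' a b) :
    dist (f b) (f' b) ≤ Real.exp (L * (b - a)) * dist (f a) (f' a) := by
  rcases hab.eq_or_lt with rfl | hab
  · simp
  have key : ∀ᶠ s in 𝓝[>] a, dist (f b) (f' b) ≤ dist (f s) (f' s) * Real.exp (L * (b - s)) := by
    filter_upwards [Ioo_mem_nhdsGT hab] with s hs
    have hss : Icc s b ⊆ Icc a b := Icc_subset_Icc_left hs.1.le
    exact dist_le_of_trajectories_ODE_of_mem (v := fun _ ↦ v) (s := fun _ ↦ K)
      (fun _ _ ↦ hv) (h.cont.mono hss)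
      (fun t ht ↦ (h.deriv t ⟨hs.1.trans_le ht.1, ht.2⟩).hasDerivWithinAt)
      (fun t ht ↦ h.mem t (hss (Ico_subset_Icc_self ht))) (h'.cont.mono hss)
      (fun t ht ↦ (h'.deriv t ⟨hs.1.trans_le ht.1, ht.2⟩).hasDerivWithinAt)
      (fun t ht ↦ h'.mem t (hss (Ico_subset_Icc_self ht))) le_rfl b ⟨hs.2.le, le_rfl⟩
  have hlim : Tendsto (fun s ↦ dist (f s) (f' s) * Real.exp (L * (b - s))) (𝓝[>] a)
      (𝓝 (dist (f a) (f' a) * Real.exp (L * (b - a)))) := by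
    have hle : 𝓝[>] a ≤ 𝓝[Icc a b] a := by
      rw [← nhdsWithin_Ioo_eq_nhdsGT hab]
      exact nhdsWithin_mono _ Ioo_subset_Icc_self
    have h1 := ((h.cont a ⟨le_rfl, hab.le⟩).mono_left hle)
    have h2 := ((h'.cont a ⟨le_rfl, hab.le⟩).mono_left hle)
    refine (h1.dist h2).mul ?_
    have : Continuous fun s ↦ Real.exp (L * (b - s)) := by fun_prop
    exact this.continuousAt.tendsto.mono_left nhdsWithin_le_nhds
  rw [mul_comm]
  exact ge_of_tendsto hlim key

/-- Reversal of time reduces this to `-v`, which has the same Lipschitz constant. -/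
lemma IsTrajectory.dist_le' {v : F → F} {K : Set F} {L : ℝ≥0} (hv : LipschitzOnWith L v K)
    {f f' : ℝ → F} {a b : ℝ} (hab : a ≤ b) (h : IsTrajectory v K f a b)
    (h' : IsTrajectory v K f' a b) :
    dist (f a) (f' a) ≤ Real.exp (L * (b - a)) * dist (f b) (f' b) := by
  have hv' : LipschitzOnWith L (fun z ↦ -v z) K := by
    intro x hx y hy
    rw [edist_neg_neg]
    exact hv hx hy
  have := IsTrajectory.dist_le hv' (neg_le_neg hab) h.neg h'.neg
  simp only [neg_neg] at this
  rwa [show -a - -b = b - a by ring] at this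

lemma IsTrajectory.lipschitz {v : F → F} {K : Set F} {C : ℝ≥0} (hC : ∀ z ∈ K, ‖v z‖₊ ≤ C)
    {f : ℝ → F} {a b : ℝ} (h : IsTrajectory v K f a b) : LipschitzOnWith C f (Icc a b) := by
  rcases lt_trichotomy a b with hab | rfl | hab
  · have h1 : LipschitzOnWith C f (Ioo a b) :=
      (convex_Ioo a b).lipschitzOnWith_of_nnnorm_hasDerivWithin_le
        (fun s hs ↦ (h.deriv s hs).hasDerivWithinAt)
        (fun s hs ↦ hC _ (h.mem s (Ioo_subset_Icc_self hs)))
    rw [← closure_Ioo hab.ne]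
    exact h1.closure (by rw [closure_Ioo hab.ne]; exact h.cont)
  · simp [LipschitzOnWith]
  · simp [Icc_eq_empty hab.not_ge]

end Gronwall

section Charts

variable {n : ℕ} {M : Type*} [TopologicalSpace M] [ChartedSpace (EuclideanHalfSpace (n + 1)) M]
  [IsManifold (𝓡∂ (n + 1)) ∞ M]

/-! ### The unit speed field -/

/-- The square of the length of a tangent vector. -/
def sqNorm (g : RMetric n M) (p : TBundle n M) : ℝ := g.inner p.1 p.2 p.2

lemma contDiffOn_sqNorm_coord (g : RMetric n M) (x₀ : M) :
    ContDiffOn ℝ ∞ (fun z : Coord n × Coord n ↦ coordMetric g x₀ z.1 z.2 z.2)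
      (coordTarget n x₀) := by
  simp only [fun z : Coord n × Coord n ↦ bilin_eq_sum (coordMetric g x₀ z.1) z.2 z.2]
  have hw : ∀ i, ContDiffOn ℝ ∞ (fun z : Coord n × Coord n ↦ z.2 i) (coordTarget n x₀) :=
    fun i ↦ (contDiff_euclidean.1 contDiff_snd i).contDiffOn
  refine ContDiffOn.sum fun i _ ↦ ContDiffOn.sum fun j _ ↦ ((hw i).mul (hw j)).mul ?_
  exact (contDiffOn_coordMetric g x₀ _ _).comp contDiffOn_fst fun z hz ↦ hz.1

lemma sqNorm_eq (g : RMetric n M) {x₀ : M} {p : TBundle n M} (hp : p ∈ coordSource n x₀) :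
    sqNorm g p = coordMetric g x₀ (coordMap x₀ p).1 (coordMap x₀ p).2 (coordMap x₀ p).2 :=
  (coordMetric_coordMap g hp).symm

lemma continuous_sqNorm (g : RMetric n M) : Continuous (sqNorm g) := by
  rw [continuous_iff_continuousAt]
  intro p
  have h : ContinuousOn (sqNorm g) (coordSource n p.1) := by
    have := (contDiffOn_sqNorm_coord g p.1).continuousOn.comp (continuousOn_coordMap p.1)
      fun q hq ↦ coordMap_mem hq
    exact this.congr fun q hq ↦ sqNorm_eq g hq
  exact h.continuousAt ((isOpen_coordSource p.1).mem_nhds (mem_coordSource_self p))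

lemma ne_zero_of_sqNorm (g : RMetric n M) {p : TBundle n M} (hp : sqNorm g p ≠ 0) : p.2 ≠ 0 := by
  intro h; exact hp (by simp [sqNorm, h])

/-- Multiplication of a tangent vector by a scalar. -/
def scale (ρ : ℝ) (p : TBundle n M) : TBundle n M := ⟨p.1, ρ • p.2⟩

lemma coordMap_scale (x₀ : M) (ρ : ℝ) (p : TBundle n M) :
    coordMap x₀ (scale ρ p) = ((coordMap x₀ p).1, ρ • (coordMap x₀ p).2) :=
  Prod.ext rfl (map_smul _ _ _)

lemma sqNorm_scale (g : RMetric n M) (ρ : ℝ) (p : TBundle n M) :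
    sqNorm g (scale ρ p) = ρ ^ 2 * sqNorm g p := by
  rw [sqNorm_eq g (mem_coordSource_self p),
    sqNorm_eq (x₀ := p.1) g (mem_coordSource_self (scale ρ p)), coordMap_scale]
  simp only [map_smul, smul_apply, smul_eq_mul]
  ring

lemma scale_scale (ρ ρ' : ℝ) (p : TBundle n M) : scale ρ (scale ρ' p) = scale (ρ * ρ') p :=
  congrArg (fun v ↦ (⟨p.1, v⟩ : TBundle n M)) (smul_smul ρ ρ' p.2)

lemma scale_one (p : TBundle n M) : scale 1 p = p :=
  congrArg (fun v ↦ (⟨p.1, v⟩ : TBundle n M)) (one_smul ℝ p.2)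

lemma normalize_eq_scale (g : RMetric n M) (p : TBundle n M) :
    normalize g p = scale (Real.sqrt (sqNorm g p))⁻¹ p := rfl

lemma sqNorm_normalize (g : RMetric n M) {p : TBundle n M} (hp : 0 < sqNorm g p) :
    sqNorm g (normalize g p) = 1 := by
  rw [normalize_eq_scale, sqNorm_scale, inv_pow, Real.sq_sqrt hp.le, inv_mul_cancel₀ hp.ne']

lemma scale_normalize (g : RMetric n M) {p : TBundle n M} (hp : 0 < sqNorm g p) :
    scale (Real.sqrt (sqNorm g p)) (normalize g p) = p := by
  rw [normalize_eq_scale, scale_scale, mul_inv_cancel₀ (Real.sqrt_pos.2 hp).ne', scale_one]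

lemma normalize_scale (g : RMetric n M) {p : TBundle n M} (hp : sqNorm g p = 1) {ρ : ℝ}
    (hρ : 0 < ρ) : normalize g (scale ρ p) = p := by
  rw [normalize_eq_scale, scale_scale, sqNorm_scale, hp, mul_one, Real.sqrt_sq hρ.le,
    inv_mul_cancel₀ hρ.ne', scale_one]

lemma coordMap_snd_ne_zero {x₀ : M} {p : TBundle n M} (hp : p ∈ coordSource n x₀)
    (h : p.2 ≠ 0) : (coordMap x₀ p).2 ≠ 0 := by
  intro h0
  apply h
  have h1 : tangentCoordChange (𝓡∂ (n + 1)) x₀ p.1 p.1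
      (tangentCoordChange (𝓡∂ (n + 1)) p.1 x₀ p.1 p.2) = p.2 :=
    (tangentCoordChange_comp ⟨⟨mem_extChartAt_source _, hp⟩, mem_extChartAt_source _⟩).trans
      (tangentCoordChange_self (mem_extChartAt_source _))
  rw [← coordMap_snd, h0] at h1
  rw [← h1]
  exact map_zero _

/-- The geodesic vector field in the chart at `x₀`, with its speed normalized to one. -/
def unitField (g : RMetric n M) (x₀ : M) (z : Coord n × Coord n) : Coord n × Coord n :=
  (Real.sqrt (coordMetric g x₀ z.1 z.2 z.2))⁻¹ • (z.2, -coordGamma g x₀ z.1 z.2)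

lemma contDiffWithinAt_unitField (g : RMetric n M) {x₀ : M} {z : Coord n × Coord n}
    (hz : z ∈ coordTarget n x₀) (h0 : z.2 ≠ 0) :
    ContDiffWithinAt ℝ ∞ (unitField g x₀) (range (𝓡∂ (n + 1)) ×ˢ univ) z := by
  have hpos := coordMetric_pos g hz.1 h0
  have h1 : ContDiffWithinAt ℝ ∞ (unitField g x₀) (coordTarget n x₀) z := by
    have e1 : ContDiffWithinAt ℝ ∞ (fun z : Coord n × Coord n ↦
        (Real.sqrt (coordMetric g x₀ z.1 z.2 z.2))⁻¹) (coordTarget n x₀) z :=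
      ((contDiffOn_sqNorm_coord g x₀ z hz).sqrt hpos.ne').inv (Real.sqrt_pos.2 hpos).ne'
    have e2 : ContDiffWithinAt ℝ ∞ (fun z : Coord n × Coord n ↦
        (z.2, -coordGamma g x₀ z.1 z.2)) (coordTarget n x₀) z :=
      contDiffWithinAt_snd.prodMk (contDiffOn_coordGamma g x₀ z hz).neg
    exact e1.smul e2
  refine h1.mono_of_mem_nhdsWithin ?_
  rw [show z = (z.1, z.2) from rfl, nhdsWithin_prod_eq]
  exact prod_mem_prod (target_mem_nhdsWithin hz.1) univ_mem

lemma coordGamma_smul (g : RMetric n M) (x₀ : M) (y w : Coord n) (ρ : ℝ) :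
    coordGamma g x₀ y (ρ • w) = ρ ^ 2 • coordGamma g x₀ y w := by
  ext k
  simp only [coordGamma, PiLp.smul_apply, smul_eq_mul, Finset.mul_sum]
  exact Finset.sum_congr rfl fun i _ ↦ Finset.sum_congr rfl fun j _ ↦ by ring

/-- The right side is the derivative of `(y, ρ • w)` along the unit speed geodesic with velocity
`w`. Hence the dilations of unit speed geodesics by all `ρ > 0` are trajectories of one field,
defined for all nonzero fibre coordinates. Estimates for this field control the cone over a set of
unit vectors, which has full dimension. -/
lemma unitField_smul (g : RMetric n M) (x₀ : M) (y w : Coord n) {ρ : ℝ} (hρ : 0 < ρ)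
    (hw : coordMetric g x₀ y w w = 1) :
    unitField g x₀ (y, ρ • w) = (w, -(ρ • coordGamma g x₀ y w)) := by
  have h : coordMetric g x₀ y (ρ • w) (ρ • w) = ρ ^ 2 := by
    simp only [map_smul, smul_apply, smul_eq_mul, hw]; ring
  simp only [unitField, h, Real.sqrt_sq hρ.le, coordGamma_smul]
  refine Prod.ext ?_ ?_
  · simp [smul_smul, inv_mul_cancel₀ hρ.ne']
  · simp only [Prod.smul_mk, smul_neg, smul_smul]
    congr 2
    field_simp

/-! ### Unit speed geodesic arcs -/

/-- `c` is a geodesic on `[a, b]` of unit speed that runs in the interior of the manifold. -/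
structure IsArc (g : RMetric n M) (c : ℝ → TBundle n M) (a b : ℝ) : Prop where
  cont : ContinuousOn c (Icc a b)
  inter : ∀ s ∈ Ioo a b, (c s).1 ∈ (𝓡∂ (n + 1)).interior M
  ode : ∀ s ∈ Ioo a b, ∀ x₀ : M, c s ∈ coordSource n x₀ →
    HasDerivAt (fun r ↦ coordMap x₀ (c r))
      ((coordMap x₀ (c s)).2, -coordGamma g x₀ (coordMap x₀ (c s)).1 (coordMap x₀ (c s)).2) s
  unit : ∀ s ∈ Icc a b, sqNorm g (c s) = 1

/-- The Koszul formula with `b = w` says that `g(Γ(w, w), w)` is half the derivative of `g(w, w)` in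
the direction `w`, so the change of the metric and the change of the velocity cancel. -/
lemma hasDerivAt_sqNorm (g : RMetric n M) {c : ℝ → TBundle n M} {s : ℝ} {x₀ : M}
    (hc : ContinuousAt c s) (hx : c s ∈ coordSource n x₀)
    (hint : (c s).1 ∈ (𝓡∂ (n + 1)).interior M)
    (h : HasDerivAt (fun r ↦ coordMap x₀ (c r))
      ((coordMap x₀ (c s)).2, -coordGamma g x₀ (coordMap x₀ (c s)).1 (coordMap x₀ (c s)).2) s) :
    HasDerivAt (fun r ↦ sqNorm g (c r)) 0 s := by
  set y := (coordMap x₀ (c s)).1 with hy_def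
  set w := (coordMap x₀ (c s)).2 with hw_def
  have hfst : HasDerivAt (fun r ↦ (coordMap x₀ (c r)).1) w s :=
    (ContinuousLinearMap.fst ℝ (Coord n) (Coord n)).hasFDerivAt.comp_hasDerivAt s h
  have hsnd : HasDerivAt (fun r ↦ (coordMap x₀ (c r)).2) (-coordGamma g x₀ y w) s :=
    (ContinuousLinearMap.snd ℝ (Coord n) (Coord n)).hasFDerivAt.comp_hasDerivAt s h
  have hy : y ∈ (extChartAt (𝓡∂ (n + 1)) x₀).target := (coordMap_mem hx).1
  have h0 : 0 < y 0 := (mem_interior_iff hx).1 hint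
  have hG : ∀ a b, HasDerivAt (fun r ↦ coordMetric g x₀ (coordMap x₀ (c r)).1 a b)
      (coordMetricDeriv g x₀ y a b w) s := fun a b ↦
    ((hasFDerivWithinAt_coordMetric g hy a b).hasFDerivAt
      (range_mem_nhds h0)).comp_hasDerivAt_of_eq s hfst hy_def
  have h1 := hasDerivAt_bilin hG hsnd hsnd
  have h2 : HasDerivAt (fun r ↦ coordMetric g x₀ (coordMap x₀ (c r)).1 (coordMap x₀ (c r)).2
      (coordMap x₀ (c r)).2) 0 s := by
    refine h1.congr_deriv ?_
    rw [← hw_def, ← hy_def, coordMetric_symm g x₀ y w]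
    simp only [map_neg, neg_apply, coordMetric_coordGamma g hy]
    ring
  refine h2.congr_of_eventuallyEq ?_
  filter_upwards [hc.eventually ((isOpen_coordSource x₀).mem_nhds hx)] with r hr
  exact sqNorm_eq g hr

lemma IsMaxGeodesic.isArc {g : RMetric n M} {p : TBundle n M} {c : ℝ → TBundle n M} {a b : ℝ}
    (h : IsMaxGeodesic g p c a b) (hp : sqNorm g p = 1) : IsArc g c a b := by
  have hcont : ContinuousOn c (Icc a b) := fun s hs ↦ (h.geodesic s hs).continuousWithinAt
  have hode : ∀ s ∈ Ioo a b, ∀ x₀ : M, c s ∈ coordSource n x₀ →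
    HasDerivAt (fun r ↦ coordMap x₀ (c r))
      ((coordMap x₀ (c s)).2, -coordGamma g x₀ (coordMap x₀ (c s)).1 (coordMap x₀ (c s)).2) s :=
    fun s hs x₀ hx ↦ hasDerivAt_coordMap g h.geodesic (Icc_mem_nhds hs.1 hs.2)
      (h.interior s hs) hx
  refine ⟨hcont, h.interior, hode, ?_⟩
  have hconst : ∀ s ∈ Icc a b, sqNorm g (c s) = sqNorm g (c a) := by
    intro s hs
    -- The squared length is a trajectory of the zero field and hence Lipschitz with constant zero.
    have htraj : IsTrajectory (fun _ : ℝ ↦ (0 : ℝ)) univ (fun r ↦ sqNorm g (c r)) a b :=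
      ⟨(continuous_sqNorm g).comp_continuousOn hcont, fun r hr ↦ hasDerivAt_sqNorm g
        (hcont.continuousAt (Icc_mem_nhds hr.1 hr.2)) (mem_coordSource_self (c r))
        (h.interior r hr) (hode r hr _ (mem_coordSource_self (c r))), fun _ _ ↦ mem_univ _⟩
    have h1 := (htraj.lipschitz (C := 0) (fun z _ ↦ by simp)).dist_le_mul s hs a
      ⟨le_rfl, h.lt.le⟩
    simpa using h1
  intro s hs
  rw [hconst s hs, ← hconst 0 h.zero_mem, h.start, hp]

lemma IsArc.mono {g : RMetric n M} {c : ℝ → TBundle n M} {a b a' b' : ℝ} (h : IsArc g c a b)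
    (ha : a ≤ a') (hb : b' ≤ b) : IsArc g c a' b' :=
  ⟨h.cont.mono (Icc_subset_Icc ha hb), fun s hs ↦ h.inter s (Ioo_subset_Ioo ha hb hs),
    fun s hs ↦ h.ode s (Ioo_subset_Ioo ha hb hs), fun s hs ↦ h.unit s (Icc_subset_Icc ha hb hs)⟩

lemma IsArc.shift {g : RMetric n M} {c : ℝ → TBundle n M} {a b : ℝ} (h : IsArc g c a b) (t : ℝ) :
    IsArc g (fun s ↦ c (t + s)) (a - t) (b - t) := by
  refine ⟨h.cont.comp (by fun_prop) fun s hs ↦ ?_, fun s hs ↦ ?_, fun s hs x₀ hx ↦ ?_,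
    fun s hs ↦ ?_⟩
  · exact ⟨by linarith [hs.1], by linarith [hs.2]⟩
  · exact h.inter _ ⟨by linarith [hs.1], by linarith [hs.2]⟩
  · exact (h.ode (t + s) ⟨by linarith [hs.1], by linarith [hs.2]⟩ x₀ hx).comp_const_add t s
  · exact h.unit _ ⟨by linarith [hs.1], by linarith [hs.2]⟩

lemma IsArc.isTrajectory {g : RMetric n M} {c : ℝ → TBundle n M} {a b : ℝ} (h : IsArc g c a b)
    {x₀ : M} {K : Set (Coord n × Coord n)} {ρ : ℝ} (hρ : 0 < ρ)
    (hK : ∀ s ∈ Icc a b, c s ∈ coordSource n x₀ ∧ coordMap x₀ (scale ρ (c s)) ∈ K) :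
    IsTrajectory (unitField g x₀) K (fun s ↦ coordMap x₀ (scale ρ (c s))) a b := by
  refine ⟨?_, fun s hs ↦ ?_, fun s hs ↦ (hK s hs).2⟩
  · have h1 : ContinuousOn (fun s ↦ coordMap x₀ (c s)) (Icc a b) :=
      (continuousOn_coordMap x₀).comp h.cont fun s hs ↦ (hK s hs).1
    simp only [coordMap_scale]
    exact (continuous_fst.comp_continuousOn h1).prodMk
      ((continuous_snd.comp_continuousOn h1).const_smul ρ)
  · have hsrc := (hK s (Ioo_subset_Icc_self hs)).1
    have h1 := h.ode s hs x₀ hsrc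
    have hfst := (ContinuousLinearMap.fst ℝ (Coord n) (Coord n)).hasFDerivAt.comp_hasDerivAt s h1
    have hsnd := (ContinuousLinearMap.snd ℝ (Coord n) (Coord n)).hasFDerivAt.comp_hasDerivAt s h1
    have hu := h.unit s (Ioo_subset_Icc_self hs)
    rw [sqNorm_eq g hsrc] at hu
    simp only [coordMap_scale]
    rw [unitField_smul g x₀ _ _ hρ hu, ← smul_neg]
    exact hfst.prodMk (hsnd.const_smul ρ)

/-! ### Boxes -/

/-- `U` is a set of tangent vectors on which the chart at `x₀` is defined, and on whose image the
unit speed field is Lipschitz and bounded. -/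
structure IsBox (g : RMetric n M) (x₀ : M) (U : Set (TBundle n M)) (L C : ℝ≥0) : Prop where
  source : U ⊆ coordSource n x₀
  lipschitz : LipschitzOnWith L (unitField g x₀) (coordMap x₀ '' U)
  bound : ∀ z ∈ coordMap x₀ '' U, ‖unitField g x₀ z‖₊ ≤ C

lemma IsBox.mono {g : RMetric n M} {x₀ : M} {U U' : Set (TBundle n M)} {L C : ℝ≥0}
    (h : IsBox g x₀ U L C) (hU : U' ⊆ U) : IsBox g x₀ U' L C :=
  ⟨hU.trans h.source, h.lipschitz.mono (image_mono hU), fun z hz ↦ h.bound z (image_mono hU hz)⟩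

/-- The half space times the fibre is convex, and a `C¹` function within a convex set is locally
Lipschitz there. In this way boundary points need no separate treatment. -/
lemma exists_isBox (g : RMetric n M) {p : TBundle n M} (hp : p.2 ≠ 0) :
    ∃ U, IsOpen U ∧ p ∈ U ∧ ∃ L C, IsBox g p.1 U L C := by
  set z := coordMap p.1 p with hz
  have hps := mem_coordSource_self p
  have h := contDiffWithinAt_unitField g (coordMap_mem hps) (coordMap_snd_ne_zero hps hp)
  have hconv : Convex ℝ (range (𝓡∂ (n + 1)) ×ˢ (univ : Set (Coord n))) :=
    (𝓡∂ (n + 1)).convex_range.prod convex_univ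
  obtain ⟨L, t, ht, hL⟩ := (h.of_le (m := 1) ENat.LEInfty.out).exists_lipschitzOnWith hconv
  have hb := h.continuousWithinAt.nnnorm.eventually (gt_mem_nhds (lt_add_one _))
  have hten : Tendsto (coordMap p.1) (𝓝 p) (𝓝[range (𝓡∂ (n + 1)) ×ˢ univ] z) := by
    refine tendsto_nhdsWithin_iff.2 ⟨(continuousOn_coordMap p.1).continuousAt
      ((isOpen_coordSource p.1).mem_nhds hps), ?_⟩
    filter_upwards [(isOpen_coordSource p.1).mem_nhds hps] with q hq
    exact ⟨target_subset_range _ (coordMap_mem hq).1, mem_univ _⟩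
  have hev : ∀ᶠ q in 𝓝 p, q ∈ coordSource n p.1 ∧ coordMap p.1 q ∈ t ∧
      ‖unitField g p.1 (coordMap p.1 q)‖₊ < ‖unitField g p.1 z‖₊ + 1 :=
    ((isOpen_coordSource p.1).eventually_mem hps).and ((hten.eventually ht).and (hten.eventually hb))
  obtain ⟨U, hU, hUo, hpU⟩ := eventually_nhds_iff.1 hev
  refine ⟨U, hUo, hpU, L, ‖unitField g p.1 z‖₊ + 1, fun q hq ↦ (hU q hq).1, hL.mono ?_, ?_⟩
  · rintro _ ⟨q, hq, rfl⟩
    exact (hU q hq).2.1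
  · rintro _ ⟨q, hq, rfl⟩
    exact (hU q hq).2.2.le

lemma IsArc.isTrajectory_of_isBox {g : RMetric n M} {c : ℝ → TBundle n M} {a b : ℝ}
    (h : IsArc g c a b) {x₀ : M} {U : Set (TBundle n M)} {L C : ℝ≥0} (hU : IsBox g x₀ U L C)
    {ρ : ℝ} (hρ : 0 < ρ) (hc : ∀ s ∈ Icc a b, scale ρ (c s) ∈ U) :
    IsTrajectory (unitField g x₀) (coordMap x₀ '' U) (fun s ↦ coordMap x₀ (scale ρ (c s))) a b :=
  h.isTrajectory hρ fun s hs ↦ ⟨(have h := hU.source (hc s hs); h), mem_image_of_mem _ (hc s hs)⟩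

/-! ### Uniqueness of geodesics -/

instance [T2Space M] : T2Space (TBundle n M) := by
  refine ⟨fun p q hpq ↦ ?_⟩
  by_cases h : p.1 = q.1
  · have hq : q ∈ coordSource n p.1 := by
      change q.1 ∈ (extChartAt (𝓡∂ (n + 1)) p.1).source
      rw [← h]; exact mem_extChartAt_source _
    have hp := mem_coordSource_self p
    have hne : coordMap p.1 p ≠ coordMap p.1 q := by
      intro he
      apply hpq
      rw [← ofCoord_coordMap hp, he, ofCoord_coordMap hq]
    obtain ⟨u, v, hu, hv, hpu, hqv, huv⟩ := t2_separation hne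
    have hc : ContinuousOn (coordMap p.1 : TBundle n M → _) (coordSource n p.1) :=
      continuousOn_coordMap p.1
    refine ⟨_, _, hc.isOpen_inter_preimage (isOpen_coordSource p.1) hu,
      hc.isOpen_inter_preimage (isOpen_coordSource p.1) hv, ⟨hp, hpu⟩, ⟨hq, hqv⟩, ?_⟩
    exact (huv.preimage _).mono inter_subset_right inter_subset_right
  · obtain ⟨u, v, hu, hv, hpu, hqv, huv⟩ := t2_separation h
    have hc : Continuous (fun p : TBundle n M ↦ p.1) := FiberBundle.continuous_proj (Coord n) _
    exact ⟨_, _, hu.preimage hc, hv.preimage hc, hpu, hqv, huv.preimage _⟩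

/-- The times of agreement form a closed set, since the tangent bundle is Hausdorff, and an open one
by Grönwall's inequality forwards and backwards in a box. -/
lemma IsArc.eqOn [T2Space M] {g : RMetric n M} {c c' : ℝ → TBundle n M} {a b t : ℝ}
    (h : IsArc g c a b) (h' : IsArc g c' a b) (ht : t ∈ Icc a b) (heq : c t = c' t) :
    EqOn c c' (Icc a b) := by
  have hab : a ≤ b := ht.1.trans ht.2
  have : PreconnectedSpace (Icc a b) := Subtype.preconnectedSpace isPreconnected_Icc
  set S : Set (Icc a b) := {s | c s = c' s} with hS
  have hcr : Continuous fun s : Icc a b ↦ c s := continuousOn_iff_continuous_domRestrict.1 h.cont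
  have hcr' : Continuous fun s : Icc a b ↦ c' s := continuousOn_iff_continuous_domRestrict.1 h'.cont
  have hclosed : IsClosed S := isClosed_eq hcr hcr'
  have hopen : IsOpen S := by
    rw [isOpen_iff_mem_nhds]
    rintro ⟨t, ht⟩ heq
    change c t = c' t at heq
    have hne : (c t).2 ≠ 0 := ne_zero_of_sqNorm g (by rw [h.unit t ht]; norm_num)
    obtain ⟨U, hUo, hpU, L, C, hbox⟩ := exists_isBox g hne
    have e1 : ∀ᶠ s : Icc a b in 𝓝 ⟨t, ht⟩, c s ∈ U :=
      hcr.continuousAt.eventually (hUo.eventually_mem hpU)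
    have e2 : ∀ᶠ s : Icc a b in 𝓝 ⟨t, ht⟩, c' s ∈ U :=
      hcr'.continuousAt.eventually (hUo.eventually_mem (show c' t ∈ U by rw [← heq]; exact hpU))
    obtain ⟨ε, hε, hball⟩ := Metric.eventually_nhds_iff.1 (e1.and e2)
    refine Metric.mem_nhds_iff.2 ⟨ε, hε, ?_⟩
    rintro ⟨s, hs⟩ hsε
    have hmem : ∀ r ∈ uIcc t s, c r ∈ U ∧ c' r ∈ U := by
      intro r hr
      have hr' : r ∈ Icc a b := (ordConnected_Icc.uIcc_subset ht hs) hr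
      refine @hball ⟨r, hr'⟩ ?_
      have h1 : |r - t| ≤ |s - t| := abs_sub_left_of_mem_uIcc hr
      have h2 : dist s t < ε := hsε
      rw [Real.dist_eq] at h2
      change dist r t < ε
      rw [Real.dist_eq]; linarith
    have hsource : ∀ r ∈ uIcc t s, c r ∈ coordSource n (c t).1 ∧ c' r ∈ coordSource n (c t).1 :=
      fun r hr ↦ ⟨hbox.source (hmem r hr).1, hbox.source (hmem r hr).2⟩
    have hdist : dist (coordMap (c t).1 (c s)) (coordMap (c t).1 (c' s)) ≤ 0 := by
      rcases le_total t s with hts | hts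
      · rw [uIcc_of_le hts] at hmem
        have h1 := (h.mono ht.1 hs.2).isTrajectory_of_isBox hbox one_pos
          (fun r hr ↦ by rw [scale_one]; exact (hmem r hr).1)
        have h2 := (h'.mono ht.1 hs.2).isTrajectory_of_isBox hbox one_pos
          (fun r hr ↦ by rw [scale_one]; exact (hmem r hr).2)
        have := IsTrajectory.dist_le hbox.lipschitz hts h1 h2
        simpa [scale_one, heq] using this
      · rw [uIcc_of_ge hts] at hmem
        have h1 := (h.mono hs.1 ht.2).isTrajectory_of_isBox hbox one_pos
          (fun r hr ↦ by rw [scale_one]; exact (hmem r hr).1)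
        have h2 := (h'.mono hs.1 ht.2).isTrajectory_of_isBox hbox one_pos
          (fun r hr ↦ by rw [scale_one]; exact (hmem r hr).2)
        have := IsTrajectory.dist_le' hbox.lipschitz hts h1 h2
        simpa [scale_one, heq] using this
    have h3 := dist_le_zero.1 hdist
    have h4 := hsource s right_mem_uIcc
    change c s = c' s
    rw [← ofCoord_coordMap h4.1, h3, ofCoord_coordMap h4.2]
  have huniv : S = univ := IsClopen.eq_univ ⟨hclosed, hopen⟩ ⟨⟨t, ht⟩, heq⟩
  intro s hs
  have : (⟨s, hs⟩ : Icc a b) ∈ S := huniv ▸ mem_univ _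
  exact this

end Charts

end

end Transport

namespace Transport

noncomputable section

open scoped NNReal

section Charts

variable {n : ℕ} {M : Type*} [TopologicalSpace M] [ChartedSpace (EuclideanHalfSpace (n + 1)) M]
  [IsManifold (𝓡∂ (n + 1)) ∞ M]

/-! ### Geodesics stay close to their starting point for a short time -/

omit [IsManifold (𝓡∂ (n + 1)) ∞ M] in
lemma coordTarget_mem_nhdsWithin {x₀ : M} {z : Coord n × Coord n} (hz : z ∈ coordTarget n x₀) :
    coordTarget n x₀ ∈ 𝓝[range (𝓡∂ (n + 1)) ×ˢ univ] z := by
  rw [show z = (z.1, z.2) from rfl, nhdsWithin_prod_eq]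
  exact prod_mem_prod (target_mem_nhdsWithin hz.1) univ_mem

/-- A continuity argument that is uniform in the curve: the speed bound is assumed only for as long
as the curve has stayed in `U`, and it prevents the curve from leaving `U` early. -/
lemma exists_forall_mem_of_dist_le [T2Space M] {p₀ : TBundle n M} {U : Set (TBundle n M)} (hU : IsOpen U)
    (hp₀ : p₀ ∈ U) (C : ℝ≥0) :
    ∃ ε > 0, ∃ V, IsOpen V ∧ p₀ ∈ V ∧ V ⊆ U ∧ ∀ (c : ℝ → TBundle n M) (b : ℝ), 0 ≤ b → b ≤ ε →
      ContinuousOn c (Icc 0 b) → c 0 ∈ V →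
      (∀ s ∈ Icc 0 b, (∀ r ∈ Icc 0 s, c r ∈ U) →
        dist (coordMap p₀.1 (c s)) (coordMap p₀.1 (c 0)) ≤ C * s) →
      ∀ s ∈ Icc 0 b, c s ∈ U := by
  set x₀ := p₀.1
  set z₀ := coordMap x₀ p₀ with hz₀
  set R : Set (Coord n × Coord n) := range (𝓡∂ (n + 1)) ×ˢ univ with hR
  have hps : p₀ ∈ coordSource n x₀ := mem_coordSource_self p₀
  have hzt : z₀ ∈ coordTarget n x₀ := coordMap_mem hps
  have hRc : IsClosed R := (𝓡∂ (n + 1)).isClosed_range.prod isClosed_univ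
  have h1 : coordTarget n x₀ ∩ ofCoord x₀ ⁻¹' U ∈ 𝓝[R] z₀ := by
    have h2 := (continuousOn_ofCoord (M := M) x₀) z₀ hzt
    have h3 : U ∈ 𝓝 (ofCoord x₀ z₀ : TBundle n M) := by
      rw [hz₀, ofCoord_coordMap hps]; exact hU.mem_nhds hp₀
    have h4 := h2 h3
    have h5 : 𝓝[coordTarget n x₀] z₀ = 𝓝[R] z₀ := by
      apply le_antisymm
      · exact nhdsWithin_mono _ fun z hz ↦ ⟨target_subset_range _ hz.1, mem_univ _⟩
      · exact nhdsWithin_le_iff.2 (coordTarget_mem_nhdsWithin hzt)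
    exact inter_mem (coordTarget_mem_nhdsWithin hzt) (h5 ▸ h4)
  obtain ⟨ρ, hρ, hball⟩ := Metric.mem_nhdsWithin_iff.1 h1
  have hsub : ∀ q ∈ coordSource n x₀, coordMap x₀ q ∈ Metric.ball z₀ ρ → q ∈ U := by
    intro q hq hqb
    have := (hball ⟨hqb, target_subset_range _ (coordMap_mem hq).1, mem_univ _⟩).2
    rwa [mem_preimage, ofCoord_coordMap hq] at this
  have hopen : ∀ r, IsOpen (coordSource n x₀ ∩ coordMap x₀ ⁻¹' Metric.ball z₀ r) := fun r ↦
    (continuousOn_coordMap x₀).isOpen_inter_preimage (isOpen_coordSource x₀) Metric.isOpen_ball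
  -- A curve that starts within `ρ / 2` of `z₀` and moves by less than `ρ / 4` remains within `3 / 4
  -- * ρ`, strictly inside the ball of radius `ρ`.
  obtain ⟨ε, hε, hεC⟩ : ∃ ε > 0, C * ε < ρ / 4 := by
    refine ⟨ρ / (8 * (C + 1)), by positivity, ?_⟩
    have : (C : ℝ) * (ρ / (8 * (C + 1))) = (C / (C + 1)) * (ρ / 8) := by field_simp
    rw [this]
    have h2 : (C : ℝ) / (C + 1) ≤ 1 := by
      rw [div_le_one (by positivity)]; linarith
    nlinarith
  refine ⟨ε, hε, _, hopen (ρ / 2), ⟨hps, Metric.mem_ball_self (by positivity)⟩, ?_, ?_⟩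
  · exact fun q hq ↦ hsub q hq.1 (Metric.ball_subset_ball (by linarith) hq.2)
  · intro c b hb hbε hc hc0 hlip
    by_contra! hcon
    obtain ⟨s₁, hs₁, hs₁U⟩ := hcon
    set B : Set ℝ := Icc 0 b ∩ c ⁻¹' (coordSource n x₀ ∩ coordMap x₀ ⁻¹' Metric.ball z₀ ρ)ᶜ
    have hBc : IsClosed B := hc.preimage_isClosed_of_isClosed isClosed_Icc (hopen ρ).isClosed_compl
    have hBne : B.Nonempty := ⟨s₁, hs₁, fun h ↦ hs₁U (hsub _ h.1 h.2)⟩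
    have hBb : BddBelow B := ⟨0, fun s hs ↦ hs.1.1⟩
    have hmem := hBc.csInf_mem hBne hBb
    set t := sInf B
    have hlt : ∀ s ∈ Icc 0 b, s < t → c s ∈ coordSource n x₀ ∩ coordMap x₀ ⁻¹' Metric.ball z₀ ρ := by
      intro s hs hst
      by_contra h
      exact absurd (csInf_le hBb ⟨hs, h⟩) (not_le.2 hst)
    have ht0 : 0 < t := by
      rcases hmem.1.1.eq_or_lt with h | h
      · exfalso
        have h2 := hmem.2
        rw [← h] at h2
        exact h2 ⟨hc0.1, Metric.ball_subset_ball (by linarith) hc0.2⟩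
      · exact h
    -- The curve could also leave the domain of the chart, which coordinates do not detect. The set
    -- `K` is compact and thus closed, so the curve is still in `K`, and in the chart, at the first
    -- bad time `t`.
    set K : Set (TBundle n M) := ofCoord x₀ '' (Metric.closedBall z₀ (3 / 4 * ρ) ∩ R)
    have hKt : Metric.closedBall z₀ (3 / 4 * ρ) ∩ R ⊆ coordTarget n x₀ := fun z hz ↦
      (hball ⟨Metric.closedBall_subset_ball (by linarith) hz.1, hz.2⟩).1
    have hKc : IsClosed K :=
      (((isCompact_closedBall _ _).inter_right hRc).image_of_continuousOn
        ((continuousOn_ofCoord x₀).mono hKt)).isClosed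
    have hcK : ∀ s ∈ Ico 0 t, c s ∈ K := by
      intro s hs
      have hsb : s ∈ Icc 0 b := ⟨hs.1, hs.2.le.trans hmem.1.2⟩
      have h2 := hlip s hsb fun r hr ↦ by
        have := hlt r ⟨hr.1, hr.2.trans hsb.2⟩ (hr.2.trans_lt hs.2)
        exact hsub _ this.1 this.2
      have h3 := hlt s hsb hs.2
      have h4 : dist (coordMap x₀ (c 0)) z₀ < ρ / 2 := hc0.2
      have h5 : (C : ℝ) * s ≤ C * ε := by
        gcongr
        exact hsb.2.trans hbε
      refine ⟨coordMap x₀ (c s), ⟨?_, target_subset_range _ (coordMap_mem h3.1).1, mem_univ _⟩,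
        ofCoord_coordMap h3.1⟩
      rw [Metric.mem_closedBall]
      linarith [dist_triangle (coordMap x₀ (c s)) (coordMap x₀ (c 0)) z₀]
    have hct : c t ∈ K := by
      have h2 : t ∈ closure (Ico 0 t) := by
        rw [closure_Ico ht0.ne]; exact ⟨ht0.le, le_rfl⟩
      have h3 : ContinuousWithinAt c (Ico 0 t) t :=
        (hc t hmem.1).mono (Ico_subset_Icc_self.trans (Icc_subset_Icc_right hmem.1.2))
      exact hKc.closure_subset (h3.mem_closure h2 hcK)
    obtain ⟨z, hz, hzc⟩ := hct
    have hz' := hKt hz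
    apply hmem.2
    rw [← hzc]
    refine ⟨ofCoord_mem hz', ?_⟩
    rw [mem_preimage, coordMap_ofCoord hz']
    exact Metric.closedBall_subset_ball (by linarith) hz.1

/-- A box provides a speed bound that holds as long as the arc is in the box. Negative times are
treated by running the arc backwards. -/
lemma exists_stay [T2Space M] (g : RMetric n M) {p₀ : TBundle n M} (h0 : p₀.2 ≠ 0)
    {U : Set (TBundle n M)} (hU : IsOpen U) (hp₀ : p₀ ∈ U) :
    ∃ ε > 0, ∃ V, IsOpen V ∧ p₀ ∈ V ∧ V ⊆ U ∧ ∀ (c : ℝ → TBundle n M) (a b : ℝ), IsArc g c a b →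
      0 ∈ Icc a b → c 0 ∈ V → ∀ s ∈ Icc a b, |s| ≤ ε → c s ∈ U := by
  obtain ⟨U', hU'o, hpU', L, C, hbox⟩ := exists_isBox g h0
  have hbox' := hbox.mono (inter_subset_right : U ∩ U' ⊆ U')
  obtain ⟨ε, hε, V, hV, hpV, hVU, h⟩ := exists_forall_mem_of_dist_le (hU.inter hU'o) ⟨hp₀, hpU'⟩ C
  refine ⟨ε, hε, V, hV, hpV, hVU.trans inter_subset_left, fun c a b hc hab hc0 s hs hsε ↦ ?_⟩
  rcases le_total 0 s with h0s | h0s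
  · rw [abs_of_nonneg h0s] at hsε
    refine (h c s h0s hsε (hc.cont.mono (Icc_subset_Icc hab.1 hs.2)) hc0 (fun t ht hct ↦ ?_) s
      ⟨h0s, le_rfl⟩).1
    have h1 := (hc.mono hab.1 (ht.2.trans hs.2)).isTrajectory_of_isBox hbox' one_pos
      (fun r hr ↦ by rw [scale_one]; exact hct r hr)
    have h2 := (h1.lipschitz hbox'.bound).dist_le_mul t ⟨ht.1, le_rfl⟩ 0 ⟨le_rfl, ht.1⟩
    simp only [scale_one] at h2
    rwa [Real.dist_eq, sub_zero, abs_of_nonneg ht.1] at h2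
  · rw [abs_of_nonpos h0s] at hsε
    have hcont : ContinuousOn (fun r ↦ c (-r)) (Icc 0 (-s)) :=
      hc.cont.comp (by fun_prop) fun r hr ↦ ⟨by linarith [hr.2, hs.1], by linarith [hr.1, hab.2]⟩
    have := (h (fun r ↦ c (-r)) (-s) (by linarith) hsε hcont (by simpa using hc0)
      (fun t ht hct ↦ ?_) (-s) ⟨by linarith, le_rfl⟩).1
    · simpa using this
    have h1 := (hc.mono (a' := -t) (b' := 0) (by linarith [ht.2, hs.1]) hab.2).isTrajectory_of_isBox
      hbox' one_pos (fun r hr ↦ by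
        rw [scale_one]
        have := hct (-r) ⟨by linarith [hr.2], by linarith [hr.1]⟩
        simpa using this)
    have h2 := (h1.lipschitz hbox'.bound).dist_le_mul (-t) ⟨le_rfl, by linarith [ht.1]⟩ 0
      ⟨by linarith [ht.1], le_rfl⟩
    simp only [scale_one] at h2
    rw [Real.dist_eq, sub_zero, abs_neg, abs_of_nonneg ht.1] at h2
    simpa using h2

/-! ### The geodesic flow -/

open Classical in
/-- A maximal geodesic through `p`, if there is one. -/
def flowData (g : RMetric n M) (p : TBundle n M) : (ℝ → TBundle n M) × ℝ × ℝ :=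
  if h : ∃ d : (ℝ → TBundle n M) × ℝ × ℝ, IsMaxGeodesic g p d.1 d.2.1 d.2.2 then h.choose
  -- Default values for vectors through which no maximal geodesic passes; under `NonTrapping` the
  -- sphere bundle contains none.
  else (fun _ ↦ p, 0, 0)

/-- The geodesic flow `φ_s(p)`. -/
def flow (g : RMetric n M) (s : ℝ) (p : TBundle n M) : TBundle n M := (flowData g p).1 s

/-- The exit time `τ_+`. -/
def exitTime (g : RMetric n M) (p : TBundle n M) : ℝ := (flowData g p).2.2

/-- The entry time `τ_-`. -/
def entryTime (g : RMetric n M) (p : TBundle n M) : ℝ := -(flowData g p).2.1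

lemma IsMaxGeodesic.flow_spec {g : RMetric n M} {p : TBundle n M} {c : ℝ → TBundle n M} {a b : ℝ}
    (h : IsMaxGeodesic g p c a b) :
    IsMaxGeodesic g p (fun s ↦ flow g s p) (-entryTime g p) (exitTime g p) := by
  have hex : ∃ d : (ℝ → TBundle n M) × ℝ × ℝ, IsMaxGeodesic g p d.1 d.2.1 d.2.2 :=
    ⟨(c, a, b), h⟩
  simp only [flow, exitTime, entryTime, neg_neg, flowData, dif_pos hex]
  exact hex.choose_spec

omit [IsManifold (𝓡∂ (n + 1)) ∞ M] in
lemma not_interior_of_boundary {x : M} (h : x ∈ (𝓡∂ (n + 1)).boundary M) :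
    x ∉ (𝓡∂ (n + 1)).interior M := by
  rw [← (𝓡∂ (n + 1)).compl_interior] at h; exact h

/-- If the end times differed, the geodesic that ends first would be at the boundary while the other
one, with which it agrees, is in the interior. The end times must be positive because `p` may be a
boundary vector at which one of the geodesics ends. -/
lemma IsMaxGeodesic.unique_right [T2Space M] {g : RMetric n M} {p : TBundle n M}
    {c c' : ℝ → TBundle n M} {a b a' b' : ℝ} (h : IsMaxGeodesic g p c a b)
    (h' : IsMaxGeodesic g p c' a' b') (hp : sqNorm g p = 1) (hb : 0 < b) (hb' : 0 < b') :
    b = b' ∧ EqOn c c' (Icc 0 b) := by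
  have key : ∀ {c c' : ℝ → TBundle n M} {a b a' b' : ℝ}, IsMaxGeodesic g p c a b →
      IsMaxGeodesic g p c' a' b' → 0 < b → 0 < b' → b ≤ b' → b = b' ∧ EqOn c c' (Icc 0 b) := by
    intro c c' a b a' b' h h' hb hb' hle
    have heq := ((h.isArc hp).mono h.zero_mem.1 le_rfl).eqOn
      ((h'.isArc hp).mono h'.zero_mem.1 hle) (t := 0) ⟨le_rfl, hb.le⟩ (h.start.trans h'.start.symm)
    refine ⟨hle.eq_or_lt.resolve_right fun hlt ↦ ?_, heq⟩
    refine not_interior_of_boundary h.right ?_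
    rw [heq ⟨hb.le, le_rfl⟩]
    exact h'.interior b ⟨h'.zero_mem.1.trans_lt hb, hlt⟩
  rcases le_total b b' with hle | hle
  · exact key h h' hb hb' hle
  · obtain ⟨e1, e2⟩ := key h' h hb' hb hle
    exact ⟨e1.symm, fun s hs ↦ (e2 (by rwa [e1])).symm⟩

lemma IsMaxGeodesic.unique_left [T2Space M] {g : RMetric n M} {p : TBundle n M}
    {c c' : ℝ → TBundle n M} {a b a' b' : ℝ} (h : IsMaxGeodesic g p c a b)
    (h' : IsMaxGeodesic g p c' a' b') (hp : sqNorm g p = 1) (ha : a < 0) (ha' : a' < 0) :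
    a = a' ∧ EqOn c c' (Icc a 0) := by
  have key : ∀ {c c' : ℝ → TBundle n M} {a b a' b' : ℝ}, IsMaxGeodesic g p c a b →
      IsMaxGeodesic g p c' a' b' → a < 0 → a' < 0 → a' ≤ a → a = a' ∧ EqOn c c' (Icc a 0) := by
    intro c c' a b a' b' h h' ha ha' hle
    have heq := ((h.isArc hp).mono le_rfl h.zero_mem.2).eqOn
      ((h'.isArc hp).mono hle h'.zero_mem.2) (t := 0) ⟨ha.le, le_rfl⟩ (h.start.trans h'.start.symm)
    refine ⟨(hle.eq_or_lt.resolve_right fun hlt ↦ ?_).symm, heq⟩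
    refine not_interior_of_boundary h.left ?_
    rw [heq ⟨le_rfl, ha.le⟩]
    exact h'.interior a ⟨hlt, ha.trans_le h'.zero_mem.2⟩
  rcases le_total a' a with hle | hle
  · exact key h h' ha ha' hle
  · obtain ⟨e1, e2⟩ := key h' h ha' ha hle
    exact ⟨e1.symm, fun s hs ↦ (e2 (by rwa [e1])).symm⟩

lemma IsMaxGeodesic.shift {g : RMetric n M} {p : TBundle n M} {c : ℝ → TBundle n M} {a b : ℝ}
    (h : IsMaxGeodesic g p c a b) {t : ℝ} (ht : t ∈ Icc a b) :
    IsMaxGeodesic g (c t) (fun s ↦ c (t + s)) (a - t) (b - t) := by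
  refine ⟨by linarith [h.lt], ⟨by linarith [ht.1], by linarith [ht.2]⟩, by simp, ?_, ?_, ?_, ?_⟩
  · have := h.geodesic.comp_add t
    have h2 : (fun s ↦ c (t + s)) = c ∘ (· + t) := by ext s : 1; simp [add_comm]
    rw [h2]
    refine this.mono fun s hs ↦ ?_
    exact ⟨by linarith [hs.1], by linarith [hs.2]⟩
  · exact fun s hs ↦ h.interior _ ⟨by linarith [hs.1], by linarith [hs.2]⟩
  · simpa using h.left
  · simpa using h.right

lemma IsMaxGeodesic.mem_Ioo {g : RMetric n M} {p : TBundle n M} {c : ℝ → TBundle n M} {a b : ℝ}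
    (h : IsMaxGeodesic g p c a b) (hp : p ∈ sphereBundle g) : (0 : ℝ) ∈ Ioo a b := by
  refine ⟨h.zero_mem.1.lt_of_ne fun he ↦ ?_, h.zero_mem.2.lt_of_ne fun he ↦ ?_⟩
  · have h1 := h.left
    rw [he, h.start] at h1
    exact not_interior_of_boundary h1 hp.1
  · have h1 := h.right
    rw [← he, h.start] at h1
    exact not_interior_of_boundary h1 hp.1

/-- The maximal geodesic through a point of `SM` is the orbit of the flow. -/
lemma IsMaxGeodesic.eq_flow [T2Space M] {g : RMetric n M} {p : TBundle n M} {c : ℝ → TBundle n M}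
    {a b : ℝ} (h : IsMaxGeodesic g p c a b) (hp : p ∈ sphereBundle g) :
    a = -entryTime g p ∧ b = exitTime g p ∧ EqOn c (fun s ↦ flow g s p) (Icc a b) := by
  have h' := h.flow_spec
  have m := h.mem_Ioo hp
  have m' := h'.mem_Ioo hp
  obtain ⟨e1, e2⟩ := h.unique_right h' hp.2 m.2 m'.2
  obtain ⟨e3, e4⟩ := h.unique_left h' hp.2 m.1 m'.1
  refine ⟨e3, e1, fun s hs ↦ ?_⟩
  rcases le_total 0 s with h0 | h0
  · exact e2 ⟨h0, hs.2⟩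
  · exact e4 ⟨hs.1, h0⟩

lemma IsMaxGeodesic.mem_sphereBundle {g : RMetric n M} {p : TBundle n M} {c : ℝ → TBundle n M}
    {a b : ℝ} (h : IsMaxGeodesic g p c a b) (hp : sqNorm g p = 1) {s : ℝ} (hs : s ∈ Ioo a b) :
    c s ∈ sphereBundle g :=
  ⟨h.interior s hs, (h.isArc hp).unit s (Ioo_subset_Icc_self hs)⟩

/-! ### Group law and continuity of the flow on the sphere bundle -/

section Flow

variable [T2Space M] {g : RMetric n M} (hg : NonTrapping g)
include hg

omit [T2Space M] in
lemma isMaxGeodesic_flow {p : TBundle n M} (hp : p ∈ sphereBundle g) :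
    IsMaxGeodesic g p (fun s ↦ flow g s p) (-entryTime g p) (exitTime g p) := by
  obtain ⟨c, a, b, h⟩ := hg p hp
  exact h.flow_spec

omit [T2Space M] in
lemma isArc_flow {p : TBundle n M} (hp : p ∈ sphereBundle g) :
    IsArc g (fun s ↦ flow g s p) (-entryTime g p) (exitTime g p) :=
  (isMaxGeodesic_flow hg hp).isArc hp.2

omit [T2Space M] in
lemma exitTime_pos {p : TBundle n M} (hp : p ∈ sphereBundle g) : 0 < exitTime g p :=
  ((isMaxGeodesic_flow hg hp).mem_Ioo hp).2

omit [T2Space M] in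
lemma entryTime_pos {p : TBundle n M} (hp : p ∈ sphereBundle g) : 0 < entryTime g p := by
  have := ((isMaxGeodesic_flow hg hp).mem_Ioo hp).1
  linarith

omit [T2Space M] in
lemma flow_zero {p : TBundle n M} (hp : p ∈ sphereBundle g) : flow g 0 p = p :=
  (isMaxGeodesic_flow hg hp).start

omit [T2Space M] in
lemma flow_mem {p : TBundle n M} (hp : p ∈ sphereBundle g) {s : ℝ}
    (hs : s ∈ Ioo (-entryTime g p) (exitTime g p)) : flow g s p ∈ sphereBundle g :=
  (isMaxGeodesic_flow hg hp).mem_sphereBundle hp.2 hs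

/-- A shifted maximal geodesic is maximal, and the maximal geodesic through a point of the sphere
bundle is unique. -/
lemma flow_shift {p : TBundle n M} (hp : p ∈ sphereBundle g) {s : ℝ}
    (hs : s ∈ Ioo (-entryTime g p) (exitTime g p)) :
    entryTime g (flow g s p) = entryTime g p + s ∧ exitTime g (flow g s p) = exitTime g p - s ∧
      ∀ r ∈ Icc (-entryTime g p) (exitTime g p), flow g (r - s) (flow g s p) = flow g r p := by
  have h := ((isMaxGeodesic_flow hg hp).shift (Ioo_subset_Icc_self hs)).eq_flow (flow_mem hg hp hs)
  refine ⟨by linarith [h.1], h.2.1.symm, fun r hr ↦ ?_⟩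
  have : flow g (s + (r - s)) p = flow g (r - s) (flow g s p) :=
    h.2.2 (x := r - s) ⟨by linarith [hr.1], by linarith [hr.2]⟩
  rw [← this, add_sub_cancel]

/-- The flow of time `s` is defined near `p` and continuous at `p`. -/
def FlowContinuousAt (g : RMetric n M) (s : ℝ) (p : TBundle n M) : Prop :=
  (∀ᶠ q in 𝓝[sphereBundle g] p, s ∈ Ioo (-entryTime g q) (exitTime g q)) ∧
    Tendsto (flow g s) (𝓝[sphereBundle g] p) (𝓝 (flow g s p))

/-- Near `p₀` the orbits stay over the interior for times up to `ε`, whereas they end on the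
boundary. This bounds both end times from below, uniformly. -/
lemma exists_flow_mem {p₀ : TBundle n M} (hp₀ : p₀ ∈ sphereBundle g) {U : Set (TBundle n M)}
    (hU : IsOpen U) (hpU : p₀ ∈ U) :
    ∃ ε > 0, ∃ V, IsOpen V ∧ p₀ ∈ V ∧ V ⊆ U ∧ ∀ p ∈ V ∩ sphereBundle g,
      ε < exitTime g p ∧ ε < entryTime g p ∧ ∀ s, |s| ≤ ε → flow g s p ∈ U := by
  have hint : IsOpen {p : TBundle n M | p.1 ∈ (𝓡∂ (n + 1)).interior M} :=
    ((𝓡∂ (n + 1)).isOpen_interior (M := M) (n := ∞) (by simp)).preimage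
      (FiberBundle.continuous_proj (Coord n) _)
  have hne : p₀.2 ≠ 0 := ne_zero_of_sqNorm g
    (by rw [show sqNorm g p₀ = 1 from hp₀.2]; norm_num)
  obtain ⟨ε, hε, V, hV, hpV, hVU, h⟩ := exists_stay g hne (hU.inter hint) ⟨hpU, hp₀.1⟩
  refine ⟨ε, hε, V, hV, hpV, hVU.trans inter_subset_left, fun p hp ↦ ?_⟩
  have hm := isMaxGeodesic_flow hg hp.2
  have h1 := h _ _ _ (isArc_flow hg hp.2) hm.zero_mem
    (by rw [flow_zero hg hp.2]; exact hp.1)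
  have e1 : ε < exitTime g p := by
    by_contra! hcon
    refine not_interior_of_boundary hm.right (h1 _ ⟨hm.lt.le, le_rfl⟩ ?_).2
    rwa [abs_of_pos (exitTime_pos hg hp.2)]
  have e2 : ε < entryTime g p := by
    by_contra! hcon
    refine not_interior_of_boundary hm.left (h1 _ ⟨le_rfl, hm.lt.le⟩ ?_).2
    rwa [abs_neg, abs_of_pos (entryTime_pos hg hp.2)]
  refine ⟨e1, e2, fun s hs ↦ (h1 s ?_ hs).1⟩
  rw [abs_le] at hs
  exact ⟨by linarith, by linarith⟩

/-- For short times the orbits of nearby points remain in one box, where Grönwall's inequality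
compares them. -/
lemma exists_flowContinuousAt {p₀ : TBundle n M} (hp₀ : p₀ ∈ sphereBundle g) :
    ∃ ε > 0, ∃ V, IsOpen V ∧ p₀ ∈ V ∧ ∀ p ∈ V ∩ sphereBundle g, ∀ s, |s| ≤ ε →
      FlowContinuousAt g s p := by
  have hne : p₀.2 ≠ 0 := ne_zero_of_sqNorm g
    (by rw [show sqNorm g p₀ = 1 from hp₀.2]; norm_num)
  obtain ⟨U, hUo, hpU, L, C, hbox⟩ := exists_isBox g hne
  obtain ⟨ε, hε, V, hV, hpV, hVU, h⟩ := exists_flow_mem hg hp₀ hUo hpU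
  refine ⟨ε, hε, V, hV, hpV, fun p hp s hs ↦ ⟨?_, ?_⟩⟩
  · filter_upwards [inter_mem_nhdsWithin (sphereBundle g) (hV.mem_nhds hp.1)] with q hq
    have := h q ⟨hq.2, hq.1⟩
    rw [abs_le] at hs
    exact ⟨by linarith, by linarith⟩
  · have hmap : ∀ q ∈ V ∩ sphereBundle g, flow g s q ∈ coordSource n p₀.1 := fun q hq ↦
      hbox.source ((h q hq).2.2 s hs)
    have hest : ∀ q ∈ V ∩ sphereBundle g, dist (coordMap p₀.1 (flow g s q))
        (coordMap p₀.1 (flow g s p)) ≤ Real.exp (L * ε) *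
          dist (coordMap p₀.1 q) (coordMap p₀.1 p) := by
      intro q hq
      have hU : ∀ q ∈ V ∩ sphereBundle g, ∀ r, |r| ≤ ε → scale 1 (flow g r q) ∈ U := by
        intro q hq r hr
        rw [scale_one]
        exact (h q hq).2.2 r hr
      rcases le_total 0 s with h0 | h0
      · rw [abs_of_nonneg h0] at hs
        have key : ∀ q ∈ V ∩ sphereBundle g, IsTrajectory (unitField g p₀.1) (coordMap p₀.1 '' U)
            (fun r ↦ coordMap p₀.1 (scale 1 (flow g r q))) 0 s := fun q hq ↦
          ((isArc_flow hg hq.2).mono (by linarith [entryTime_pos hg hq.2])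
            (by linarith [(h q hq).1])).isTrajectory_of_isBox hbox one_pos fun r hr ↦
              hU q hq r (by rw [abs_of_nonneg hr.1]; linarith [hr.2])
        have := IsTrajectory.dist_le hbox.lipschitz h0 (key q hq) (key p hp)
        simp only [scale_one, flow_zero hg hq.2, flow_zero hg hp.2, sub_zero] at this
        refine this.trans ?_
        gcongr
      · rw [abs_of_nonpos h0] at hs
        have key : ∀ q ∈ V ∩ sphereBundle g, IsTrajectory (unitField g p₀.1) (coordMap p₀.1 '' U)
            (fun r ↦ coordMap p₀.1 (scale 1 (flow g r q))) s 0 := fun q hq ↦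
          ((isArc_flow hg hq.2).mono (by linarith [(h q hq).2.1])
            (by linarith [exitTime_pos hg hq.2])).isTrajectory_of_isBox hbox one_pos fun r hr ↦
              hU q hq r (by rw [abs_of_nonpos hr.2]; linarith [hr.1])
        have := IsTrajectory.dist_le' hbox.lipschitz h0 (key q hq) (key p hp)
        simp only [scale_one, flow_zero hg hq.2, flow_zero hg hp.2, zero_sub] at this
        refine this.trans ?_
        gcongr
    have hVn : ∀ᶠ q in 𝓝[sphereBundle g] p, q ∈ V ∩ sphereBundle g := by
      filter_upwards [inter_mem_nhdsWithin (sphereBundle g) (hV.mem_nhds hp.1)] with q hq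
      exact ⟨hq.2, hq.1⟩
    have hcoord : Tendsto (fun q ↦ coordMap p₀.1 (flow g s q)) (𝓝[sphereBundle g] p)
        (𝓝 (coordMap p₀.1 (flow g s p))) := by
      rw [tendsto_iff_dist_tendsto_zero]
      have hps : p ∈ coordSource n p₀.1 := hbox.source (hVU hp.1)
      have h1 : Tendsto (coordMap p₀.1) (𝓝[sphereBundle g] p) (𝓝 (coordMap p₀.1 p)) :=
        ((continuousOn_coordMap p₀.1).continuousAt
          ((isOpen_coordSource p₀.1).mem_nhds hps)).tendsto.mono_left nhdsWithin_le_nhds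
      have h2 := (tendsto_iff_dist_tendsto_zero.1 h1).const_mul (Real.exp (L * ε))
      rw [mul_zero] at h2
      exact squeeze_zero' (Eventually.of_forall fun _ ↦ dist_nonneg)
        (hVn.mono fun q hq ↦ hest q hq) h2
    have htgt : coordMap p₀.1 (flow g s p) ∈ coordTarget n p₀.1 := coordMap_mem (hmap p hp)
    have h3 : Tendsto (fun q ↦ coordMap p₀.1 (flow g s q)) (𝓝[sphereBundle g] p)
        (𝓝[coordTarget n p₀.1] (coordMap p₀.1 (flow g s p))) :=
      tendsto_nhdsWithin_iff.2 ⟨hcoord, hVn.mono fun q hq ↦ coordMap_mem (hmap q hq)⟩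
    have h4 := ((continuousOn_ofCoord (M := M) p₀.1) _ htgt).tendsto.comp h3
    rw [ofCoord_coordMap (hmap p hp)] at h4
    refine h4.congr' (hVn.mono fun q hq ↦ ?_)
    exact ofCoord_coordMap (hmap q hq)

lemma FlowContinuousAt.comp {p : TBundle n M} (hp : p ∈ sphereBundle g) {s r : ℝ}
    (hs : s ∈ Ioo (-entryTime g p) (exitTime g p)) (h : FlowContinuousAt g s p)
    (h' : FlowContinuousAt g r (flow g s p)) : FlowContinuousAt g (s + r) p := by
  have hmem : ∀ᶠ q in 𝓝[sphereBundle g] p, q ∈ sphereBundle g := eventually_mem_nhdsWithin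
  have h1 : Tendsto (flow g s) (𝓝[sphereBundle g] p) (𝓝[sphereBundle g] (flow g s p)) := by
    refine tendsto_nhdsWithin_iff.2 ⟨h.2, ?_⟩
    filter_upwards [h.1, hmem] with q hq hqm
    exact flow_mem hg hqm hq
  have h2 : ∀ q ∈ sphereBundle g, s ∈ Ioo (-entryTime g q) (exitTime g q) →
      r ∈ Ioo (-entryTime g (flow g s q)) (exitTime g (flow g s q)) →
      s + r ∈ Ioo (-entryTime g q) (exitTime g q) ∧
        flow g r (flow g s q) = flow g (s + r) q := by
    intro q hq hs hr
    obtain ⟨e1, e2, e3⟩ := flow_shift hg hq hs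
    rw [e1, e2] at hr
    have h3 : s + r ∈ Ioo (-entryTime g q) (exitTime g q) :=
      ⟨by linarith [hr.1], by linarith [hr.2]⟩
    have := e3 (s + r) (Ioo_subset_Icc_self h3)
    rw [add_sub_cancel_left] at this
    exact ⟨h3, this⟩
  have hr : r ∈ Ioo (-entryTime g (flow g s p)) (exitTime g (flow g s p)) :=
    h'.1.self_of_nhdsWithin (flow_mem hg hp hs)
  refine ⟨?_, ?_⟩
  · filter_upwards [h.1, h1.eventually h'.1, hmem] with q hq1 hq2 hqm
    exact (h2 q hqm hq1 hq2).1
  · rw [← (h2 p hp hs hr).2]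
    refine (h'.2.comp h1).congr' ?_
    filter_upwards [h.1, h1.eventually h'.1, hmem] with q hq1 hq2 hqm
    exact (h2 q hqm hq1 hq2).2

/-- Short time continuity holds uniformly near each point of the orbit, so the times at which the
flow is continuous at `p` form an open and closed subset of the orbit interval that contains zero.
-/
lemma flowContinuousAt {p : TBundle n M} (hp : p ∈ sphereBundle g) {s : ℝ}
    (hs : s ∈ Ioo (-entryTime g p) (exitTime g p)) : FlowContinuousAt g s p := by
  set J := Ioo (-entryTime g p) (exitTime g p) with hJ
  have : PreconnectedSpace J := Subtype.preconnectedSpace isPreconnected_Ioo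
  have hcont : ContinuousOn (fun s ↦ flow g s p) J :=
    (isArc_flow hg hp).cont.mono Ioo_subset_Icc_self
  set S : Set J := {s | FlowContinuousAt g s p} with hS
  -- Two times close to `t` differ by a short time, so continuity passes from either to the other.
  -- Both openness and closedness of `S` follow.
  have key : ∀ t : J, ∀ᶠ r : J in 𝓝 t, ∀ᶠ r' : J in 𝓝 t, r ∈ S → r' ∈ S := by
    rintro ⟨t, ht⟩
    obtain ⟨ε, hε, V, hV, hpV, h⟩ := exists_flowContinuousAt hg (flow_mem hg hp ht)
    have e1 : ∀ᶠ r : J in 𝓝 ⟨t, ht⟩, flow g r p ∈ V := by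
      have := continuousOn_iff_continuous_domRestrict.1 hcont
      exact this.continuousAt.eventually (hV.eventually_mem hpV)
    have e2 : ∀ᶠ r : J in 𝓝 ⟨t, ht⟩, dist (r : ℝ) t < ε / 2 :=
      continuous_subtype_val.continuousAt.eventually (p := fun x : ℝ ↦ dist x t < ε / 2)
        (Metric.ball_mem_nhds t (half_pos hε))
    filter_upwards [e1, e2] with r hr1 hr2
    filter_upwards [e2] with r' hr' hrS
    have h1 := h _ ⟨hr1, flow_mem hg hp r.2⟩ (r' - r) (by
      rw [Real.dist_eq] at hr2 hr'
      have : (r' : ℝ) - r = (r' - t) - (r - t) := by ring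
      rw [this]
      exact (abs_sub _ _).trans (by linarith))
    have h2 := FlowContinuousAt.comp hg hp r.2 hrS h1
    rw [add_sub_cancel] at h2
    exact h2
  have hopen : IsOpen S := by
    rw [isOpen_iff_mem_nhds]
    intro t ht
    filter_upwards [(key t).self_of_nhds] with r hr
    exact hr ht
  have hclosed : IsClosed S := by
    rw [← isOpen_compl_iff, isOpen_iff_mem_nhds]
    intro t ht
    filter_upwards [key t] with r hr hrS
    exact ht (hr.self_of_nhds hrS)
  have hzero : (⟨0, (isMaxGeodesic_flow hg hp).mem_Ioo hp⟩ : J) ∈ S := by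
    obtain ⟨ε, hε, V, hV, hpV, h⟩ := exists_flowContinuousAt hg hp
    exact h p ⟨hpV, hp⟩ 0 (by simpa using hε.le)
  have huniv : S = univ := IsClopen.eq_univ ⟨hclosed, hopen⟩ ⟨_, hzero⟩
  have : (⟨s, hs⟩ : J) ∈ S := huniv ▸ mem_univ _
  exact this

/-- The domain of the flow is relatively open, and the flow is continuous. -/
lemma eventually_flow {p : TBundle n M} (hp : p ∈ sphereBundle g) {s : ℝ}
    (hs : s ∈ Ioo (-entryTime g p) (exitTime g p)) {U : Set (TBundle n M)}
    (hU : U ∈ 𝓝 (flow g s p)) :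
    ∃ ε > 0, ∀ᶠ q in 𝓝[sphereBundle g] p, ∀ r, |r - s| ≤ ε →
      r ∈ Ioo (-entryTime g q) (exitTime g q) ∧ flow g r q ∈ U := by
  obtain ⟨U', hU', hU'o, hsU'⟩ := mem_nhds_iff.1 hU
  obtain ⟨ε, hε, V, hV, hpV, hVU, h⟩ := exists_flow_mem hg (flow_mem hg hp hs) hU'o hsU'
  have hc := flowContinuousAt hg hp hs
  refine ⟨ε, hε, ?_⟩
  filter_upwards [hc.1, hc.2.eventually (hV.eventually_mem hpV),
    eventually_mem_nhdsWithin] with q hq1 hq2 hqm r hr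
  obtain ⟨e1, e2, e3⟩ := flow_shift hg hqm hq1
  obtain ⟨h1, h2, h3⟩ := h _ ⟨hq2, flow_mem hg hqm hq1⟩
  rw [e2] at h1
  rw [e1] at h2
  have hr' := abs_le.1 hr
  have hmem : r ∈ Ioo (-entryTime g q) (exitTime g q) := ⟨by linarith, by linarith⟩
  refine ⟨hmem, hU' ?_⟩
  rw [← e3 r (Ioo_subset_Icc_self hmem)]
  exact h3 _ hr

end Flow

end Charts

end

end Transport

namespace Transport

noncomputable section

open scoped NNReal

section Charts

variable {n : ℕ} {M : Type*} [TopologicalSpace M] [ChartedSpace (EuclideanHalfSpace (n + 1)) M]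
  [IsManifold (𝓡∂ (n + 1)) ∞ M]

/-! ### The boundary of the sphere bundle -/

lemma coordMap_self (p : TBundle n M) :
    coordMap p.1 p = (extChartAt (𝓡∂ (n + 1)) p.1 p.1, (p.2 : Coord n)) :=
  Prod.ext rfl (tangentCoordChange_self (mem_extChartAt_source p.1))

lemma comp_eq (p : TBundle n M) (i : Fin (n + 1)) : comp p.2 i = (coordMap p.1 p).2 i := by
  rw [coordMap_self]; rfl

lemma coordMetric_self (g : RMetric n M) (x : M) (a b : TangentSpace (𝓡∂ (n + 1)) x) :
    coordMetric g x (extChartAt (𝓡∂ (n + 1)) x x) a b = g.inner x a b := by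
  have h : ∀ a : Coord n, tangentCoordChange (𝓡∂ (n + 1)) x x x a = a := fun a ↦
    tangentCoordChange_self (mem_extChartAt_source x)
  refine (coordMetric_extChartAt g (mem_extChartAt_source x) a b).trans ?_
  exact congrArg₂ (fun a b : Coord n ↦ g.inner x (show TangentSpace (𝓡∂ (n + 1)) x from a)
    (show TangentSpace (𝓡∂ (n + 1)) x from b)) (h a) (h b)

/-- A positive definite form gives an injective map to the dual space, which has the same dimension.
The vector `u` is the gradient of the coordinate `i`. -/
lemma exists_coordMetric_eq (g : RMetric n M) {x₀ : M} {y : Coord n}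
    (hy : y ∈ (extChartAt (𝓡∂ (n + 1)) x₀).target) (i : Fin (n + 1)) :
    ∃ u : Coord n, ∀ b : Coord n, coordMetric g x₀ y u b = b i := by
  set f : Coord n →ₗ[ℝ] Module.Dual ℝ (Coord n) :=
    (ContinuousLinearMap.coeLM ℝ) ∘ₗ (coordMetric g x₀ y : Coord n →ₗ[ℝ] Coord n →L[ℝ] ℝ) with hf
  have hinj : Function.Injective f := by
    rw [injective_iff_map_eq_zero]
    intro a ha
    by_contra h0
    have h1 := coordMetric_pos g hy h0
    have h2 : coordMetric g x₀ y a a = f a a := rfl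
    rw [h2, ha] at h1
    simp at h1
  have hsurj := (LinearMap.injective_iff_surjective_of_finrank_eq_finrank
    (Subspace.dual_finrank_eq (K := ℝ) (V := Coord n)).symm).1 hinj
  obtain ⟨u, hu⟩ := hsurj ((EuclideanSpace.proj i : Coord n →L[ℝ] ℝ) : Coord n →ₗ[ℝ] ℝ)
  exact ⟨u, fun b ↦ LinearMap.congr_fun hu b⟩

/-- The normal is minus the normalized gradient of the coordinate `0`. -/
lemma exists_isOuterNormal (g : RMetric n M) (x : M) : ∃ ν, IsOuterNormal g x ν := by
  obtain ⟨u, hu⟩ := exists_coordMetric_eq g (mem_extChartAt_target (I := 𝓡∂ (n + 1)) x) 0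
  have hu' : ∀ b : TangentSpace (𝓡∂ (n + 1)) x,
      g.inner x (show TangentSpace (𝓡∂ (n + 1)) x from u) b = comp b 0 := fun b ↦
    (coordMetric_self g x u b).symm.trans (hu b)
  have hne : u ≠ 0 := by
    rintro rfl
    have := hu (basisVec n 0)
    simp [basisVec] at this
  have hpos : 0 < u 0 := by
    rw [← hu u]
    exact coordMetric_pos g (mem_extChartAt_target (I := 𝓡∂ (n + 1)) x) hne
  set k := -(Real.sqrt (u 0))⁻¹ with hk
  have hkneg : k < 0 := by rw [hk]; simpa using hpos
  have hkk : k * k * u 0 = 1 := by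
    rw [hk, neg_mul_neg, ← mul_inv, Real.mul_self_sqrt hpos.le, inv_mul_cancel₀ hpos.ne']
  have hin : ∀ b : TangentSpace (𝓡∂ (n + 1)) x,
      g.inner x (k • (show TangentSpace (𝓡∂ (n + 1)) x from u)) b = k * comp b 0 := by
    intro b
    rw [map_smul, smul_apply, hu', smul_eq_mul]
  refine ⟨k • (show TangentSpace (𝓡∂ (n + 1)) x from u), ?_, ?_, ?_⟩
  · rw [hin, ← hkk, mul_assoc]
    rfl
  · intro w hw
    rw [hin, hw, mul_zero]
  · exact mul_neg_of_neg_of_pos hkneg hpos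

/-- Subtracting a suitable multiple of `ν` from `b` leaves a vector tangent to the boundary. The
factor is negative, so inward and outward directions are told apart by the sign of the component
`0`. -/
lemma IsOuterNormal.inner_eq {g : RMetric n M} {x : M} {ν : TangentSpace (𝓡∂ (n + 1)) x}
    (h : IsOuterNormal g x ν) (b : TangentSpace (𝓡∂ (n + 1)) x) :
    g.inner x ν b = (comp ν 0)⁻¹ * comp b 0 := by
  have h1 := h.normal (b - ((comp ν 0)⁻¹ * comp b 0) • ν) (by
    change comp b 0 - ((comp ν 0)⁻¹ * comp b 0) * comp ν 0 = 0
    field_simp [h.outward.ne]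
    ring)
  rw [map_sub, map_smul, h.unit, smul_eq_mul, mul_one] at h1
  linarith

lemma mem_incoming_iff {g : RMetric n M} {p : TBundle n M} : p ∈ incoming g ↔
    p.1 ∈ (𝓡∂ (n + 1)).boundary M ∧ sqNorm g p = 1 ∧ 0 < (coordMap p.1 p).2 0 := by
  rw [← comp_eq]
  refine and_congr_right fun _ ↦ and_congr_right fun _ ↦ ⟨?_, fun h ↦ ?_⟩
  · rintro ⟨ν, hν, h⟩
    rw [hν.inner_eq] at h
    have := inv_lt_zero.2 hν.outward
    by_contra! hcon
    nlinarith
  · obtain ⟨ν, hν⟩ := exists_isOuterNormal g p.1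
    exact ⟨ν, hν, by
      rw [hν.inner_eq]; exact mul_neg_of_neg_of_pos (inv_lt_zero.2 hν.outward) h⟩

lemma mem_outgoing_iff {g : RMetric n M} {p : TBundle n M} : p ∈ outgoing g ↔
    p.1 ∈ (𝓡∂ (n + 1)).boundary M ∧ sqNorm g p = 1 ∧ (coordMap p.1 p).2 0 < 0 := by
  rw [← comp_eq]
  refine and_congr_right fun _ ↦ and_congr_right fun _ ↦ ⟨?_, fun h ↦ ?_⟩
  · rintro ⟨ν, hν, h⟩
    rw [hν.inner_eq] at h
    have := inv_lt_zero.2 hν.outward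
    by_contra! hcon
    nlinarith
  · obtain ⟨ν, hν⟩ := exists_isOuterNormal g p.1
    exact ⟨ν, hν, by
      rw [hν.inner_eq]; exact mul_pos_of_neg_of_neg (inv_lt_zero.2 hν.outward) h⟩

/-- Along a geodesic the second derivative of the coordinate `0` is minus this quantity. Strict
convexity therefore bends geodesics tangent to the boundary out of the half space. -/
lemma StrictlyConvexBoundary.coordGamma_pos {g : RMetric n M} (hconv : StrictlyConvexBoundary g)
    {p : TBundle n M} (hp : p.1 ∈ (𝓡∂ (n + 1)).boundary M) (h0 : p.2 ≠ 0)
    (h : (coordMap p.1 p).2 0 = 0) :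
    0 < coordGamma g p.1 (coordMap p.1 p).1 (coordMap p.1 p).2 0 := by
  obtain ⟨ν, hν⟩ := exists_isOuterNormal g p.1
  have h1 := hconv p.1 hp ν hν p.2 h0 ((comp_eq p 0).trans h)
  replace h1 : 0 < -((comp ν 0)⁻¹ * comp (x := p.1) (christoffelVec g p.1 p.2) 0) :=
    h1.trans_eq (congrArg Neg.neg (hν.inner_eq (christoffelVec g p.1 p.2)))
  have h2 : comp (x := p.1) (christoffelVec g p.1 p.2) 0
      = coordGamma g p.1 (coordMap p.1 p).1 (coordMap p.1 p).2 0 := by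
    rw [christoffelVec_eq, coordMap_self]; rfl
  have h3 := inv_lt_zero.2 hν.outward
  rw [← h2]
  by_contra! hcon
  have h4 : 0 ≤ (comp ν 0)⁻¹ * comp (x := p.1) (christoffelVec g p.1 p.2) 0 :=
    mul_nonneg_of_nonpos_of_nonpos h3.le hcon
  linarith

/-! ### Invariance of the inward direction under coordinate changes -/

lemma transition_zero {x x₀ : M} {y : Coord n} (hy : y ∈ transitionSource n x x₀) (h0 : y 0 = 0) :
    transition x x₀ y 0 = 0 := by
  have h := mem_boundary_iff ((extChartAt (𝓡∂ (n + 1)) x).map_target hy.1)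
  rw [(extChartAt (𝓡∂ (n + 1)) x).right_inv hy.1] at h
  exact (mem_boundary_iff hy.2).1 (h.2 h0)

omit [IsManifold (𝓡∂ (n + 1)) ∞ M] in
lemma transitionSource_mem_nhdsWithin {x x₀ : M} {y : Coord n}
    (hy : y ∈ transitionSource n x x₀) :
    transitionSource n x x₀ ∈ 𝓝[range (𝓡∂ (n + 1))] y := by
  have h1 := target_mem_nhdsWithin hy.1
  have h2 := ((continuousOn_extChartAt_symm (I := 𝓡∂ (n + 1)) x) y hy.1).preimage_mem_nhdsWithin
    ((isOpen_extChartAt_source x₀).mem_nhds hy.2)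
  refine inter_mem h1 ?_
  exact (nhdsWithin_le_iff.2 h1) h2

/-- At a boundary point the coordinate `0` of the transition attains its minimum zero over the half
space, so its derivative is nonnegative in directions that point into the half space. -/
lemma fderivWithin_transition_nonneg {x x₀ : M} {y : Coord n} (hy : y ∈ transitionSource n x x₀)
    (h0 : y 0 = 0) {w : Coord n} (hw : 0 ≤ w 0) :
    0 ≤ fderivWithin ℝ (transition x x₀) (range (𝓡∂ (n + 1))) y w 0 := by
  have h1 := ((contDiffWithinAt_transition hy).differentiableWithinAt (by simp)).hasFDerivWithinAt
  have h2 := (EuclideanSpace.proj 0 : Coord n →L[ℝ] ℝ).hasFDerivAt.comp_hasFDerivWithinAt y h1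
  have hmin : IsLocalMinOn ((EuclideanSpace.proj 0 : Coord n →L[ℝ] ℝ) ∘ transition x x₀)
      (range (𝓡∂ (n + 1))) y := by
    filter_upwards [transitionSource_mem_nhdsWithin hy] with z hz
    change transition x x₀ y 0 ≤ transition x x₀ z 0
    rw [transition_zero hy h0]
    exact target_nonneg ((extChartAt (𝓡∂ (n + 1)) x₀).map_source hz.2)
  refine hmin.hasFDerivWithinAt_nonneg h2 (mem_posTangentConeAt_of_segment_subset ?_)
  refine (𝓡∂ (n + 1)).convex_range.segment_subset (mem_range_iff.2 h0.ge) (mem_range_iff.2 ?_)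
  change 0 ≤ y 0 + w 0
  linarith

lemma fderivWithin_transition_zero {x x₀ : M} {y : Coord n} (hy : y ∈ transitionSource n x x₀)
    (h0 : y 0 = 0) {w : Coord n} (hw : w 0 = 0) :
    fderivWithin ℝ (transition x x₀) (range (𝓡∂ (n + 1))) y w 0 = 0 := by
  have h1 := fderivWithin_transition_nonneg hy h0 hw.ge
  have h2 := fderivWithin_transition_nonneg hy h0 (w := -w) (by simp [hw])
  rw [map_neg, PiLp.neg_apply] at h2
  linarith

/-- If the derivative vanished, the inverse transition would turn a vector tangent to the boundary
into the transversal vector `w`. -/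
lemma fderivWithin_transition_pos {x x₀ : M} {y : Coord n} (hy : y ∈ transitionSource n x x₀)
    (h0 : y 0 = 0) {w : Coord n} (hw : 0 < w 0) :
    0 < fderivWithin ℝ (transition x x₀) (range (𝓡∂ (n + 1))) y w 0 := by
  refine (fderivWithin_transition_nonneg hy h0 hw.le).lt_of_ne fun he ↦ ?_
  have h1 := fderivWithin_transition_zero (transition_mem hy) (transition_zero hy h0) he.symm
  rw [fderivWithin_transition_comp hy] at h1
  exact hw.ne' h1

lemma coordMap_fst_zero {x₀ : M} {p : TBundle n M} (hp : p ∈ coordSource n x₀)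
    (hb : p.1 ∈ (𝓡∂ (n + 1)).boundary M) : (coordMap x₀ p).1 0 = 0 :=
  (mem_boundary_iff hp).1 hb

lemma coordMap_snd_pos {x x₀ : M} {p : TBundle n M} (hp : p ∈ coordSource n x)
    (hp₀ : p ∈ coordSource n x₀) (hb : p.1 ∈ (𝓡∂ (n + 1)).boundary M)
    (h : 0 < (coordMap x p).2 0) : 0 < (coordMap x₀ p).2 0 := by
  have hy : (coordMap x p).1 ∈ transitionSource n x x₀ := by
    refine ⟨(coordMap_mem hp).1, ?_⟩
    change (extChartAt (𝓡∂ (n + 1)) x).symm (extChartAt (𝓡∂ (n + 1)) x p.1) ∈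
      (extChartAt (𝓡∂ (n + 1)) x₀).source
    rw [(extChartAt (𝓡∂ (n + 1)) x).left_inv hp]
    exact hp₀
  have h1 := coordMap_ofCoord_transition (z := coordMap x p) hy
  rw [ofCoord_coordMap hp] at h1
  rw [h1]
  exact fderivWithin_transition_pos hy (coordMap_fst_zero hp hb) h

lemma coordMap_neg_snd {x : M} (p : TBundle n M) :
    (coordMap x (scale (-1) p)).2 0 = -(coordMap x p).2 0 := by
  rw [coordMap_scale]; simp

lemma coordMap_snd_neg {x x₀ : M} {p : TBundle n M} (hp : p ∈ coordSource n x)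
    (hp₀ : p ∈ coordSource n x₀) (hb : p.1 ∈ (𝓡∂ (n + 1)).boundary M)
    (h : (coordMap x p).2 0 < 0) : (coordMap x₀ p).2 0 < 0 := by
  have h1 := coordMap_snd_pos (p := scale (-1) p) (x := x) (x₀ := x₀) hp hp₀ hb
    (by rw [coordMap_neg_snd]; linarith)
  rw [coordMap_neg_snd] at h1
  linarith

/-- Being outgoing may be tested in any chart. -/
lemma mem_outgoing_iff_coord {g : RMetric n M} {x₀ : M} {p : TBundle n M}
    (hp : p ∈ coordSource n x₀) : p ∈ outgoing g ↔
    (coordMap x₀ p).1 0 = 0 ∧ sqNorm g p = 1 ∧ (coordMap x₀ p).2 0 < 0 := by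
  rw [mem_outgoing_iff]
  have h : (coordMap x₀ p).1 0 = 0 ↔ p.1 ∈ (𝓡∂ (n + 1)).boundary M := (mem_boundary_iff hp).symm
  rw [h]
  exact and_congr_right fun hb ↦ and_congr_right fun _ ↦
    ⟨coordMap_snd_neg (mem_coordSource_self p) hp hb,
      coordMap_snd_neg hp (mem_coordSource_self p) hb⟩

/-! ### Reversal of geodesics -/

lemma continuous_scale_prod : Continuous (fun q : ℝ × TBundle n M ↦ scale q.1 q.2) := by
  rw [continuous_iff_continuousAt]
  rintro ⟨ρ, p⟩
  have h1 : ContinuousOn (fun q : ℝ × TBundle n M ↦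
      (ofCoord p.1 ((coordMap p.1 q.2).1, q.1 • (coordMap p.1 q.2).2) : TBundle n M))
      (univ ×ˢ coordSource n p.1) := by
    have h2 : ContinuousOn (fun q : ℝ × TBundle n M ↦ coordMap p.1 q.2)
        (univ ×ˢ coordSource n p.1) :=
      (continuousOn_coordMap (n := n) p.1).comp continuousOn_snd fun q hq ↦ hq.2
    exact (continuousOn_ofCoord (M := M) p.1).comp
      (h2.fst.prodMk (continuousOn_fst.smul h2.snd)) fun q hq ↦ ⟨(coordMap_mem hq.2).1, mem_univ _⟩
  refine (h1.congr fun q hq ↦ ?_).continuousAt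
    ((isOpen_univ.prod (isOpen_coordSource p.1)).mem_nhds ⟨mem_univ _, mem_coordSource_self p⟩)
  exact (by rw [← coordMap_scale, ofCoord_coordMap (show scale q.1 q.2 ∈ coordSource n p.1 from hq.2)])

lemma continuous_scale (ρ : ℝ) : Continuous (scale ρ : TBundle n M → TBundle n M) :=
  continuous_scale_prod.comp (continuous_const.prodMk continuous_id)

/-- `Γ(w, w)` is even in `w`, so the geodesic equation is invariant under reversal of time and
velocity. -/
lemma IsArc.reverse {g : RMetric n M} {c : ℝ → TBundle n M} {a b : ℝ} (h : IsArc g c a b) :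
    IsArc g (fun s ↦ scale (-1) (c (-s))) (-b) (-a) := by
  have hmem : ∀ s ∈ Ioo (-b) (-a), -s ∈ Ioo a b := fun s hs ↦
    ⟨by linarith [hs.2], by linarith [hs.1]⟩
  have hmem' : ∀ s ∈ Icc (-b) (-a), -s ∈ Icc a b := fun s hs ↦
    ⟨by linarith [hs.2], by linarith [hs.1]⟩
  refine ⟨(continuous_scale _).comp_continuousOn (h.cont.comp (by fun_prop) hmem'),
    fun s hs ↦ h.inter _ (hmem s hs), fun s hs x₀ hx ↦ ?_, fun s hs ↦ ?_⟩
  · have h1 := (h.ode _ (hmem s hs) x₀ hx).scomp s (hasDerivAt_neg s)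
    have hf : HasDerivAt (fun r ↦ (coordMap x₀ (c (-r))).1) _ s :=
      (ContinuousLinearMap.fst ℝ (Coord n) (Coord n)).hasFDerivAt.comp_hasDerivAt s h1
    have hs' : HasDerivAt (fun r ↦ (coordMap x₀ (c (-r))).2) _ s :=
      (ContinuousLinearMap.snd ℝ (Coord n) (Coord n)).hasFDerivAt.comp_hasDerivAt s h1
    simp only [coordMap_scale]
    refine (hf.prodMk (hs'.const_smul (-1 : ℝ))).congr_deriv ?_
    rw [coordGamma_smul]
    simp
  · rw [sqNorm_scale, h.unit _ (hmem' s hs)]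
    norm_num

end Charts

end

end Transport

namespace Transport

noncomputable section

open scoped NNReal

section Charts

variable {n : ℕ} {M : Type*} [TopologicalSpace M] [ChartedSpace (EuclideanHalfSpace (n + 1)) M]
  [IsManifold (𝓡∂ (n + 1)) ∞ M]

/-! ### Geodesics near the boundary -/

lemma isOpen_coordPreimage {x₀ : M} {f : Coord n × Coord n → ℝ}
    (hf : ContinuousOn f (coordTarget n x₀)) {k : Set ℝ} (hk : IsOpen k) :
    IsOpen {p : TBundle n M | p ∈ coordSource n x₀ ∧ f (coordMap x₀ p) ∈ k} :=
  (hf.comp (continuousOn_coordMap x₀) fun _ hp ↦ coordMap_mem hp).isOpen_inter_preimage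
    (isOpen_coordSource x₀) hk

lemma IsArc.hasDerivAt_fst {g : RMetric n M} {c : ℝ → TBundle n M} {a b : ℝ} (h : IsArc g c a b)
    {s : ℝ} (hs : s ∈ Ioo a b) {x₀ : M} (hx : c s ∈ coordSource n x₀) :
    HasDerivAt (fun r ↦ (coordMap x₀ (c r)).1 0) ((coordMap x₀ (c s)).2 0) s :=
  hasDerivAt_coord ((ContinuousLinearMap.fst ℝ (Coord n) (Coord n)).hasFDerivAt.comp_hasDerivAt s
    (h.ode s hs x₀ hx)) 0

lemma IsArc.hasDerivAt_snd {g : RMetric n M} {c : ℝ → TBundle n M} {a b : ℝ} (h : IsArc g c a b)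
    {s : ℝ} (hs : s ∈ Ioo a b) {x₀ : M} (hx : c s ∈ coordSource n x₀) :
    HasDerivAt (fun r ↦ (coordMap x₀ (c r)).2 0)
      (-coordGamma g x₀ (coordMap x₀ (c s)).1 (coordMap x₀ (c s)).2 0) s :=
  hasDerivAt_coord ((ContinuousLinearMap.snd ℝ (Coord n) (Coord n)).hasFDerivAt.comp_hasDerivAt s
    (h.ode s hs x₀ hx)) 0

lemma IsArc.continuousOn_coordMap {g : RMetric n M} {c : ℝ → TBundle n M} {a b : ℝ}
    (h : IsArc g c a b) {x₀ : M} (hx : ∀ s ∈ Icc a b, c s ∈ coordSource n x₀) :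
    ContinuousOn (fun s ↦ coordMap x₀ (c s)) (Icc a b) :=
  (Transport.continuousOn_coordMap x₀).comp h.cont hx

lemma le_of_deriv_nonpos {f f' : ℝ → ℝ} {e : ℝ} (he : 0 ≤ e) (hf : ContinuousOn f (Icc 0 e))
    (hd : ∀ s ∈ Ioo 0 e, HasDerivAt f (f' s) s) (hn : ∀ s ∈ Ioo 0 e, f' s ≤ 0) : f e ≤ f 0 := by
  refine antitoneOn_of_hasDerivWithinAt_nonpos (convex_Icc 0 e) hf (f' := f') ?_ ?_
    ⟨le_rfl, he⟩ ⟨he, le_rfl⟩ he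
  · rw [interior_Icc]; exact fun s hs ↦ (hd s hs).hasDerivWithinAt
  · rw [interior_Icc]; exact hn

/-- Unit speed geodesics that start close to a vector at the boundary that does not point inwards
leave the manifold soon. -/
lemma exists_exit_lt [T2Space M] {g : RMetric n M} (hconv : StrictlyConvexBoundary g)
    {q : TBundle n M} (hb : q.1 ∈ (𝓡∂ (n + 1)).boundary M) (hu : sqNorm g q = 1)
    (hw : (coordMap q.1 q).2 0 ≤ 0) {ε : ℝ} (hε : 0 < ε) :
    ∃ V, IsOpen V ∧ q ∈ V ∧ ∀ (c : ℝ → TBundle n M) (a b : ℝ), IsArc g c a b → 0 ∈ Icc a b →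
      c 0 ∈ V → b < ε := by
  set x₀ := q.1
  have hq : q ∈ coordSource n x₀ := mem_coordSource_self q
  have hne : q.2 ≠ 0 := ne_zero_of_sqNorm g (by rw [hu]; norm_num)
  have hy0 : (coordMap x₀ q).1 0 = 0 := coordMap_fst_zero hq hb
  have c1 : ContinuousOn (fun z : Coord n × Coord n ↦ z.1 0) (coordTarget n x₀) := by fun_prop
  have c2 : ContinuousOn (fun z : Coord n × Coord n ↦ z.2 0) (coordTarget n x₀) := by fun_prop
  have c3 : ContinuousOn (fun z : Coord n × Coord n ↦ coordGamma g x₀ z.1 z.2 0)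
      (coordTarget n x₀) :=
    (by fun_prop : Continuous fun y : Coord n ↦ y 0).comp_continuousOn
      (contDiffOn_coordGamma g x₀).continuousOn
  have hnn : ∀ p : TBundle n M, p ∈ coordSource n x₀ → 0 ≤ (coordMap x₀ p).1 0 := fun p hp ↦
    target_nonneg (coordMap_mem hp).1
  rcases hw.lt_or_eq with hw | hw
  -- Outward vectors: nearby the coordinate `0` decreases faster than `κ * s`. Since it starts below
  -- `κ * e`, it would be negative at time `e`.
  · set κ := -((coordMap x₀ q).2 0) / 2 with hκ
    have hκ0 : 0 < κ := by rw [hκ]; linarith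
    obtain ⟨ε₁, hε₁, V₁, hV₁, hqV₁, hVU, h⟩ := exists_stay g hne
      (isOpen_coordPreimage c2 (isOpen_Iio (a := -κ))) ⟨hq, by rw [mem_Iio]; linarith⟩
    set e := min ε ε₁
    have he : 0 < e := lt_min hε hε₁
    refine ⟨_, hV₁.inter (isOpen_coordPreimage c1 (isOpen_Iio (a := κ * e))),
      ⟨hqV₁, hq, by rw [mem_Iio, hy0]; positivity⟩, fun c a b hc hab hc0 ↦ ?_⟩
    by_contra! hcon
    have heb : e ≤ b := (min_le_left _ _).trans hcon
    have hU : ∀ s ∈ Icc 0 e, c s ∈ coordSource n x₀ ∧ (coordMap x₀ (c s)).2 0 < -κ :=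
      fun s hs ↦ h c a b hc hab hc0.1 s ⟨hab.1.trans hs.1, hs.2.trans heb⟩
        (by rw [abs_of_nonneg hs.1]; exact hs.2.trans (min_le_right _ _))
    have hc' := hc.mono hab.1 heb
    have key := le_of_deriv_nonpos (f := fun s ↦ (coordMap x₀ (c s)).1 0 + κ * s)
      (f' := fun s ↦ (coordMap x₀ (c s)).2 0 + κ) he.le
      ((c1.comp (hc'.continuousOn_coordMap fun s hs ↦ (hU s hs).1)
        fun s hs ↦ coordMap_mem (hU s hs).1).add (by fun_prop))
      (fun s hs ↦ (hc'.hasDerivAt_fst hs (hU s (Ioo_subset_Icc_self hs)).1).add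
        (by simpa using (hasDerivAt_id s).const_mul κ))
      (fun s hs ↦ by linarith [(hU s (Ioo_subset_Icc_self hs)).2])
    have h1 : (coordMap x₀ (c 0)).1 0 < κ * e := hc0.2.2
    have h2 := hnn _ (hU e ⟨he.le, le_rfl⟩).1
    simp only [mul_zero, add_zero] at key
    linarith
  -- Tangent vectors: nearby the second derivative of the coordinate `0` is below `-κ`. With initial
  -- position below `κ * e ^ 2 / 4` and initial velocity below `κ * e / 4`, integrating twice makes
  -- the coordinate negative at time `e`, because `1 / 4 + 1 / 4 - 1 / 2 = 0`.
  · have hpos := hconv.coordGamma_pos hb hne hw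
    set κ := coordGamma g x₀ (coordMap x₀ q).1 (coordMap x₀ q).2 0 / 2 with hκ
    have hκ0 : 0 < κ := by rw [hκ]; linarith
    obtain ⟨ε₁, hε₁, V₁, hV₁, hqV₁, hVU, h⟩ := exists_stay g hne
      (isOpen_coordPreimage c3 (isOpen_Ioi (a := κ))) ⟨hq, by rw [mem_Ioi]; linarith⟩
    set e := min ε ε₁
    have he : 0 < e := lt_min hε hε₁
    refine ⟨_, (hV₁.inter (isOpen_coordPreimage c1 (isOpen_Iio (a := κ * e ^ 2 / 4)))).inter
      (isOpen_coordPreimage c2 (isOpen_Iio (a := κ * e / 4))),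
      ⟨⟨hqV₁, hq, by rw [mem_Iio, hy0]; positivity⟩, hq, by rw [mem_Iio, hw]; positivity⟩,
      fun c a b hc hab hc0 ↦ ?_⟩
    by_contra! hcon
    have heb : e ≤ b := (min_le_left _ _).trans hcon
    have hU : ∀ s ∈ Icc 0 e, c s ∈ coordSource n x₀ ∧
        κ < coordGamma g x₀ (coordMap x₀ (c s)).1 (coordMap x₀ (c s)).2 0 :=
      fun s hs ↦ h c a b hc hab hc0.1.1 s ⟨hab.1.trans hs.1, hs.2.trans heb⟩
        (by rw [abs_of_nonneg hs.1]; exact hs.2.trans (min_le_right _ _))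
    have hc' := hc.mono hab.1 heb
    have hcont := hc'.continuousOn_coordMap fun s hs ↦ (hU s hs).1
    have hmaps : MapsTo (fun s ↦ coordMap x₀ (c s)) (Icc 0 e) (coordTarget n x₀) :=
      fun s hs ↦ coordMap_mem (hU s hs).1
    have key1 : ∀ s ∈ Icc 0 e, (coordMap x₀ (c s)).2 0 ≤ (coordMap x₀ (c 0)).2 0 - κ * s := by
      intro s hs
      have hsub : Ioo 0 s ⊆ Ioo 0 e := Ioo_subset_Ioo_right hs.2
      have := le_of_deriv_nonpos (f := fun s ↦ (coordMap x₀ (c s)).2 0 + κ * s)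
        (f' := fun s ↦ -coordGamma g x₀ (coordMap x₀ (c s)).1 (coordMap x₀ (c s)).2 0 + κ) hs.1
        (((c2.comp hcont hmaps).mono (Icc_subset_Icc_right hs.2)).add (by fun_prop))
        (fun r hr ↦ (hc'.hasDerivAt_snd (hsub hr)
          (hU r (Ioo_subset_Icc_self (hsub hr))).1).add
          (by simpa using (hasDerivAt_id r).const_mul κ))
        (fun r hr ↦ by linarith [(hU r (Ioo_subset_Icc_self (hsub hr))).2])
      simp only [mul_zero, add_zero] at this
      linarith
    have key := le_of_deriv_nonpos
      (f := fun s ↦ (coordMap x₀ (c s)).1 0 - ((coordMap x₀ (c 0)).2 0 * s - κ * s ^ 2 / 2))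
      (f' := fun s ↦ (coordMap x₀ (c s)).2 0 - ((coordMap x₀ (c 0)).2 0 - κ * s)) he.le
      ((c1.comp hcont hmaps).sub (by fun_prop))
      (fun s hs ↦ (hc'.hasDerivAt_fst hs (hU s (Ioo_subset_Icc_self hs)).1).sub
        (((hasDerivAt_id s).const_mul ((coordMap x₀ (c 0)).2 0)).sub
          (((hasDerivAt_pow 2 s).const_mul κ).div_const 2) |>.congr_deriv (by
            simp only [mul_one, Nat.cast_ofNat]; ring)))
      (fun s hs ↦ by linarith [key1 s (Ioo_subset_Icc_self hs)])
    have h1 : (coordMap x₀ (c 0)).1 0 < κ * e ^ 2 / 4 := hc0.1.2.2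
    have h3 : (coordMap x₀ (c 0)).2 0 < κ * e / 4 := hc0.2.2
    have h2 := hnn _ (hU e ⟨he.le, le_rfl⟩).1
    simp only [mul_zero, sub_zero, ne_eq, OfNat.ofNat_ne_zero, not_false_eq_true, zero_pow,
      zero_div] at key
    nlinarith

/-- Otherwise the reversed arc would start at the boundary with a velocity that does not point
inwards, and `exists_exit_lt` would make it shorter than its actual length `b - a`. -/
lemma IsArc.snd_neg [T2Space M] {g : RMetric n M} (hconv : StrictlyConvexBoundary g)
    {c : ℝ → TBundle n M} {a b : ℝ} (h : IsArc g c a b) (hab : a < b)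
    (hb : (c b).1 ∈ (𝓡∂ (n + 1)).boundary M) : (coordMap (c b).1 (c b)).2 0 < 0 := by
  by_contra! hcon
  have hu : sqNorm g (scale (-1) (c b)) = 1 := by
    rw [sqNorm_scale, h.unit b ⟨hab.le, le_rfl⟩]; norm_num
  have h1 := exists_exit_lt (q := scale (-1) (c b)) hconv hb hu (by
    change (coordMap (c b).1 (scale (-1) (c b))).2 0 ≤ 0
    rw [coordMap_neg_snd]; linarith) (sub_pos.2 hab)
  obtain ⟨V, -, hV, h2⟩ := h1
  have h3 := h2 _ _ _ (h.reverse.shift (-b)) ⟨by linarith, by linarith⟩ (by simpa using hV)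
  linarith

lemma IsArc.mem_outgoing [T2Space M] {g : RMetric n M} (hconv : StrictlyConvexBoundary g)
    {c : ℝ → TBundle n M} {a b : ℝ} (h : IsArc g c a b) (hab : a < b)
    (hb : (c b).1 ∈ (𝓡∂ (n + 1)).boundary M) : c b ∈ outgoing g :=
  mem_outgoing_iff.2 ⟨hb, h.unit b ⟨hab.le, le_rfl⟩, h.snd_neg hconv hab hb⟩

lemma IsArc.mem_incoming [T2Space M] {g : RMetric n M} (hconv : StrictlyConvexBoundary g)
    {c : ℝ → TBundle n M} {a b : ℝ} (h : IsArc g c a b) (hab : a < b)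
    (ha : (c a).1 ∈ (𝓡∂ (n + 1)).boundary M) : c a ∈ incoming g := by
  refine mem_incoming_iff.2 ⟨ha, h.unit a ⟨le_rfl, hab.le⟩, ?_⟩
  have h1 := h.reverse.snd_neg hconv (neg_lt_neg hab) (by simpa [scale] using ha)
  simp only [neg_neg] at h1
  change (coordMap (c a).1 (scale (-1) (c a))).2 0 < 0 at h1
  rw [coordMap_neg_snd] at h1
  linarith

/-- A maximal geodesic through an incoming vector starts there. -/
lemma IsMaxGeodesic.left_eq_zero [T2Space M] {g : RMetric n M} (hconv : StrictlyConvexBoundary g)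
    {p : TBundle n M} (hp : p ∈ incoming g) {c : ℝ → TBundle n M} {a b : ℝ}
    (h : IsMaxGeodesic g p c a b) : a = 0 ∧ 0 < b := by
  have hp' := mem_incoming_iff.1 hp
  have harc := h.isArc hp'.2.1
  rcases h.zero_mem.1.eq_or_lt with h0 | h0
  · exact ⟨h0, h0 ▸ h.lt⟩
  exfalso
  rcases h.zero_mem.2.eq_or_lt with h1 | h1
  · have h2 := harc.snd_neg hconv h.lt h.right
    rw [← h1, h.start] at h2
    exact lt_asymm h2 hp'.2.2
  · have := h.interior 0 ⟨h0, h1⟩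
    rw [h.start] at this
    exact not_interior_of_boundary hp'.1 this

/-- A maximal geodesic through an outgoing vector ends there. -/
lemma IsMaxGeodesic.right_eq_zero [T2Space M] {g : RMetric n M} (hconv : StrictlyConvexBoundary g)
    {p : TBundle n M} (hp : p ∈ outgoing g) {c : ℝ → TBundle n M} {a b : ℝ}
    (h : IsMaxGeodesic g p c a b) : b = 0 ∧ a < 0 := by
  have hp' := mem_outgoing_iff.1 hp
  have harc := h.isArc hp'.2.1
  rcases h.zero_mem.2.eq_or_lt with h0 | h0
  · exact ⟨h0.symm, h0 ▸ h.lt⟩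
  exfalso
  rcases h.zero_mem.1.eq_or_lt with h1 | h1
  · have h2 := (mem_incoming_iff.1 (harc.mem_incoming hconv h.lt h.left)).2.2
    rw [h1, h.start] at h2
    exact lt_asymm h2 hp'.2.2
  · have := h.interior 0 ⟨h1, h0⟩
    rw [h.start] at this
    exact not_interior_of_boundary hp'.1 this

/-! ### The exit time is bounded -/

/-- By compactness the forms are bounded below by a constant `m > 0` on the unit sphere of the norm.
Vectors of length one for the forms thus have norm at most `1 / √m`, and the set is closed in a
compact one. -/
lemma isCompact_unit_bilin {E F : Type*} [NormedAddCommGroup E] [NormedSpace ℝ E] [ProperSpace E]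
    [TopologicalSpace F] [T2Space F] {B : F → E →L[ℝ] E →L[ℝ] ℝ} {K : Set F} (hK : IsCompact K)
    (hcont : ContinuousOn (fun z : F × E ↦ B z.1 z.2 z.2) (K ×ˢ univ))
    (hpos : ∀ y ∈ K, ∀ w : E, w ≠ 0 → 0 < B y w w) :
    IsCompact {z : F × E | z.1 ∈ K ∧ B z.1 z.2 z.2 = 1} := by
  have hclosed : IsClosed {z : F × E | z.1 ∈ K ∧ B z.1 z.2 z.2 = 1} := by
    have h1 := hcont.preimage_isClosed_of_isClosed (hK.isClosed.prod isClosed_univ)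
      (isClosed_singleton (x := (1 : ℝ)))
    have h2 : {z : F × E | z.1 ∈ K ∧ B z.1 z.2 z.2 = 1}
        = K ×ˢ univ ∩ (fun z : F × E ↦ B z.1 z.2 z.2) ⁻¹' {1} := by
      ext z
      simp
    rwa [h2]
  have hS : IsCompact (K ×ˢ Metric.sphere (0 : E) 1) := hK.prod (isCompact_sphere _ _)
  obtain ⟨m, hm, hmin⟩ : ∃ m > 0, ∀ y ∈ K, ∀ w : E, ‖w‖ = 1 → m ≤ B y w w := by
    rcases (K ×ˢ Metric.sphere (0 : E) 1).eq_empty_or_nonempty with he | hne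
    · refine ⟨1, one_pos, fun y hy w hw ↦ ?_⟩
      have : (y, w) ∈ K ×ˢ Metric.sphere (0 : E) 1 := ⟨hy, by simpa using hw⟩
      rw [he] at this
      exact this.elim
    · obtain ⟨z, hz, hmin⟩ := hS.exists_isMinOn hne
        (hcont.mono (prod_mono le_rfl (subset_univ _)))
      refine ⟨B z.1 z.2 z.2, hpos _ hz.1 _ ?_, fun y hy w hw ↦ ?_⟩
      · rintro h0
        have := hz.2
        rw [h0] at this
        simp at this
      · exact isMinOn_iff.1 hmin (y, w) ⟨hy, by simpa using hw⟩
  refine IsCompact.of_isClosed_subset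
    (hK.prod (isCompact_closedBall (0 : E) (Real.sqrt m)⁻¹)) hclosed ?_
  rintro ⟨y, w⟩ ⟨hy, hw⟩
  refine ⟨hy, ?_⟩
  rw [mem_closedBall_zero_iff]
  rcases eq_or_ne w 0 with rfl | h0
  · simp
  have h1 := hmin y hy (‖w‖⁻¹ • w) (by
    rw [norm_smul, norm_inv, norm_norm, inv_mul_cancel₀ (norm_ne_zero_iff.2 h0)])
  simp only [map_smul, smul_apply, smul_eq_mul] at h1
  change B y w w = 1 at hw
  rw [hw, mul_one, ← mul_inv] at h1
  have hpos : 0 < ‖w‖ := norm_pos_iff.2 h0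
  have h2 : m * (‖w‖ * ‖w‖) ≤ 1 := by
    have := mul_le_mul_of_nonneg_right h1 (mul_pos hpos hpos).le
    rwa [inv_mul_cancel₀ (mul_pos hpos hpos).ne'] at this
  rw [le_inv_comm₀ hpos (Real.sqrt_pos.2 hm), Real.sqrt_le_left (by positivity), inv_pow,
    le_inv_comm₀ hm (by positivity), sq]
  rw [inv_eq_one_div, le_div_iff₀ hm]
  linarith

lemma isCompact_unit_coord (g : RMetric n M) {x₀ : M} {K : Set (Coord n)} (hK : IsCompact K)
    (hKt : K ⊆ (extChartAt (𝓡∂ (n + 1)) x₀).target) :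
    IsCompact {z : Coord n × Coord n | z.1 ∈ K ∧ coordMetric g x₀ z.1 z.2 z.2 = 1} :=
  isCompact_unit_bilin hK ((contDiffOn_sqNorm_coord g x₀).continuousOn.mono
    (prod_mono hKt le_rfl)) fun _ hy _ hw ↦ coordMetric_pos g (hKt hy) hw

lemma isCompact_unit [CompactSpace M] (g : RMetric n M) :
    IsCompact {p : TBundle n M | sqNorm g p = 1} := by
  have key : ∀ x : M, ∃ V ∈ 𝓝 x, ∃ K : Set (TBundle n M), IsCompact K ∧
      ∀ p : TBundle n M, p.1 ∈ V → sqNorm g p = 1 → p ∈ K := by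
    intro x
    set y := extChartAt (𝓡∂ (n + 1)) x x with hy
    obtain ⟨ρ, hρ, hball⟩ := Metric.mem_nhdsWithin_iff.1
      (target_mem_nhdsWithin (mem_extChartAt_target (I := 𝓡∂ (n + 1)) x))
    set K : Set (Coord n) := Metric.closedBall y (ρ / 2) ∩ range (𝓡∂ (n + 1))
    have hKt : K ⊆ (extChartAt (𝓡∂ (n + 1)) x).target := fun z hz ↦
      hball ⟨Metric.closedBall_subset_ball (by linarith) hz.1, hz.2⟩
    have hK : IsCompact K :=
      (isCompact_closedBall _ _).inter_right (𝓡∂ (n + 1)).isClosed_range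
    refine ⟨(extChartAt (𝓡∂ (n + 1)) x).source ∩
      extChartAt (𝓡∂ (n + 1)) x ⁻¹' Metric.ball y (ρ / 2), ?_, _,
      (isCompact_unit_coord g hK hKt).image_of_continuousOn
        ((continuousOn_ofCoord (M := M) x).mono fun z hz ↦ ⟨hKt hz.1, mem_univ _⟩), ?_⟩
    · exact inter_mem (extChartAt_source_mem_nhds x)
        ((continuousAt_extChartAt x).preimage_mem_nhds (Metric.ball_mem_nhds _ (by positivity)))
    · intro p hpV hp
      refine ⟨coordMap x p, ⟨⟨Metric.ball_subset_closedBall hpV.2,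
        target_subset_range _ (coordMap_mem hpV.1).1⟩, ?_⟩, ofCoord_coordMap hpV.1⟩
      rw [← sqNorm_eq g hpV.1, hp]
  choose V hV K hK hVK using key
  obtain ⟨t, ht⟩ := isCompact_univ.elim_nhds_subcover V fun x _ ↦ hV x
  refine (t.isCompact_biUnion fun x _ ↦ hK x).of_isClosed_subset
    (isClosed_eq (continuous_sqNorm g) continuous_const) fun p hp ↦ ?_
  obtain ⟨x, hx, hpx⟩ := mem_iUnion₂.1 (ht.2 (mem_univ p.1))
  exact mem_iUnion₂.2 ⟨x, hx, hVK x p hpx hp⟩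

end Charts

end

end Transport

namespace Transport

noncomputable section

open scoped NNReal

section Charts

variable {n : ℕ} {M : Type*} [TopologicalSpace M] [ChartedSpace (EuclideanHalfSpace (n + 1)) M]
  [IsManifold (𝓡∂ (n + 1)) ∞ M]

section Exit

variable [T2Space M] {g : RMetric n M}

omit [T2Space M] in
lemma exit_mem_boundary (hg : NonTrapping g) {p : TBundle n M} (hp : p ∈ sphereBundle g) :
    (flow g (exitTime g p) p).1 ∈ (𝓡∂ (n + 1)).boundary M :=
  (isMaxGeodesic_flow hg hp).right

lemma exit_mem_outgoing (hconv : StrictlyConvexBoundary g) (hg : NonTrapping g) {p : TBundle n M}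
    (hp : p ∈ sphereBundle g) : flow g (exitTime g p) p ∈ outgoing g :=
  (isArc_flow hg hp).mem_outgoing hconv (isMaxGeodesic_flow hg hp).lt (exit_mem_boundary hg hp)

/-- The exit time is bounded near points of the sphere bundle. -/
lemma exists_exit_le_of_mem (hconv : StrictlyConvexBoundary g) (hg : NonTrapping g)
    {p₀ : TBundle n M} (hp₀ : p₀ ∈ sphereBundle g) :
    ∃ V ∈ 𝓝 p₀, ∃ B, ∀ p ∈ V ∩ sphereBundle g, exitTime g p ≤ B := by
  have hm := isMaxGeodesic_flow hg hp₀
  have ho := mem_outgoing_iff.1 (exit_mem_outgoing hconv hg hp₀)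
  obtain ⟨V, hV, hqV, h⟩ := exists_exit_lt hconv ho.1 ho.2.1 ho.2.2.le one_pos
  have hcont := (isArc_flow hg hp₀).cont (exitTime g p₀) ⟨hm.lt.le, le_rfl⟩
  -- Shortly before it leaves, the orbit of `p₀` enters the set `V` of vectors that exit within time
  -- one. By continuity of the flow, nearby orbits are in `V` at the same time `s`, so they leave
  -- before `s + 1`.
  have h1 : ∀ᶠ s in 𝓝[<] (exitTime g p₀), flow g s p₀ ∈ V := by
    have h2 := hcont.mono (Ioo_subset_Icc_self) |>.eventually (hV.eventually_mem hqV)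
    rwa [nhdsWithin_Ioo_eq_nhdsLT hm.lt] at h2
  have h3 : ∀ᶠ s in 𝓝[<] (exitTime g p₀), s ∈ Ioo (-entryTime g p₀) (exitTime g p₀) :=
    Ioo_mem_nhdsLT hm.lt
  obtain ⟨s, hs1, hs2⟩ := (h1.and h3).exists
  obtain ⟨ε, hε, hev⟩ := eventually_flow hg hp₀ hs2 (hV.mem_nhds hs1)
  obtain ⟨V', hV', hsub⟩ := mem_nhdsWithin_iff_exists_mem_nhds_inter.1 hev
  refine ⟨V', hV', s + 1, fun p hp ↦ ?_⟩
  obtain ⟨h4, h5⟩ := hsub hp s (by simpa using hε.le)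
  have hpm := flow_mem hg hp.2 h4
  have h6 := h _ _ _ (isArc_flow hg hpm) (isMaxGeodesic_flow hg hpm).zero_mem
    (by rw [flow_zero hg hpm]; exact h5)
  rw [(flow_shift hg hp.2 h4).2.1] at h6
  linarith

omit [T2Space M] in
lemma exists_exit_le_of_isCompact {C : Set (TBundle n M)} (hC : IsCompact C)
    (h : ∀ p₀ ∈ C, ∃ V ∈ 𝓝 p₀, ∃ B, ∀ p ∈ V ∩ sphereBundle g, exitTime g p ≤ B) :
    ∃ B, ∀ p ∈ C ∩ sphereBundle g, exitTime g p ≤ B := by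
  refine hC.induction_on (p := fun A ↦ ∃ B, ∀ p ∈ A ∩ sphereBundle g, exitTime g p ≤ B)
    ⟨0, by simp⟩ (fun A A' hA ⟨B, hB⟩ ↦ ⟨B, fun p hp ↦ hB p ⟨hA hp.1, hp.2⟩⟩)
    (fun A A' ⟨B, hB⟩ ⟨B', hB'⟩ ↦ ⟨max B B', ?_⟩) fun p hp ↦ ?_
  · rintro p ⟨hp | hp, hpm⟩
    · exact (hB p ⟨hp, hpm⟩).trans (le_max_left _ _)
    · exact (hB' p ⟨hp, hpm⟩).trans (le_max_right _ _)
  · obtain ⟨V, hV, hB⟩ := h p hp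
    exact ⟨V, mem_nhdsWithin_of_mem_nhds hV, hB⟩

/-- Near an inward boundary vector, an orbit either leaves before time `ε` or has by then moved into
the interior by at least `κ * ε`. The vectors reached in the second case lie in a compact set over
the interior, where the exit time is already known to be bounded. -/
lemma exists_exit_le_of_incoming [CompactSpace M] (hconv : StrictlyConvexBoundary g)
    (hg : NonTrapping g) {p₀ : TBundle n M} (hu : sqNorm g p₀ = 1)
    (hw : 0 < (coordMap p₀.1 p₀).2 0) :
    ∃ V ∈ 𝓝 p₀, ∃ B, ∀ p ∈ V ∩ sphereBundle g, exitTime g p ≤ B := by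
  set x₀ := p₀.1
  have hps : p₀ ∈ coordSource n x₀ := mem_coordSource_self p₀
  have hne : p₀.2 ≠ 0 := ne_zero_of_sqNorm g (by rw [hu]; norm_num)
  set κ := (coordMap x₀ p₀).2 0 / 2 with hκ
  have hκ0 : 0 < κ := by rw [hκ]; linarith
  set z₀ := coordMap x₀ p₀ with hz₀
  obtain ⟨ρ, hρ, hball⟩ := Metric.mem_nhdsWithin_iff.1
    (coordTarget_mem_nhdsWithin (coordMap_mem hps))
  have c2 : Continuous (fun z : Coord n × Coord n ↦ z.2 0) := by fun_prop
  have hU : IsOpen {p : TBundle n M | p ∈ coordSource n x₀ ∧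
      coordMap x₀ p ∈ Metric.ball z₀ (ρ / 2) ∩ {z | κ < z.2 0}} :=
    (continuousOn_coordMap x₀).isOpen_inter_preimage (isOpen_coordSource x₀)
      (Metric.isOpen_ball.inter (isOpen_lt continuous_const c2))
  obtain ⟨ε, hε, V, hV, hpV, -, h⟩ := exists_stay g hne hU
    ⟨hps, Metric.mem_ball_self (by positivity), by rw [mem_ofPred_eq]; linarith⟩
  set K : Set (Coord n × Coord n) := Metric.closedBall z₀ (ρ / 2) ∩ {z | κ * ε ≤ z.1 0} with hKdef
  have hKt : K ⊆ coordTarget n x₀ := fun z hz ↦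
    hball ⟨Metric.closedBall_subset_ball (by linarith) hz.1,
      mem_range_iff.2 ((by positivity : 0 ≤ κ * ε).trans hz.2), mem_univ _⟩
  have hK : IsCompact K := (isCompact_closedBall _ _).inter_right
    (isClosed_le continuous_const (by fun_prop))
  have hC : IsCompact (ofCoord x₀ '' K ∩ {p : TBundle n M | sqNorm g p = 1}) :=
    (hK.image_of_continuousOn ((continuousOn_ofCoord (M := M) x₀).mono hKt)).inter_right
      (isClosed_eq (continuous_sqNorm g) continuous_const)
  obtain ⟨B, hB⟩ := exists_exit_le_of_isCompact (g := g) hC fun p hp ↦ by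
    obtain ⟨⟨z, hz, rfl⟩, hp⟩ := hp
    refine exists_exit_le_of_mem hconv hg ⟨(mem_interior_iff (ofCoord_mem (hKt hz))).2 ?_, hp⟩
    have h1 : extChartAt (𝓡∂ (n + 1)) x₀ (ofCoord x₀ z : TBundle n M).1 = z.1 :=
      congrArg Prod.fst (coordMap_ofCoord (M := M) (hKt hz))
    rw [h1]
    exact (mul_pos hκ0 hε).trans_le hz.2
  refine ⟨V, hV.mem_nhds hpV, max ε (ε + B), fun p hp ↦ ?_⟩
  by_cases hle : exitTime g p ≤ ε
  · exact hle.trans (le_max_left _ _)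
  push Not at hle
  have harc := isArc_flow hg hp.2
  have hm := isMaxGeodesic_flow hg hp.2
  have hstay : ∀ s ∈ Icc 0 ε, flow g s p ∈ coordSource n x₀ ∧
      coordMap x₀ (flow g s p) ∈ Metric.ball z₀ (ρ / 2) ∩ {z | κ < z.2 0} := fun s hs ↦
    h _ _ _ harc hm.zero_mem (by rw [flow_zero hg hp.2]; exact hp.1) s
      ⟨hm.zero_mem.1.trans hs.1, hs.2.trans hle.le⟩ (by rw [abs_of_nonneg hs.1]; exact hs.2)
  have hεm : ε ∈ Ioo (-entryTime g p) (exitTime g p) :=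
    ⟨by linarith [entryTime_pos hg hp.2], hle⟩
  have hmem := flow_mem hg hp.2 hεm
  have harc' := harc.mono hm.zero_mem.1 hle.le
  have hcont : ContinuousOn (fun s ↦ (coordMap x₀ (flow g s p)).1 0) (Icc 0 ε) :=
    (by fun_prop : Continuous fun z : Coord n × Coord n ↦ z.1 0).comp_continuousOn
      (harc'.continuousOn_coordMap fun s hs ↦ (hstay s hs).1)
  have key := le_of_deriv_nonpos (f := fun s ↦ κ * s - (coordMap x₀ (flow g s p)).1 0)
    (f' := fun s ↦ κ - (coordMap x₀ (flow g s p)).2 0) hε.le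
    (ContinuousOn.sub (by fun_prop) hcont)
    (fun s hs ↦ HasDerivAt.sub (by simpa using (hasDerivAt_id s).const_mul κ)
      (harc'.hasDerivAt_fst hs (hstay s (Ioo_subset_Icc_self hs)).1))
    (fun s hs ↦ by
      have : κ < (coordMap x₀ (flow g s p)).2 0 := (hstay s (Ioo_subset_Icc_self hs)).2.2
      linarith)
  have h0 : 0 ≤ (coordMap x₀ (flow g 0 p)).1 0 :=
    target_nonneg (coordMap_mem (hstay 0 ⟨le_rfl, hε.le⟩).1).1
  have h1 := hstay ε ⟨hε.le, le_rfl⟩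
  have h2 := hB (flow g ε p) ⟨⟨⟨coordMap x₀ (flow g ε p), ⟨Metric.ball_subset_closedBall h1.2.1, by
    rw [mem_ofPred_eq]; simp only [mul_zero] at key; linarith⟩, ofCoord_coordMap h1.1⟩,
      hmem.2⟩, hmem⟩
  rw [(flow_shift hg hp.2 hεm).2.1] at h2
  exact (by linarith : exitTime g p ≤ ε + B).trans (le_max_right _ _)

/-- The exit time is bounded on a compact nontrapping manifold with strictly convex boundary. -/
lemma exists_exitTime_le [CompactSpace M] (hconv : StrictlyConvexBoundary g)
    (hg : NonTrapping g) : ∃ B, ∀ p ∈ sphereBundle g, exitTime g p ≤ B := by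
  obtain ⟨B, hB⟩ := exists_exit_le_of_isCompact (g := g) (isCompact_unit g) fun p hp ↦ by
    -- Local bounds near interior vectors, near boundary vectors that do not point inwards, and near
    -- inward ones; compactness of the set of all unit vectors makes them global.
    by_cases hint : p.1 ∈ (𝓡∂ (n + 1)).interior M
    · exact exists_exit_le_of_mem hconv hg ⟨hint, hp⟩
    · have hb : p.1 ∈ (𝓡∂ (n + 1)).boundary M := by
        rw [← (𝓡∂ (n + 1)).compl_interior]; exact hint
      rcases le_or_gt ((coordMap p.1 p).2 0) 0 with hw | hw
      · obtain ⟨V, hV, hpV, h⟩ := exists_exit_lt hconv hb hp hw one_pos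
        refine ⟨V, hV.mem_nhds hpV, 1, fun q hq ↦ (h _ _ _ (isArc_flow hg hq.2)
          (isMaxGeodesic_flow hg hq.2).zero_mem ?_).le⟩
        rw [flow_zero hg hq.2]
        exact hq.1
      · exact exists_exit_le_of_incoming hconv hg hp hw
  exact ⟨B, fun p hp ↦ hB p ⟨hp.2, hp⟩⟩

end Exit

/-! ### Measurability -/

omit [IsManifold (𝓡∂ (n + 1)) ∞ M] in
lemma exists_finite_charts [CompactSpace M] :
    ∃ t : Finset M, ∀ x : M, ∃ x₀ ∈ t, x ∈ (extChartAt (𝓡∂ (n + 1)) x₀).source := by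
  obtain ⟨t, ht⟩ := (isCompact_univ (X := M)).elim_nhds_subcover
    (fun x ↦ (extChartAt (𝓡∂ (n + 1)) x).source) fun x _ ↦ extChartAt_source_mem_nhds x
  exact ⟨t, fun x ↦ by simpa using ht.2 (mem_univ x)⟩

/-- Second countability makes Borel sets of `ℝ × TM` measurable for the product structure, and
allows countable subcovers. -/
instance [CompactSpace M] : SecondCountableTopology (TBundle n M) := by
  have h2 : SecondCountableTopology (EuclideanHalfSpace (n + 1)) :=
    TopologicalSpace.Subtype.secondCountableTopology {x : Coord n | 0 ≤ x 0}
  have h3 : SecondCountableTopology (ModelProd (EuclideanHalfSpace (n + 1)) (Coord n)) :=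
    inferInstanceAs (SecondCountableTopology (EuclideanHalfSpace (n + 1) × Coord n))
  obtain ⟨t, ht⟩ := exists_finite_charts (n := n) (M := M)
  refine ChartedSpace.secondCountable_of_countable_cover
    (ModelProd (EuclideanHalfSpace (n + 1)) (Coord n))
    (s := (fun x ↦ (⟨x, 0⟩ : TBundle n M)) '' (t : Set M)) ?_ (t.countable_toSet.image _)
  rw [eq_univ_iff_forall]
  intro p
  obtain ⟨x₀, hx₀, hp⟩ := ht p.1
  refine mem_iUnion₂.2 ⟨_, mem_image_of_mem _ hx₀, ?_⟩
  have h1 : p ∈ coordSource n x₀ := hp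
  rw [coordSource_eq] at h1
  simpa using h1

lemma isOpen_interiorBundle : IsOpen {p : TBundle n M | p.1 ∈ (𝓡∂ (n + 1)).interior M} :=
  ((𝓡∂ (n + 1)).isOpen_interior (M := M) (n := ∞) (by simp)).preimage
    (FiberBundle.continuous_proj (Coord n) _)

lemma measurableSet_sphereBundle (g : RMetric n M) : MeasurableSet (sphereBundle g) :=
  isOpen_interiorBundle.measurableSet.inter
    (isClosed_eq (continuous_sqNorm g) continuous_const).measurableSet

lemma measurableSet_outgoing [CompactSpace M] (g : RMetric n M) : MeasurableSet (outgoing g) := by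
  obtain ⟨t, ht⟩ := exists_finite_charts (n := n) (M := M)
  have h : outgoing g = ({p | sqNorm g p = 1} ∩ {p | p.1 ∈ (𝓡∂ (n + 1)).interior M}ᶜ) ∩
      ⋃ x₀ ∈ t, {p | p ∈ coordSource n x₀ ∧ (coordMap x₀ p).2 0 ∈ Iio 0} := by
    ext p
    simp only [mem_inter_iff, mem_iUnion, mem_ofPred_eq, mem_compl_iff, exists_prop]
    constructor
    · intro hp
      obtain ⟨x₀, hx₀, hpx⟩ := ht p.1
      have hp' := (mem_outgoing_iff_coord (x₀ := x₀) hpx).1 hp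
      exact ⟨⟨hp'.2.1, not_interior_of_boundary hp.1⟩, x₀, hx₀, hpx, hp'.2.2⟩
    · rintro ⟨⟨h1, h2⟩, x₀, hx₀, hpx, h3⟩
      exact (mem_outgoing_iff_coord hpx).2 ⟨(mem_boundary_iff hpx).1 (by
        rw [← (𝓡∂ (n + 1)).compl_interior]; exact h2), h1, h3⟩
  rw [h]
  have c2 : ∀ x₀ : M, ContinuousOn (fun z : Coord n × Coord n ↦ z.2 0) (coordTarget n x₀) :=
    fun x₀ ↦ by fun_prop
  exact ((isClosed_eq (continuous_sqNorm g) continuous_const).measurableSet.inter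
    isOpen_interiorBundle.measurableSet.compl).inter
    (isOpen_biUnion fun x₀ _ ↦ isOpen_coordPreimage (c2 x₀) isOpen_Iio).measurableSet

/-- The domain of the geodesic flow. -/
def flowDomain (g : RMetric n M) : Set (ℝ × TBundle n M) :=
  {q | q.2 ∈ sphereBundle g ∧ q.1 ∈ Ioo (-entryTime g q.2) (exitTime g q.2)}

section FlowMeasurable

variable [T2Space M] {g : RMetric n M} (hg : NonTrapping g)
include hg

lemma eventually_flow_prod {q : ℝ × TBundle n M} (hq : q ∈ flowDomain g) {U : Set (TBundle n M)}
    (hU : U ∈ 𝓝 (flow g q.1 q.2)) :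
    ∀ᶠ q' in 𝓝[univ ×ˢ sphereBundle g] q, q' ∈ flowDomain g ∧ flow g q'.1 q'.2 ∈ U := by
  obtain ⟨ε, hε, h⟩ := eventually_flow hg hq.1 hq.2 hU
  have h1 : ∀ᶠ s in 𝓝 q.1, |s - q.1| ≤ ε := by
    filter_upwards [Metric.closedBall_mem_nhds q.1 hε] with s hs
    rwa [Metric.mem_closedBall, Real.dist_eq] at hs
  rw [show q = (q.1, q.2) from rfl, nhdsWithin_prod_eq, nhdsWithin_univ]
  have h2 := h.and (eventually_mem_nhdsWithin (s := sphereBundle g) (a := q.2))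
  filter_upwards [h1.prod_mk h2] with q' hq'
  have := hq'.2.1 q'.1 hq'.1
  exact ⟨⟨hq'.2.2, this.1⟩, this.2⟩

lemma continuousOn_flow_prod :
    ContinuousOn (fun q : ℝ × TBundle n M ↦ flow g q.1 q.2) (flowDomain g) := by
  intro q hq
  rw [ContinuousWithinAt, tendsto_def]
  intro U hU
  have := eventually_flow_prod hg hq hU
  have hs : flowDomain g ⊆ univ ×ˢ sphereBundle g := fun q' hq' ↦ ⟨mem_univ _, hq'.1⟩
  exact (this.filter_mono (nhdsWithin_mono q hs)).mono fun q' h ↦ h.2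

lemma measurableSet_flowDomain [CompactSpace M] : MeasurableSet (flowDomain g) := by
  have h : ∀ q ∈ flowDomain g, ∃ V : Set (ℝ × TBundle n M), IsOpen V ∧ q ∈ V ∧
      V ∩ univ ×ˢ sphereBundle g ⊆ flowDomain g := by
    intro q hq
    have := eventually_flow_prod hg hq univ_mem
    obtain ⟨V, hV, hqV, hsub⟩ := mem_nhdsWithin.1 this
    exact ⟨V, hV, hqV, fun q' hq' ↦ (hsub hq').1⟩
  choose! V hV hqV hsub using h
  have heq : flowDomain g = (⋃ q ∈ flowDomain g, V q) ∩ univ ×ˢ sphereBundle g := by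
    ext q
    refine ⟨fun hq ↦ ⟨mem_iUnion₂.2 ⟨q, hq, hqV q hq⟩, mem_univ _, hq.1⟩, ?_⟩
    rintro ⟨hq, hqs⟩
    obtain ⟨q', hq', hqq⟩ := mem_iUnion₂.1 hq
    exact hsub q' hq' ⟨hqq, hqs⟩
  rw [heq]
  exact (isOpen_biUnion hV).measurableSet.inter
    (MeasurableSet.univ.prod (measurableSet_sphereBundle g))

end FlowMeasurable

end Charts

end

end Transport

namespace Transport

noncomputable section

open scoped NNReal

/-! ### Null sets -/

/-- The points `α i` are the images of the points `β i` under a Lipschitz map. Hausdorff measure of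
the common dimension is a Haar measure on both spaces, and Lipschitz maps preserve its null sets.
Thus Grönwall estimates suffice to transport null sets. -/
lemma measure_range_eq_zero_of_dist_le {ι E F : Type*} [NormedAddCommGroup E] [NormedSpace ℝ E]
    [FiniteDimensional ℝ E] [MeasurableSpace E] [BorelSpace E] [NormedAddCommGroup F]
    [NormedSpace ℝ F] [FiniteDimensional ℝ F] [MeasurableSpace F] [BorelSpace F]
    (μ : Measure E) [μ.IsAddHaarMeasure] (ν : Measure F) [ν.IsAddHaarMeasure]
    (hdim : Module.finrank ℝ E = Module.finrank ℝ F) {α : ι → E} {β : ι → F} {K : ℝ≥0}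
    (h : ∀ i j, dist (α i) (α j) ≤ K * dist (β i) (β j)) (hβ : ν (range β) = 0) :
    μ (range α) = 0 := by
  classical
  have hE : (μH[Module.finrank ℝ E] : Measure E).IsAddHaarMeasure :=
    isAddHaarMeasure_hausdorffMeasure
  have hF : (μH[Module.finrank ℝ E] : Measure F).IsAddHaarMeasure := by
    rw [hdim]; exact isAddHaarMeasure_hausdorffMeasure
  have hF0 : (μH[Module.finrank ℝ E] : Measure F) (range β) = 0 :=
    Measure.absolutelyContinuous_isAddHaarMeasure _ ν hβ
  refine Measure.absolutelyContinuous_isAddHaarMeasure μ (μH[Module.finrank ℝ E]) ?_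
  set f : F → E := fun z ↦ if hz : z ∈ range β then α hz.choose else 0 with hf
  have hfβ : ∀ i, f (β i) = α i := by
    intro i
    have hz : β i ∈ range β := mem_range_self i
    rw [hf]
    simp only [dif_pos hz]
    have := h hz.choose i
    rw [hz.choose_spec, dist_self, mul_zero] at this
    exact dist_le_zero.1 this
  have hlip : LipschitzOnWith K f (range β) := by
    refine LipschitzOnWith.of_dist_le_mul ?_
    rintro _ ⟨i, rfl⟩ _ ⟨j, rfl⟩
    rw [hfβ, hfβ]
    exact h i j
  have himg : f '' range β = range α := by
    rw [← range_comp]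
    exact congrArg range (funext hfβ)
  have := hlip.hausdorffMeasure_image_le (d := Module.finrank ℝ E) (Nat.cast_nonneg _)
  rw [himg, hF0, mul_zero] at this
  exact le_antisymm this zero_le

section Glue

variable {ι F X : Type*} [MeasurableSpace F] {μ : Measure F} [MeasurableSpace X]
  {κ : ι → F → X} {S : ι → Set F} {d : ι → F → ℝ≥0∞}

lemma map_withDensity_null (hS : ∀ i, MeasurableSet (S i))
    (hκ : ∀ i, AEMeasurable (κ i) (μ.restrict (S i)))
    (hd : ∀ i, AEMeasurable (d i) (μ.restrict (S i))) (hpos : ∀ i, ∀ z ∈ S i, d i z ≠ 0) {A : Set X}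
    (hA : MeasurableSet A) (i : ι) :
    Measure.map (κ i) ((μ.restrict (S i)).withDensity (d i)) A = 0 ↔ μ (S i ∩ κ i ⁻¹' A) = 0 := by
  rw [Measure.map_apply_of_aemeasurable
    ((hκ i).mono_ac (withDensity_absolutelyContinuous _ _)) hA]
  have h1 : (μ.restrict (S i)).withDensity (d i) (κ i ⁻¹' A) = 0 ↔
      μ.restrict (S i) (κ i ⁻¹' A) = 0 :=
    ⟨fun h ↦ withDensity_absolutelyContinuous' (hd i)
      ((ae_restrict_iff' (hS i)).2 (Eventually.of_forall (hpos i))) h,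
      fun h ↦ withDensity_absolutelyContinuous _ _ h⟩
  rw [h1, Measure.restrict_apply' (hS i), inter_comm]

/-- Null sets of a measure that is glued from measures in charts. -/
lemma iSup_map_withDensity_null (hS : ∀ i, MeasurableSet (S i))
    (hκ : ∀ i, AEMeasurable (κ i) (μ.restrict (S i)))
    (hd : ∀ i, AEMeasurable (d i) (μ.restrict (S i))) (hpos : ∀ i, ∀ z ∈ S i, d i z ≠ 0) {A : Set X}
    (hA : MeasurableSet A) :
    (⨆ i, Measure.map (κ i) ((μ.restrict (S i)).withDensity (d i))) A = 0 ↔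
      ∀ i, μ (S i ∩ κ i ⁻¹' A) = 0 := by
  simp only [← map_withDensity_null hS hκ hd hpos hA]
  constructor
  · intro h i
    exact le_antisymm ((le_iSup (fun i ↦ Measure.map (κ i) ((μ.restrict (S i)).withDensity (d i)))
      i A).trans_eq h) zero_le
  · intro h
    -- There may be uncountably many charts. The supremum is dominated by the sum, which vanishes on
    -- a measurable set when every term does.
    refine le_antisymm ((iSup_le (fun i ↦ Measure.le_sum _ i) : (⨆ i, Measure.map (κ i)
      ((μ.restrict (S i)).withDensity (d i))) ≤ Measure.sum _) A |>.trans ?_) zero_le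
    rw [Measure.sum_apply _ hA]
    simp [h]

/-- On `I` the supremum over all charts is absolutely continuous with respect to the sum over the
finitely many charts in `t`. The s-finiteness gained in this way is what Fubini's theorem requires.
-/
lemma sFinite_iSup_map_withDensity [SFinite μ] (hS : ∀ i, MeasurableSet (S i))
    (hκ : ∀ i, AEMeasurable (κ i) (μ.restrict (S i)))
    (hd : ∀ i, AEMeasurable (d i) (μ.restrict (S i))) (hpos : ∀ i, ∀ z ∈ S i, d i z ≠ 0)
    {I : Set X} (hI : MeasurableSet I) (t : Finset ι) (ht : ∀ A ⊆ I, MeasurableSet A →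
      (∀ i ∈ t, μ (S i ∩ κ i ⁻¹' A) = 0) → ∀ i, μ (S i ∩ κ i ⁻¹' A) = 0) :
    SFinite ((⨆ i, Measure.map (κ i) ((μ.restrict (S i)).withDensity (d i))).restrict I) := by
  have : ∀ i, SFinite (Measure.map (κ i) ((μ.restrict (S i)).withDensity (d i))) :=
    fun i ↦ inferInstance
  refine sFinite_of_absolutelyContinuous
    (ν := Measure.sum fun i : t ↦ Measure.map (κ i) ((μ.restrict (S i)).withDensity (d i))) ?_
  refine Measure.AbsolutelyContinuous.mk fun A hA h ↦ ?_
  rw [Measure.sum_apply _ hA, ENNReal.tsum_eq_zero] at h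
  rw [Measure.restrict_apply hA, iSup_map_withDensity_null hS hκ hd hpos (hA.inter hI)]
  refine ht _ inter_subset_right (hA.inter hI) fun i hi ↦ ?_
  have := (map_withDensity_null hS hκ hd hpos hA i).1 (h ⟨i, hi⟩)
  exact measure_mono_null (inter_subset_inter_right _ (preimage_mono inter_subset_left)) this

end Glue

/-! ### Null sets of the tangent bundle and of the sphere bundle -/

section Charts

variable {n : ℕ} {M : Type*} [TopologicalSpace M] [ChartedSpace (EuclideanHalfSpace (n + 1)) M]
  [IsManifold (𝓡∂ (n + 1)) ∞ M]

/-- The image in the chart at `x₀` of a set of tangent vectors. -/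
def coordSet (x₀ : M) (A : Set (TBundle n M)) : Set (Coord n × Coord n) :=
  coordMap x₀ '' (A ∩ coordSource n x₀)

lemma coordTarget_inter_preimage (x₀ : M) (A : Set (TBundle n M)) :
    coordTarget n x₀ ∩ ofCoord x₀ ⁻¹' A = coordSet x₀ A := by
  ext z
  constructor
  · rintro ⟨hz, hA⟩
    exact ⟨ofCoord x₀ z, ⟨hA, ofCoord_mem hz⟩, coordMap_ofCoord hz⟩
  · rintro ⟨p, ⟨hA, hp⟩, rfl⟩
    exact ⟨coordMap_mem hp, by rw [mem_preimage, ofCoord_coordMap hp]; exact hA⟩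

/-- Sets of tangent vectors that are null in every chart. -/
def NullT (A : Set (TBundle n M)) : Prop :=
  ∀ x₀ : M, (volume : Measure (Coord n × Coord n)) (coordSet x₀ A) = 0

lemma NullT.mono {A B : Set (TBundle n M)} (h : NullT B) (hAB : A ⊆ B) : NullT A := fun x₀ ↦
  measure_mono_null (image_mono (inter_subset_inter_left _ hAB)) (h x₀)

lemma NullT.iUnion {ι : Type*} [Countable ι] {A : ι → Set (TBundle n M)} (h : ∀ i, NullT (A i)) :
    NullT (⋃ i, A i) := fun x₀ ↦ by
  rw [coordSet, iUnion_inter, image_iUnion]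
  exact measure_iUnion_null fun i ↦ h i x₀

lemma contDiffWithinAt_tangentTransition {x x₀ : M} {z : Coord n × Coord n}
    (hz : z ∈ coordTarget n x) (hz' : (ofCoord x z : TBundle n M) ∈ coordSource n x₀) :
    ContDiffWithinAt ℝ ∞ (fun z ↦ coordMap x₀ (ofCoord x z : TBundle n M))
      (range (𝓡∂ (n + 1)) ×ˢ univ) z := by
  have h := contDiffWithinAt_ext_coord_change (I := (𝓡∂ (n + 1)).tangent) (n := ∞)
    (⟨x₀, 0⟩ : TBundle n M) ⟨x, 0⟩ (y := z) (by
      rw [PartialEquiv.trans_source]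
      refine ⟨?_, ?_⟩
      · rw [PartialEquiv.symm_source, ← coordTarget_eq]; exact hz
      · rw [mem_preimage, ← coordSource_eq, ← ofCoord_eq]; exact hz')
  have hr : range (𝓡∂ (n + 1)).tangent = range (𝓡∂ (n + 1)) ×ˢ univ := by
    rw [ModelWithCorners.range_prod]; simp
  rw [← ofCoord_eq, hr] at h
  exact h

/-- For sets of vectors over the interior, being null does not depend on the chart. -/
lemma nullT_of_subset_coordSource {A : Set (TBundle n M)} {x : M}
    (hint : ∀ p ∈ A, p.1 ∈ (𝓡∂ (n + 1)).interior M) (hx : A ⊆ coordSource n x)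
    (h : (volume : Measure (Coord n × Coord n)) (coordMap x '' A) = 0) : NullT A := by
  intro x₀
  have heq : coordSet x₀ A = (fun z ↦ coordMap x₀ (ofCoord x z : TBundle n M)) ''
      (coordMap x '' (A ∩ coordSource n x₀)) := by
    rw [image_image]
    refine image_congr fun p hp ↦ ?_
    rw [ofCoord_coordMap (hx hp.1)]
  have : (volume : Measure (Coord n × Coord n)).IsAddHaarMeasure :=
    Measure.prod.instIsAddHaarMeasure volume volume
  rw [heq]
  refine addHaar_image_eq_zero_of_differentiableOn_of_addHaar_eq_zero _ ?_
    (measure_mono_null (image_mono inter_subset_left) h)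
  rintro _ ⟨p, hp, rfl⟩
  have hpx := hx hp.1
  have h1 := contDiffWithinAt_tangentTransition (x₀ := x₀) (coordMap_mem hpx)
    (by rw [ofCoord_coordMap hpx]; exact hp.2)
  have h2 : range (𝓡∂ (n + 1)) ×ˢ univ ∈ 𝓝 (coordMap x p) :=
    prod_mem_nhds (range_mem_nhds ((mem_interior_iff hpx).1 (hint p hp.1))) univ_mem
  exact ((h1.contDiffAt h2).differentiableAt (by simp)).differentiableWithinAt

/-- Null sets in finitely many charts that cover are null. -/
lemma nullT_of_charts {A : Set (TBundle n M)} {t : Finset M}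
    (ht : ∀ x : M, ∃ x₀ ∈ t, x ∈ (extChartAt (𝓡∂ (n + 1)) x₀).source)
    (hint : ∀ p ∈ A, p.1 ∈ (𝓡∂ (n + 1)).interior M)
    (h : ∀ x ∈ t, (volume : Measure (Coord n × Coord n)) (coordSet x A) = 0) : NullT A := by
  refine (NullT.iUnion (ι := t) (A := fun x ↦ A ∩ coordSource n (x : M)) fun x ↦ ?_).mono
    fun p hp ↦ ?_
  · exact nullT_of_subset_coordSource (x := x) (fun p hp ↦ hint p hp.1) inter_subset_right
      (h x x.2)
  · obtain ⟨x, hx, hpx⟩ := ht p.1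
    exact mem_iUnion.2 ⟨⟨x, hx⟩, hp, hpx⟩

lemma continuousOn_metricMatrix_det (g : RMetric n M) (x₀ : M) :
    ContinuousOn (fun y ↦ (metricMatrix g x₀ y).det) (extChartAt (𝓡∂ (n + 1)) x₀).target :=
  (contDiffOn_matrix_det fun i j ↦ contDiffOn_metricMatrix g x₀ i j).continuousOn

lemma aemeasurable_ofCoord (x₀ : M) : AEMeasurable (ofCoord x₀ : _ → TBundle n M)
    ((volume : Measure (Coord n × Coord n)).restrict (coordTarget n x₀)) :=
  (continuousOn_ofCoord x₀).aemeasurable (measurableSet_coordTarget x₀)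

lemma aemeasurable_density (g : RMetric n M) (x₀ : M) :
    AEMeasurable (fun z : Coord n × Coord n ↦ ENNReal.ofReal (metricMatrix g x₀ z.1).det)
      ((volume : Measure (Coord n × Coord n)).restrict (coordTarget n x₀)) :=
  (((continuousOn_metricMatrix_det g x₀).comp continuousOn_fst fun _ hz ↦ hz.1).aemeasurable
    (measurableSet_coordTarget x₀)).ennreal_ofReal

lemma density_ne_zero (g : RMetric n M) (x₀ : M) :
    ∀ z ∈ coordTarget n x₀, ENNReal.ofReal (metricMatrix g x₀ z.1).det ≠ 0 := fun z hz ↦ by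
  simpa using (posDef_metricMatrix g hz.1).det_pos

lemma tangentVolume_null_iff (g : RMetric n M) {A : Set (TBundle n M)} (hA : MeasurableSet A) :
    tangentVolume g A = 0 ↔ NullT A := by
  refine (iSup_map_withDensity_null (fun x₀ : M ↦ measurableSet_coordTarget x₀)
    aemeasurable_ofCoord (aemeasurable_density g) (density_ne_zero g) hA).trans ?_
  simp only [coordTarget_inter_preimage]
  rfl

lemma continuousOn_normalize (g : RMetric n M) :
    ContinuousOn (normalize g) {p : TBundle n M | 0 < sqNorm g p} := by
  have h1 : ContinuousOn (fun p : TBundle n M ↦ ((Real.sqrt (sqNorm g p))⁻¹, p))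
      {p : TBundle n M | 0 < sqNorm g p} :=
    ContinuousOn.prodMk (((Real.continuous_sqrt.comp (continuous_sqNorm g)).continuousOn).inv₀
      fun p hp ↦ (Real.sqrt_pos.2 hp).ne') continuousOn_id
  exact continuous_scale_prod.comp_continuousOn h1

/-- The vectors over the interior in the punctured unit ball bundle. -/
def interiorBall (g : RMetric n M) : Set (TBundle n M) :=
  {p | p.1 ∈ (𝓡∂ (n + 1)).interior M ∧ p ∈ puncturedBall g}

lemma isOpen_puncturedBall (g : RMetric n M) : IsOpen (puncturedBall g) :=
  (isOpen_lt continuous_const (continuous_sqNorm g)).inter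
    (isOpen_lt (continuous_sqNorm g) continuous_const)

lemma measurableSet_interiorBall (g : RMetric n M) : MeasurableSet (interiorBall g) :=
  (isOpen_interiorBundle.inter (isOpen_puncturedBall g)).measurableSet

/-- The cone over a set of unit vectors. -/
def cone (g : RMetric n M) (A : Set (TBundle n M)) : Set (TBundle n M) :=
  interiorBall g ∩ normalize g ⁻¹' A

/-- Null sets of unit vectors. -/
def NullS (g : RMetric n M) (A : Set (TBundle n M)) : Prop := NullT (cone g A)

lemma NullS.mono {g : RMetric n M} {A B : Set (TBundle n M)} (h : NullS g B) (hAB : A ⊆ B) :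
    NullS g A := NullT.mono h (inter_subset_inter_right _ (preimage_mono hAB))

lemma NullS.iUnion {g : RMetric n M} {ι : Type*} [Countable ι] {A : ι → Set (TBundle n M)}
    (h : ∀ i, NullS g (A i)) : NullS g (⋃ i, A i) := by
  rw [NullS, cone, preimage_iUnion, inter_iUnion]
  exact NullT.iUnion h

lemma measurableSet_inter_preimage {X Y : Type*} [TopologicalSpace X] [MeasurableSpace X]
    [BorelSpace X] [TopologicalSpace Y] [MeasurableSpace Y] [BorelSpace Y] {f : X → Y}
    {s : Set X} (hf : ContinuousOn f s) (hs : MeasurableSet s) {A : Set Y} (hA : MeasurableSet A) :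
    MeasurableSet (s ∩ f ⁻¹' A) := by
  have h2 : Measurable (s.domRestrict f) :=
    (continuousOn_iff_continuous_domRestrict.1 hf).measurable
  have h3 := (MeasurableEmbedding.subtype_coe hs).measurableSet_image.2 (h2 hA)
  convert h3 using 1
  ext p
  simp only [mem_inter_iff, mem_preimage, mem_image, Subtype.exists, exists_and_right,
    exists_eq_right]
  exact ⟨fun h ↦ ⟨h.1, h.2⟩, fun ⟨h1, h2⟩ ↦ ⟨h1, h2⟩⟩

lemma measurableSet_cone (g : RMetric n M) {A : Set (TBundle n M)} (hA : MeasurableSet A) :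
    MeasurableSet (cone g A) :=
  measurableSet_inter_preimage ((continuousOn_normalize g).mono (t := interiorBall g)
    fun _ hp ↦ hp.2.1) (measurableSet_interiorBall g) hA

/-- The volume of `A` is a positive multiple of the volume of the cone over `A`, and the densities
in the charts are positive. Null sets of unit vectors become Lebesgue null sets of cones. -/
lemma sphereVolume_null_iff (g : RMetric n M) {A : Set (TBundle n M)} (hA : MeasurableSet A) :
    sphereVolume g A = 0 ↔ NullS g A := by
  have hmeas : AEMeasurable (normalize g) (((n + 1 : ℕ) : ℝ≥0∞) •
      (tangentVolume g).restrict (interiorBall g)) :=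
    (((continuousOn_normalize g).mono
      (fun p hp ↦ hp.2.1 : interiorBall g ⊆ {p | 0 < sqNorm g p})).aemeasurable
      (measurableSet_interiorBall g)).smul_measure _
  have h1 : sphereVolume g A = ((n + 1 : ℕ) : ℝ≥0∞) * tangentVolume g (cone g A) := by
    change Measure.map (normalize g) (((n + 1 : ℕ) : ℝ≥0∞) •
      (tangentVolume g).restrict (interiorBall g)) A = _
    rw [Measure.map_apply_of_aemeasurable hmeas hA, Measure.smul_apply, smul_eq_mul,
      Measure.restrict_apply' (measurableSet_interiorBall g), inter_comm]
    rfl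
  rw [h1, NullS, ← tangentVolume_null_iff g (measurableSet_cone g hA)]
  simp

lemma NullS.of_sphereVolume {g : RMetric n M} {A : Set (TBundle n M)} (hA : sphereVolume g A = 0) :
    NullS g A :=
  ((sphereVolume_null_iff g (measurableSet_toMeasurable _ _)).1
    ((measure_toMeasurable A).trans hA)).mono (subset_toMeasurable _ _)

lemma sphereVolume_compl (g : RMetric n M) : ∀ᵐ p ∂sphereVolume g, p ∈ sphereBundle g := by
  rw [ae_iff]
  change sphereVolume g (sphereBundle g)ᶜ = 0
  rw [sphereVolume_null_iff g (measurableSet_sphereBundle g).compl]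
  have : cone g (sphereBundle g)ᶜ = ∅ := by
    rw [eq_empty_iff_forall_notMem]
    intro p hp
    exact hp.2 ⟨hp.1.1, sqNorm_normalize g hp.1.2.1⟩
  rw [NullS, this]
  intro x₀
  simp [coordSet]

instance [CompactSpace M] (g : RMetric n M) : SFinite (sphereVolume g) := by
  obtain ⟨t, ht⟩ := exists_finite_charts (n := n) (M := M)
  have : SFinite ((tangentVolume g).restrict (interiorBall g)) := by
    refine sFinite_iSup_map_withDensity (fun x₀ : M ↦ measurableSet_coordTarget x₀)
      aemeasurable_ofCoord (aemeasurable_density g) (density_ne_zero g)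
      (measurableSet_interiorBall g) t fun A hA _ h ↦ ?_
    have h2 : NullT A := nullT_of_charts ht (fun p hp ↦ (hA hp).1) fun x hx ↦ by
      rw [← coordTarget_inter_preimage]
      exact h x hx
    intro x
    have := h2 x
    rw [← coordTarget_inter_preimage] at this
    exact this
  exact inferInstanceAs (SFinite (Measure.map (normalize g) (((n + 1 : ℕ) : ℝ≥0∞) •
    (tangentVolume g).restrict (interiorBall g))))

end Charts

end

end Transport

namespace Transport

noncomputable section

open scoped NNReal

section Charts

variable {n : ℕ} {M : Type*} [TopologicalSpace M] [ChartedSpace (EuclideanHalfSpace (n + 1)) M]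
  [IsManifold (𝓡∂ (n + 1)) ∞ M]

/-! ### The geodesic flow preserves null sets -/

instance : (volume : Measure (Coord n × Coord n)).IsAddHaarMeasure :=
  Measure.prod.instIsAddHaarMeasure volume volume

lemma dist_smul_snd_le {E F : Type*} [NormedAddCommGroup F] [PseudoMetricSpace E]
    [NormedSpace ℝ F] {l : ℝ} (h0 : 0 ≤ l) (h1 : l ≤ 1) (z z' : E × F) :
    dist (z.1, l • z.2) (z'.1, l • z'.2) ≤ dist z z' := by
  rw [Prod.dist_eq, Prod.dist_eq]
  refine max_le_max le_rfl ?_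
  rw [dist_smul₀, Real.norm_of_nonneg h0]
  exact mul_le_of_le_one_left dist_nonneg h1

/-- A set of unit vectors is null if a part of the cone over it is parametrized by a null set. -/
lemma nullS_of_dist_le {g : RMetric n M} {x₀ : M} {A : Set (TBundle n M)}
    (hAx : A ⊆ coordSource n x₀) {F : Type*} [NormedAddCommGroup F] [NormedSpace ℝ F]
    [FiniteDimensional ℝ F] [MeasurableSpace F] [BorelSpace F] (ν : Measure F)
    [ν.IsAddHaarMeasure] (hdim : Module.finrank ℝ (Coord n × Coord n) = Module.finrank ℝ F)
    {a : ℝ} (ha0 : 0 < a) (ha1 : a < 1) {β : ℝ → TBundle n M → F} {K : ℝ≥0}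
    (h : ∀ ρ ∈ Ioo a 1, ∀ ρ' ∈ Ioo a 1, ∀ p ∈ A, ∀ p' ∈ A,
      dist (coordMap x₀ (scale ρ p)) (coordMap x₀ (scale ρ' p')) ≤ K * dist (β ρ p) (β ρ' p'))
    {B : Set F} (hβ : ∀ ρ ∈ Ioo a 1, ∀ p ∈ A, β ρ p ∈ B) (hB : ν B = 0) : NullS g A := by
  set ι := {i : ℝ × TBundle n M // i.1 ∈ Ioo a 1 ∧ i.2 ∈ A}
  -- The hypothesis concerns only radii in `(a, 1)`. Other radii are reached by the countably many
  -- rational dilations of the fibres with `l ≤ 1`, which do not increase distances.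
  have hsc : ∀ l : {l : ℚ // (0 : ℝ) < l ∧ (l : ℝ) ≤ 1}, (volume : Measure (Coord n × Coord n))
      (range fun i : ι ↦ coordMap x₀ (scale (l : ℚ) (scale i.1.1 i.1.2))) = 0 := by
    intro l
    refine measure_range_eq_zero_of_dist_le volume ν hdim (β := fun i : ι ↦ β i.1.1 i.1.2) (K := K)
      (fun i j ↦ ?_) (measure_mono_null ?_ hB)
    · rw [coordMap_scale x₀ (l : ℚ), coordMap_scale x₀ (l : ℚ)]
      exact (dist_smul_snd_le l.2.1.le l.2.2 _ _).trans (h _ i.2.1 _ j.2.1 _ i.2.2 _ j.2.2)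
    · rintro _ ⟨i, rfl⟩
      exact hβ _ i.2.1 _ i.2.2
  refine nullT_of_subset_coordSource (x := x₀) (fun p hp ↦ hp.1.1) (fun p hp ↦
    show normalize g p ∈ coordSource n x₀ from hAx hp.2) (measure_mono_null ?_ (measure_iUnion_null hsc))
  rintro _ ⟨q, hq, rfl⟩
  set r := Real.sqrt (sqNorm g q) with hr
  have hpos : 0 < sqNorm g q := hq.1.2.1
  have hr0 : 0 < r := Real.sqrt_pos.2 hpos
  have hr1 : r < 1 := by
    rw [hr, Real.sqrt_lt' one_pos, one_pow]
    exact hq.1.2.2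
  -- From `r < l < min 1 (r / a)` follows `a < r / l < 1`.
  obtain ⟨l, hl1, hl2⟩ := exists_rat_btwn (lt_min hr1 ((lt_div_iff₀ ha0).2
    (by nlinarith : r * a < r)))
  have hl0 : (0 : ℝ) < l := hr0.trans hl1
  have hla : a < r / l := by
    have := hl2.trans_le (min_le_right _ _)
    rw [lt_div_iff₀ ha0] at this
    rw [lt_div_iff₀ hl0]
    linarith
  refine mem_iUnion.2 ⟨⟨l, hl0, hl2.le.trans (min_le_left _ _)⟩,
    ⟨⟨(r / l, normalize g q), ⟨hla, (div_lt_one hl0).2 hl1⟩, hq.2⟩, ?_⟩⟩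
  simp only
  rw [scale_scale, mul_div_cancel₀ _ hl0.ne', scale_normalize g hpos]

/-- Boxes that contain dilations of unit vectors. -/
lemma exists_isBox_scale (g : RMetric n M) {p₀ : TBundle n M} (h0 : p₀.2 ≠ 0) :
    ∃ U, IsOpen U ∧ p₀ ∈ U ∧ ∃ L C, IsBox g p₀.1 U L C ∧ ∃ U', IsOpen U' ∧ p₀ ∈ U' ∧ U' ⊆ U ∧
      ∃ a, 0 < a ∧ a < 1 ∧ ∀ ρ ∈ Ioo a 1, ∀ p ∈ U', scale ρ p ∈ U := by
  obtain ⟨U, hU, hpU, L, C, hbox⟩ := exists_isBox g h0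
  refine ⟨U, hU, hpU, L, C, hbox, ?_⟩
  have h1 : (fun q : ℝ × TBundle n M ↦ scale q.1 q.2) ⁻¹' U ∈ 𝓝 ((1 : ℝ), p₀) :=
    continuous_scale_prod.continuousAt.preimage_mem_nhds
      (hU.mem_nhds (by rw [scale_one]; exact hpU))
  rw [nhds_prod_eq, mem_prod_iff] at h1
  obtain ⟨t, ht, V, hV, hsub⟩ := h1
  obtain ⟨δ, hδ, hball⟩ := Metric.mem_nhds_iff.1 ht
  obtain ⟨V', hV', hV'o, hpV'⟩ := mem_nhds_iff.1 hV
  refine ⟨V' ∩ U, hV'o.inter hU, ⟨hpV', hpU⟩, inter_subset_right, max (1 / 2) (1 - δ),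
    by positivity, max_lt (by norm_num) (by linarith), fun ρ hρ p hp ↦ ?_⟩
  refine hsub (show (ρ, p) ∈ t ×ˢ V from ⟨hball ?_, hV' hp.1⟩)
  rw [Metric.mem_ball, Real.dist_eq, abs_of_nonpos (by linarith [hρ.2])]
  linarith [(le_max_right (1 / 2) (1 - δ)).trans_lt hρ.1]

section Flow

variable [T2Space M] {g : RMetric n M} (hg : NonTrapping g)
include hg

/-- Within a box, Grönwall's inequality bounds distances of dilated starting points by distances of
the equally dilated points at time `s`. The cone over the starting points is therefore covered by
Lipschitz images of the null cone over `Z`. -/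
lemma exists_nullS_flow {p₀ : TBundle n M} (hp₀ : p₀ ∈ sphereBundle g) :
    ∃ ε > 0, ∃ V, IsOpen V ∧ p₀ ∈ V ∧ ∀ s, |s| ≤ ε → ∀ Z, NullS g Z →
      NullS g {p | p ∈ V ∩ sphereBundle g ∧ flow g s p ∈ Z} := by
  have hne : p₀.2 ≠ 0 := ne_zero_of_sqNorm g (by rw [show sqNorm g p₀ = 1 from hp₀.2]; norm_num)
  obtain ⟨U, hU, hpU, L, C, hbox, U', hU', hpU', hUU', a, ha0, ha1, hsc⟩ := exists_isBox_scale g hne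
  obtain ⟨ε, hε, V, hV, hpV, hVU, h⟩ := exists_flow_mem hg hp₀ hU' hpU'
  refine ⟨ε, hε, V, hV, hpV, fun s hs Z hZ ↦ ?_⟩
  refine nullS_of_dist_le (x₀ := p₀.1) (fun p hp ↦ hbox.source (hUU' (hVU hp.1.1))) volume rfl
    ha0 ha1 (β := fun ρ p ↦ coordMap p₀.1 (scale ρ (flow g s p)))
    (K := ⟨Real.exp (L * ε), (Real.exp_pos _).le⟩) ?_ (B := coordSet p₀.1 (cone g Z)) ?_ (hZ p₀.1)
  · intro ρ hρ ρ' hρ' p hp p' hp'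
    have hρ0 : 0 < ρ := ha0.trans hρ.1
    have hρ0' : 0 < ρ' := ha0.trans hρ'.1
    rcases le_total 0 s with h0 | h0
    · rw [abs_of_nonneg h0] at hs
      have key : ∀ ρ ∈ Ioo a 1, ∀ q ∈ V ∩ sphereBundle g, IsTrajectory (unitField g p₀.1)
          (coordMap p₀.1 '' U) (fun r ↦ coordMap p₀.1 (scale ρ (flow g r q))) 0 s :=
        fun ρ hρ q hq ↦ ((isArc_flow hg hq.2).mono (by linarith [entryTime_pos hg hq.2])
          (by linarith [(h q hq).1])).isTrajectory_of_isBox hbox (ha0.trans hρ.1) fun r hr ↦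
            hsc ρ hρ _ ((h q hq).2.2 r (by rw [abs_of_nonneg hr.1]; linarith [hr.2]))
      have := IsTrajectory.dist_le' hbox.lipschitz h0 (key ρ hρ p hp.1) (key ρ' hρ' p' hp'.1)
      simp only [flow_zero hg hp.1.2, flow_zero hg hp'.1.2, sub_zero] at this
      refine this.trans ?_
      change _ ≤ Real.exp (L * ε) * _
      gcongr
    · rw [abs_of_nonpos h0] at hs
      have key : ∀ ρ ∈ Ioo a 1, ∀ q ∈ V ∩ sphereBundle g, IsTrajectory (unitField g p₀.1)
          (coordMap p₀.1 '' U) (fun r ↦ coordMap p₀.1 (scale ρ (flow g r q))) s 0 :=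
        fun ρ hρ q hq ↦ ((isArc_flow hg hq.2).mono (by linarith [(h q hq).2.1])
          (by linarith [exitTime_pos hg hq.2])).isTrajectory_of_isBox hbox (ha0.trans hρ.1)
            fun r hr ↦
            hsc ρ hρ _ ((h q hq).2.2 r (by rw [abs_of_nonpos hr.2]; linarith [hr.1]))
      have := IsTrajectory.dist_le hbox.lipschitz h0 (key ρ hρ p hp.1) (key ρ' hρ' p' hp'.1)
      simp only [flow_zero hg hp.1.2, flow_zero hg hp'.1.2, zero_sub] at this
      refine this.trans ?_
      change _ ≤ Real.exp (L * ε) * _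
      gcongr
  · intro ρ hρ p hp
    have hρ0 : 0 < ρ := ha0.trans hρ.1
    have hs' := abs_le.1 hs
    have hh := h p hp.1
    have hm := flow_mem hg hp.1.2 (s := s) ⟨by linarith, by linarith⟩
    have hsq : sqNorm g (scale ρ (flow g s p)) = ρ ^ 2 := by
      rw [sqNorm_scale, show sqNorm g (flow g s p) = 1 from hm.2, mul_one]
    have hsrc : scale ρ (flow g s p) ∈ coordSource n p₀.1 :=
      hbox.source (hsc ρ hρ _ (hh.2.2 s hs))
    refine ⟨scale ρ (flow g s p), ⟨⟨⟨hm.1, ?_⟩, ?_⟩, hsrc⟩, rfl⟩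
    · change 0 < sqNorm g (scale ρ (flow g s p)) ∧ sqNorm g (scale ρ (flow g s p)) < 1
      rw [hsq]
      exact ⟨by positivity, by nlinarith [hρ.2]⟩
    · rw [mem_preimage, normalize_scale g hm.2 hρ0]
      exact hp.2

/-- The geodesic flow preserves null sets. -/
lemma nullS_flow [CompactSpace M] {Z : Set (TBundle n M)} (hZ : NullS g Z) (s : ℝ) :
    NullS g {p | (s, p) ∈ flowDomain g ∧ flow g s p ∈ Z} := by
  have hloc : ∀ p₀ : TBundle n M, p₀ ∈ sphereBundle g → ∃ ε > 0, ∃ V, IsOpen V ∧ p₀ ∈ V ∧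
      ∀ s, |s| ≤ ε → ∀ Z, NullS g Z → NullS g {p | p ∈ V ∩ sphereBundle g ∧ flow g s p ∈ Z} :=
    fun p₀ hp₀ ↦ exists_nullS_flow hg hp₀
  choose! ε hε V hV hpV hnull using hloc
  set J : ℝ → Set (TBundle n M) := fun r ↦ {p₀ | p₀ ∈ sphereBundle g ∧ |r| ≤ ε p₀} with hJ
  -- One step of the flow, backwards from `Z`, near points at which the duration `r` is short
  -- enough. By the Lindelöf property it preserves null sets.
  set step : ℝ → Set (TBundle n M) → Set (TBundle n M) := fun r Z ↦
    {p | p ∈ (⋃ p₀ ∈ J r, V p₀) ∩ sphereBundle g ∧ flow g r p ∈ Z} with hstep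
  have hstepnull : ∀ r Z, NullS g Z → NullS g (step r Z) := by
    intro r Z hZ
    obtain ⟨t, htJ, htc, ht⟩ := TopologicalSpace.isOpen_biUnion_countable (J r) V
      fun p₀ hp₀ ↦ hV p₀ hp₀.1
    have := htc.to_subtype
    refine (NullS.iUnion (ι := t) fun p₀ ↦ hnull p₀ (htJ p₀.2).1 r (htJ p₀.2).2 Z hZ).mono ?_
    rintro p ⟨⟨hp, hps⟩, hpZ⟩
    rw [← ht] at hp
    obtain ⟨p₀, hp₀, hpp⟩ := mem_iUnion₂.1 hp
    exact mem_iUnion.2 ⟨⟨p₀, hp₀⟩, ⟨hpp, hps⟩, hpZ⟩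
  have hiter : ∀ r (N : ℕ), NullS g ((step r)^[N] Z) := by
    intro r N
    induction N with
    | zero => exact hZ
    | succ N ih =>
      rw [Function.iterate_succ_apply']
      exact hstepnull r _ ih
  -- The segment of an orbit between the times `0` and `s` is compact, so it can be divided into `N`
  -- admissible steps of length `s / N`. As `N` depends on the orbit, the union over all `N` is
  -- taken.
  refine (NullS.iUnion fun N : ℕ ↦ hiter (s / N) N).mono ?_
  rintro p ⟨⟨hp, hs⟩, hpZ⟩
  change s ∈ Ioo (-entryTime g p) (exitTime g p) at hs
  have h0 := (isMaxGeodesic_flow hg hp).mem_Ioo hp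
  have hsub : uIcc 0 s ⊆ Ioo (-entryTime g p) (exitTime g p) := ordConnected_Ioo.uIcc_subset h0 hs
  have hK : IsCompact ((fun r ↦ flow g r p) '' uIcc 0 s) :=
    isCompact_uIcc.image_of_continuousOn
      ((isArc_flow hg hp).cont.mono (hsub.trans Ioo_subset_Icc_self))
  have hKs : ∀ q ∈ (fun r ↦ flow g r p) '' uIcc 0 s, q ∈ sphereBundle g := by
    rintro _ ⟨r, hr, rfl⟩
    exact flow_mem hg hp (hsub hr)
  obtain ⟨t, htK, ht⟩ := hK.elim_nhds_subcover V fun q hq ↦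
    (hV q (hKs q hq)).mem_nhds (hpV q (hKs q hq))
  obtain ⟨δ, hδ, hδt⟩ : ∃ δ > 0, ∀ q ∈ t, δ ≤ ε q := by
    rcases t.eq_empty_or_nonempty with rfl | hne
    · exact ⟨1, one_pos, by simp⟩
    · obtain ⟨q, hq, hmin⟩ := t.exists_min_image ε hne
      exact ⟨ε q, hε q (hKs q (htK q hq)), hmin⟩
  obtain ⟨N, hN⟩ := exists_nat_gt (|s| / δ)
  have hN0 : (0 : ℝ) < N := (by positivity : 0 ≤ |s| / δ).trans_lt hN
  have hstepsize : |s / N| ≤ δ := by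
    rw [abs_div, abs_of_pos hN0, div_le_iff₀ hN0]
    rw [div_lt_iff₀ hδ] at hN
    linarith
  refine mem_iUnion.2 ⟨N, ?_⟩
  -- Induction from the end of the segment towards its start.
  have key : ∀ k : ℕ, k ≤ N → flow g (s * ((N - k : ℝ) / N)) p ∈ (step (s / N))^[k] Z := by
    intro k
    induction k with
    | zero =>
      intro _
      rw [Nat.cast_zero, sub_zero, div_self hN0.ne', mul_one]
      exact hpZ
    | succ k ih =>
      intro hk
      have hk' : (k : ℝ) + 1 ≤ N := by exact_mod_cast hk
      rw [Function.iterate_succ_apply']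
      have hmem : ∀ j : ℝ, 0 ≤ j → j ≤ N → s * ((N - j) / N) ∈ uIcc 0 s := by
        intro j hj hj'
        have h1 : 0 ≤ (N - j) / N := div_nonneg (by linarith) hN0.le
        have h2 : (N - j) / N ≤ 1 := (div_le_one hN0).2 (by linarith)
        rcases le_total 0 s with hs0 | hs0
        · rw [uIcc_of_le hs0]
          exact ⟨by positivity, by nlinarith⟩
        · rw [uIcc_of_ge hs0]
          exact ⟨by nlinarith, by nlinarith⟩
      have hm1 := hmem ((k + 1 : ℕ) : ℝ) (by positivity) (by push_cast; exact hk')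
      have hm2 := hmem (k : ℝ) (by positivity) (by linarith)
      have hq := hKs _ ⟨_, hm1, rfl⟩
      obtain ⟨q, hqt, hqV⟩ := mem_iUnion₂.1 (ht ⟨_, hm1, rfl⟩)
      refine ⟨⟨mem_iUnion₂.2 ⟨q, ⟨hKs q (htK q hqt), hstepsize.trans (hδt q hqt)⟩, hqV⟩, hq⟩, ?_⟩
      have h3 := (flow_shift hg hp (hsub hm1)).2.2 _ (Ioo_subset_Icc_self (hsub hm2))
      have h4 : s * ((N - (k : ℝ)) / N) - s * ((N - ((k + 1 : ℕ) : ℝ)) / N) = s / N := by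
        push_cast
        field_simp
        ring
      rw [h4] at h3
      rw [h3]
      exact ih (by omega)
  have := key N le_rfl
  rw [sub_self, zero_div, mul_zero, flow_zero hg hp] at this
  exact this

end Flow

end Charts

end

end Transport

namespace Transport

noncomputable section

open scoped NNReal

section Charts

variable {n : ℕ} {M : Type*} [TopologicalSpace M] [ChartedSpace (EuclideanHalfSpace (n + 1)) M]
  [IsManifold (𝓡∂ (n + 1)) ∞ M]

/-! ### Boundary charts -/

/-- The coordinates along the boundary. -/
def boundaryTail (y : Coord n) : EuclideanSpace ℝ (Fin n) := WithLp.toLp 2 fun i ↦ y i.succ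

lemma contDiff_boundaryTail : ContDiff ℝ ∞ (boundaryTail : Coord n → _) := by
  rw [contDiff_euclidean]
  intro i
  exact contDiff_euclidean.1 contDiff_id i.succ

lemma contDiff_boundaryCoord : ContDiff ℝ ∞ (boundaryCoord : _ → Coord n) := by
  rw [contDiff_euclidean]
  intro i
  refine Fin.cases ?_ (fun j ↦ ?_) i
  · exact contDiff_const
  · exact contDiff_euclidean.1 contDiff_id j

lemma boundaryCoord_zero (y : EuclideanSpace ℝ (Fin n)) : boundaryCoord y 0 = 0 := rfl

lemma boundaryTail_boundaryCoord (y : EuclideanSpace ℝ (Fin n)) :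
    boundaryTail (boundaryCoord y) = y := by
  ext i; rfl

lemma boundaryCoord_boundaryTail {y : Coord n} (hy : y 0 = 0) :
    boundaryCoord (boundaryTail y) = y := by
  ext i
  refine Fin.cases ?_ (fun j ↦ ?_) i
  · exact hy.symm
  · rfl

lemma dist_boundaryTail {y y' : Coord n} (hy : y 0 = 0) (hy' : y' 0 = 0) :
    dist (boundaryTail y) (boundaryTail y') = dist y y' := by
  rw [EuclideanSpace.dist_eq, EuclideanSpace.dist_eq, Fin.sum_univ_succ, hy, hy']
  simp [boundaryTail]

/-- The tangent vector with given coordinates over the boundary. -/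
def boundaryOfCoord (x₀ : M) (z : EuclideanSpace ℝ (Fin n) × Coord n) : TBundle n M :=
  ofCoord x₀ (boundaryCoord z.1, z.2)

/-- The range of the chart at `x₀` of the tangent bundle over the boundary. -/
def boundaryTarget (n : ℕ) {M : Type*} [TopologicalSpace M]
    [ChartedSpace (EuclideanHalfSpace (n + 1)) M] (x₀ : M) :
    Set (EuclideanSpace ℝ (Fin n) × Coord n) :=
  {z | boundaryCoord z.1 ∈ (extChartAt (𝓡∂ (n + 1)) x₀).target}

omit [IsManifold (𝓡∂ (n + 1)) ∞ M] in
lemma measurableSet_boundaryTarget (x₀ : M) : MeasurableSet (boundaryTarget n x₀) :=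
  (measurableSet_target x₀).preimage
    (contDiff_boundaryCoord.continuous.comp continuous_fst).measurable

lemma continuousOn_boundaryOfCoord (x₀ : M) :
    ContinuousOn (boundaryOfCoord x₀ : _ → TBundle n M) (boundaryTarget n x₀) :=
  (continuousOn_ofCoord x₀).comp ((contDiff_boundaryCoord.continuous.comp
    continuous_fst).prodMk continuous_snd).continuousOn fun _ hz ↦ ⟨hz, mem_univ _⟩

/-- The density of the volume of the tangent bundle over the boundary. -/
def boundaryDensity (g : RMetric n M) (x₀ : M) (z : EuclideanSpace ℝ (Fin n) × Coord n) : ℝ≥0∞ :=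
  ENNReal.ofReal (Real.sqrt ((metricMatrix g x₀ (boundaryCoord z.1)).submatrix
    Fin.succ Fin.succ).det * Real.sqrt (metricMatrix g x₀ (boundaryCoord z.1)).det)

lemma aemeasurable_boundaryDensity (g : RMetric n M) (x₀ : M) :
    AEMeasurable (boundaryDensity g x₀)
      ((volume : Measure (EuclideanSpace ℝ (Fin n) × Coord n)).restrict (boundaryTarget n x₀)) := by
  have h1 : ContinuousOn (fun y ↦ ((metricMatrix g x₀ y).submatrix Fin.succ Fin.succ).det)
      (extChartAt (𝓡∂ (n + 1)) x₀).target :=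
    (contDiffOn_matrix_det (A := fun y ↦ (metricMatrix g x₀ y).submatrix Fin.succ Fin.succ)
      fun i j ↦ contDiffOn_metricMatrix g x₀ i.succ j.succ).continuousOn
  have h2 : ContinuousOn (fun y ↦ Real.sqrt ((metricMatrix g x₀ y).submatrix
      Fin.succ Fin.succ).det * Real.sqrt (metricMatrix g x₀ y).det)
      (extChartAt (𝓡∂ (n + 1)) x₀).target :=
    h1.sqrt.mul (continuousOn_metricMatrix_det g x₀).sqrt
  exact ((h2.comp (contDiff_boundaryCoord.continuous.comp continuous_fst).continuousOn
    fun _ hz ↦ hz).aemeasurable (measurableSet_boundaryTarget x₀)).ennreal_ofReal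

lemma boundaryDensity_ne_zero (g : RMetric n M) (x₀ : M) :
    ∀ z ∈ boundaryTarget n x₀, boundaryDensity g x₀ z ≠ 0 := fun z hz ↦ by
  have h := posDef_metricMatrix g (x₀ := x₀) hz
  have h1 := (h.submatrix (Fin.succ_injective n)).det_pos
  have h2 := h.det_pos
  simp only [boundaryDensity, ne_eq, ENNReal.ofReal_eq_zero, not_le]
  positivity

lemma boundaryTangentVolume_null_iff (g : RMetric n M) {A : Set (TBundle n M)}
    (hA : MeasurableSet A) : boundaryTangentVolume g A = 0 ↔
      ∀ x₀ : M, (volume : Measure (EuclideanSpace ℝ (Fin n) × Coord n))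
        (boundaryTarget n x₀ ∩ boundaryOfCoord x₀ ⁻¹' A) = 0 :=
  iSup_map_withDensity_null (fun x₀ : M ↦ measurableSet_boundaryTarget x₀)
    (fun x₀ ↦ (continuousOn_boundaryOfCoord x₀).aemeasurable (measurableSet_boundaryTarget x₀))
    (aemeasurable_boundaryDensity g) (boundaryDensity_ne_zero g) hA

instance : (volume : Measure (EuclideanSpace ℝ (Fin n) × Coord n)).IsAddHaarMeasure :=
  Measure.prod.instIsAddHaarMeasure volume volume

/-- A vector over the boundary in boundary coordinates. -/
lemma boundaryOfCoord_coordMap {x₀ : M} {p : TBundle n M} (hp : p ∈ coordSource n x₀)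
    (h0 : (coordMap x₀ p).1 0 = 0) :
    (boundaryTail (coordMap x₀ p).1, (coordMap x₀ p).2) ∈ boundaryTarget n x₀ ∧
      boundaryOfCoord x₀ (boundaryTail (coordMap x₀ p).1, (coordMap x₀ p).2) = p := by
  have h1 := boundaryCoord_boundaryTail h0
  refine ⟨?_, ?_⟩
  · change boundaryCoord (boundaryTail (coordMap x₀ p).1) ∈ (extChartAt (𝓡∂ (n + 1)) x₀).target
    rw [h1]
    exact (coordMap_mem hp).1
  · change ofCoord x₀ (boundaryCoord (boundaryTail (coordMap x₀ p).1), (coordMap x₀ p).2) = p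
    rw [h1]
    exact ofCoord_coordMap hp

/-- In boundary coordinates the transition maps are differentiable and preserve null sets, and the
charts in `t` cover the boundary. -/
lemma boundary_null_of_charts {A : Set (TBundle n M)} {t : Finset M}
    (ht : ∀ x : M, ∃ x₀ ∈ t, x ∈ (extChartAt (𝓡∂ (n + 1)) x₀).source)
    (h : ∀ x ∈ t, (volume : Measure (EuclideanSpace ℝ (Fin n) × Coord n))
      (boundaryTarget n x ∩ boundaryOfCoord x ⁻¹' A) = 0) (x₀ : M) :
    (volume : Measure (EuclideanSpace ℝ (Fin n) × Coord n))
      (boundaryTarget n x₀ ∩ boundaryOfCoord x₀ ⁻¹' A) = 0 := by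
  set T : M → EuclideanSpace ℝ (Fin n) × Coord n → EuclideanSpace ℝ (Fin n) × Coord n :=
    fun x z ↦ (boundaryTail (coordMap x₀ (boundaryOfCoord x z : TBundle n M)).1,
      (coordMap x₀ (boundaryOfCoord x z : TBundle n M)).2) with hT
  set S : M → Set (EuclideanSpace ℝ (Fin n) × Coord n) := fun x ↦
    (boundaryTarget n x ∩ boundaryOfCoord x ⁻¹' A) ∩ boundaryOfCoord x ⁻¹' coordSource n x₀ with hS
  have hnull : ∀ x : t, (volume : Measure (EuclideanSpace ℝ (Fin n) × Coord n))
      (T x '' S x) = 0 := by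
    intro x
    refine addHaar_image_eq_zero_of_differentiableOn_of_addHaar_eq_zero _ ?_
      (measure_mono_null inter_subset_left (h x x.2))
    intro z hz
    have h1 := contDiffWithinAt_tangentTransition (x := (x : M)) (x₀ := x₀)
      (z := (boundaryCoord z.1, z.2)) ⟨hz.1.1, mem_univ _⟩ hz.2
    have h2 : ContDiff ℝ ∞ (fun z : EuclideanSpace ℝ (Fin n) × Coord n ↦
        (boundaryCoord z.1, z.2)) :=
      (contDiff_boundaryCoord.comp contDiff_fst).prodMk contDiff_snd
    have hmaps : MapsTo (fun z : EuclideanSpace ℝ (Fin n) × Coord n ↦ (boundaryCoord z.1, z.2))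
        univ (range (𝓡∂ (n + 1)) ×ˢ univ) := fun z _ ↦
      ⟨mem_range_iff.2 (boundaryCoord_zero z.1).ge, mem_univ _⟩
    have h3 := h1.comp z (h2.contDiffAt.contDiffWithinAt (s := univ)) hmaps
    have h4 : ContDiff ℝ ∞ (fun z : Coord n × Coord n ↦ (boundaryTail z.1, z.2)) :=
      (contDiff_boundaryTail.comp contDiff_fst).prodMk contDiff_snd
    have h5 := h4.contDiffAt.comp_contDiffWithinAt z h3
    exact (h5.differentiableWithinAt (by simp)).mono (subset_univ _)
  refine measure_mono_null ?_ (measure_iUnion_null hnull)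
  rintro z ⟨hz, hzA⟩
  set p := boundaryOfCoord x₀ z with hp
  have hzt : (boundaryCoord z.1, z.2) ∈ coordTarget n x₀ := ⟨hz, mem_univ _⟩
  have hpx₀ : p ∈ coordSource n x₀ := ofCoord_mem hzt
  have hcoord : coordMap x₀ p = (boundaryCoord z.1, z.2) := coordMap_ofCoord hzt
  have hb : p.1 ∈ (𝓡∂ (n + 1)).boundary M := (mem_boundary_iff hpx₀).2 (by
    change (coordMap x₀ p).1 0 = 0
    rw [hcoord]; rfl)
  obtain ⟨x, hx, hpx⟩ := ht p.1
  obtain ⟨h1, h2⟩ := boundaryOfCoord_coordMap (x₀ := x) hpx (coordMap_fst_zero hpx hb)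
  refine mem_iUnion.2 ⟨⟨x, hx⟩, _, ⟨⟨h1, ?_⟩, ?_⟩, ?_⟩
  · rw [mem_preimage, h2]; exact hzA
  · rw [mem_preimage, h2]; exact hpx₀
  · rw [hT]
    simp only [h2, hcoord, boundaryTail_boundaryCoord]

instance [CompactSpace M] (g : RMetric n M) : SFinite (boundaryVolume g) := by
  obtain ⟨t, ht⟩ := exists_finite_charts (n := n) (M := M)
  have h := sFinite_iSup_map_withDensity (fun x₀ : M ↦ measurableSet_boundaryTarget x₀)
    (fun x₀ ↦ (continuousOn_boundaryOfCoord x₀).aemeasurable (measurableSet_boundaryTarget x₀))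
    (aemeasurable_boundaryDensity g) (boundaryDensity_ne_zero g)
    MeasurableSet.univ t fun A _ _ h ↦ boundary_null_of_charts ht h
  rw [Measure.restrict_univ] at h
  have : SFinite (boundaryTangentVolume g) := h
  exact inferInstanceAs (SFinite (Measure.map (normalize g) (((n + 1 : ℕ) : ℝ≥0∞) •
    (boundaryTangentVolume g).restrict (puncturedBall g))))

lemma boundaryVolume_null (g : RMetric n M) {A : Set (TBundle n M)} (hA : MeasurableSet A)
    (h : boundaryVolume g A = 0) (x₀ : M) :
    (volume : Measure (EuclideanSpace ℝ (Fin n) × Coord n))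
      (boundaryTarget n x₀ ∩ boundaryOfCoord x₀ ⁻¹' (puncturedBall g ∩ normalize g ⁻¹' A)) = 0 := by
  have hcont : ContinuousOn (normalize g) (puncturedBall g) :=
    (continuousOn_normalize g).mono fun p hp ↦ hp.1
  have hms := (isOpen_puncturedBall g).measurableSet
  have hmeas : AEMeasurable (normalize g) (((n + 1 : ℕ) : ℝ≥0∞) •
      (boundaryTangentVolume g).restrict (puncturedBall g)) :=
    (hcont.aemeasurable hms).smul_measure _
  rw [boundaryVolume, Measure.map_apply_of_aemeasurable hmeas hA, Measure.smul_apply, smul_eq_mul,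
    Measure.restrict_apply' hms, inter_comm, mul_eq_zero] at h
  have h1 := h.resolve_left (by simp)
  exact (boundaryTangentVolume_null_iff g (measurableSet_inter_preimage hcont hms hA)).1 h1 x₀

/-- Null sets of `∂_+SM_T` in coordinates. -/
lemma timesInterval_outgoing_null [CompactSpace M] (g : RMetric n M) {T : ℝ}
    {B : Set (ℝ × TBundle n M)} (hB : MeasurableSet B)
    (h : timesInterval T ((boundaryVolume g).restrict (outgoing g)) B = 0) (x₀ : M) :
    (volume : Measure (ℝ × (EuclideanSpace ℝ (Fin n) × Coord n)))
      {q | q.1 ∈ Ioo 0 T ∧ q.2 ∈ boundaryTarget n x₀ ∧ boundaryOfCoord x₀ q.2 ∈ puncturedBall g ∧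
        normalize g (boundaryOfCoord x₀ q.2) ∈ outgoing g ∧
        (q.1, normalize g (boundaryOfCoord x₀ q.2)) ∈ B} = 0 := by
  have hcont : ContinuousOn (normalize g) (puncturedBall g) :=
    (continuousOn_normalize g).mono fun p hp ↦ hp.1
  set S := boundaryTarget n x₀ ∩ boundaryOfCoord x₀ ⁻¹' puncturedBall g with hS
  have hSm : MeasurableSet S := measurableSet_inter_preimage (continuousOn_boundaryOfCoord x₀)
    (measurableSet_boundaryTarget x₀) (isOpen_puncturedBall g).measurableSet
  have hcS : ContinuousOn (fun z ↦ normalize g (boundaryOfCoord x₀ z)) S :=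
    hcont.comp ((continuousOn_boundaryOfCoord x₀).mono inter_subset_left) fun z hz ↦ hz.2
  have hcq : ContinuousOn (fun q : ℝ × (EuclideanSpace ℝ (Fin n) × Coord n) ↦
      (q.1, normalize g (boundaryOfCoord x₀ q.2))) (Ioo 0 T ×ˢ S) :=
    continuousOn_fst.prodMk (hcS.comp continuousOn_snd fun q hq ↦ hq.2)
  have hB' : MeasurableSet (B ∩ univ ×ˢ outgoing g) :=
    hB.inter (MeasurableSet.univ.prod (measurableSet_outgoing g))
  have hm := measurableSet_inter_preimage hcq (measurableSet_Ioo.prod hSm) hB'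
  have hae := Measure.measure_ae_null_of_prod_null h
  rw [Filter.EventuallyEq, ae_restrict_iff' measurableSet_Ioo] at hae
  refine measure_mono_null ?_ (Measure.measure_prod_null_of_ae_null (μ := volume) (ν := volume)
    hm ?_)
  · rintro q ⟨h1, h2, h3, h4, h5⟩
    exact ⟨⟨h1, h2, h3⟩, h5, mem_univ _, h4⟩
  · filter_upwards [hae] with t ht
    by_cases htT : t ∈ Ioo 0 T
    · have h1 := ht htT
      have hBt : MeasurableSet (Prod.mk t ⁻¹' B) := measurable_prodMk_left hB
      rw [Pi.zero_apply, Measure.restrict_apply hBt] at h1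
      have h2 := boundaryVolume_null g (hBt.inter (measurableSet_outgoing g)) h1 x₀
      refine measure_mono_null ?_ h2
      rintro z ⟨⟨-, hz⟩, hz1, -, hz2⟩
      exact ⟨hz.1, hz.2, hz1, hz2⟩
    · refine measure_mono_null ?_ measure_empty
      rintro z ⟨⟨hz, -⟩, -⟩
      exact htT hz

end Charts

end

end Transport

namespace Transport

noncomputable section

open scoped NNReal

section Charts

variable {n : ℕ} {M : Type*} [TopologicalSpace M] [ChartedSpace (EuclideanHalfSpace (n + 1)) M]
  [IsManifold (𝓡∂ (n + 1)) ∞ M]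

/-! ### Null sets of the outgoing boundary -/

/-- The point where the orbit through `p` leaves the manifold. -/
def exitPoint (g : RMetric n M) (p : TBundle n M) : TBundle n M := flow g (exitTime g p) p

/-- Grönwall's inequality compares the trajectories over the shorter duration; the remaining piece
of the longer one has length at most `C` times the difference of the durations. -/
lemma IsTrajectory.dist_endpoints_le {F : Type*} [NormedAddCommGroup F] [NormedSpace ℝ F]
    {v : F → F} {K : Set F} {L C : ℝ≥0} (hv : LipschitzOnWith L v K) (hC : ∀ z ∈ K, ‖v z‖₊ ≤ C)
    {f f' : ℝ → F} {e e' ε : ℝ} (he : 0 ≤ e) (he' : 0 ≤ e') (heε : e ≤ ε) (heε' : e' ≤ ε)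
    (h : IsTrajectory v K f (-e) 0) (h' : IsTrajectory v K f' (-e') 0) :
    dist (f (-e)) (f' (-e')) ≤ Real.exp (L * ε) * dist (f 0) (f' 0) + C * dist e e' := by
  have key : ∀ {f f' : ℝ → F} {e e' : ℝ}, 0 ≤ e → e ≤ ε → e ≤ e' →
      IsTrajectory v K f (-e) 0 → IsTrajectory v K f' (-e') 0 →
      dist (f (-e)) (f' (-e')) ≤ Real.exp (L * ε) * dist (f 0) (f' 0) + C * dist e e' := by
    intro f f' e e' he heε hee h h'
    have h1 := IsTrajectory.dist_le' hv (by linarith) h (h'.mono (by linarith) le_rfl)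
    have h2 := (h'.lipschitz hC).dist_le_mul (-e) ⟨by linarith, by linarith⟩ (-e')
      ⟨le_rfl, by linarith⟩
    rw [dist_neg_neg] at h2
    refine (dist_triangle _ (f' (-e)) _).trans (add_le_add (h1.trans ?_) h2)
    gcongr
    linarith
  rcases le_total e e' with hee | hee
  · exact key he heε hee h h'
  · have := key he' heε' hee h' h
    rwa [dist_comm, dist_comm (f 0), dist_comm e]

variable [T2Space M] {g : RMetric n M}

lemma flow_exitPoint (hg : NonTrapping g) {p : TBundle n M} (hp : p ∈ sphereBundle g) {s : ℝ}
    (hs : s ∈ Ioo (-entryTime g p) (exitTime g p)) :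
    exitPoint g (flow g s p) = exitPoint g p := by
  obtain ⟨h1, h2, h3⟩ := flow_shift hg hp hs
  rw [exitPoint, h2]
  exact h3 _ ⟨hs.1.le.trans hs.2.le, le_rfl⟩

/-- A starting point is a Lipschitz function of its exit time and exit point, by the preceding
estimate for trajectories run backwards from the boundary. Only this direction is needed, so no
smoothness of the exit time enters. The offset `c` accounts for orbits that have already run for the
time `c`. -/
lemma exists_nullS_exit [CompactSpace M] (hconv : StrictlyConvexBoundary g) (hg : NonTrapping g)
    {q₀ : TBundle n M} (hq₀ : sqNorm g q₀ = 1) :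
    ∃ ε > 0, ∃ V, IsOpen V ∧ q₀ ∈ V ∧ ∀ (T c : ℝ) (B : Set (ℝ × TBundle n M)), MeasurableSet B →
      timesInterval T ((boundaryVolume g).restrict (outgoing g)) B = 0 →
      NullS g {p | p ∈ sphereBundle g ∧ exitTime g p < ε ∧ exitPoint g p ∈ V ∧
        c + exitTime g p ∈ Ioo 0 T ∧ (c + exitTime g p, exitPoint g p) ∈ B} := by
  have hne : q₀.2 ≠ 0 := ne_zero_of_sqNorm g (by rw [hq₀]; norm_num)
  obtain ⟨U, hU, hpU, L, C, hbox, U', hU', hpU', hUU', a, ha0, ha1, hsc⟩ := exists_isBox_scale g hne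
  obtain ⟨ε, hε, V, hV, hpV, hVU, h⟩ := exists_stay g hne hU' hpU'
  refine ⟨ε, hε, V, hV, hpV, fun T c B hB hBnull ↦ ?_⟩
  set x₀ := q₀.1
  set A : Set (TBundle n M) := {p | p ∈ sphereBundle g ∧ exitTime g p < ε ∧ exitPoint g p ∈ V ∧
    c + exitTime g p ∈ Ioo 0 T ∧ (c + exitTime g p, exitPoint g p) ∈ B} with hA
  have harc : ∀ p ∈ A, IsArc g (fun s ↦ flow g (exitTime g p + s) p)
      (-entryTime g p - exitTime g p) 0 := fun p hp ↦ by
    simpa using (isArc_flow hg hp.1).shift (exitTime g p)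
  have hstay : ∀ p ∈ A, ∀ s ∈ Icc (-exitTime g p) 0, flow g (exitTime g p + s) p ∈ U' := by
    intro p hp s hs
    have h1 := entryTime_pos hg hp.1
    have h2 := exitTime_pos hg hp.1
    refine h _ _ _ (harc p hp) ⟨by linarith, le_rfl⟩ ?_ s ⟨by linarith [hs.1], hs.2⟩ ?_
    · simp only [add_zero]; exact hp.2.2.1
    · rw [abs_of_nonpos hs.2]
      linarith [hs.1, hp.2.1]
  have htraj : ∀ ρ ∈ Ioo a 1, ∀ p ∈ A, IsTrajectory (unitField g x₀) (coordMap x₀ '' U)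
      (fun s ↦ coordMap x₀ (scale ρ (flow g (exitTime g p + s) p))) (-exitTime g p) 0 :=
    fun ρ hρ p hp ↦ ((harc p hp).mono (by linarith [entryTime_pos hg hp.1])
      le_rfl).isTrajectory_of_isBox hbox (ha0.trans hρ.1) fun s hs ↦
        hsc ρ hρ _ (hstay p hp s hs)
  have hexit : ∀ p ∈ A, exitPoint g p ∈ outgoing g ∧ exitPoint g p ∈ coordSource n x₀ ∧
      (coordMap x₀ (exitPoint g p)).1 0 = 0 := fun p hp ↦ by
    have h1 := exit_mem_outgoing hconv hg hp.1
    have h2 : exitPoint g p ∈ coordSource n x₀ := hbox.source (hUU' (hVU hp.2.2.1))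
    exact ⟨h1, h2, coordMap_fst_zero h2 h1.1⟩
  have : (volume : Measure (ℝ × (EuclideanSpace ℝ (Fin n) × Coord n))).IsAddHaarMeasure :=
    Measure.prod.instIsAddHaarMeasure volume volume
  -- The parameters are one time, `n` boundary coordinates and `n + 1` fibre coordinates, which is
  -- the dimension of the tangent bundle.
  refine nullS_of_dist_le (x₀ := x₀) (fun p hp ↦ ?_)
    (volume : Measure (ℝ × (EuclideanSpace ℝ (Fin n) × Coord n)))
    (by simp only [Module.finrank_prod, finrank_euclideanSpace_fin, Module.finrank_self]; omega)
    ha0 ha1 (β := fun ρ p ↦ (c + exitTime g p, boundaryTail (coordMap x₀ (exitPoint g p)).1,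
      ρ • (coordMap x₀ (exitPoint g p)).2))
    (K := ⟨Real.exp (L * ε), (Real.exp_pos _).le⟩ + C) ?_ ?_
    (timesInterval_outgoing_null g hB hBnull x₀)
  · have := hstay p hp (-exitTime g p) ⟨le_rfl, by linarith [exitTime_pos hg hp.1]⟩
    rw [add_neg_cancel, flow_zero hg hp.1] at this
    exact hbox.source (hUU' this)
  · intro ρ hρ ρ' hρ' p hp p' hp'
    have h1 := IsTrajectory.dist_endpoints_le hbox.lipschitz hbox.bound (exitTime_pos hg hp.1).le
      (exitTime_pos hg hp'.1).le hp.2.1.le hp'.2.1.le (htraj ρ hρ p hp) (htraj ρ' hρ' p' hp')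
    simp only [add_neg_cancel, flow_zero hg hp.1, flow_zero hg hp'.1, add_zero] at h1
    refine h1.trans ?_
    change _ ≤ (Real.exp (L * ε) + C) * _
    rw [add_mul]
    have h2 : dist (coordMap x₀ (scale ρ (exitPoint g p))) (coordMap x₀ (scale ρ' (exitPoint g p')))
        ≤ dist (boundaryTail (coordMap x₀ (exitPoint g p)).1,
          ρ • (coordMap x₀ (exitPoint g p)).2) (boundaryTail (coordMap x₀ (exitPoint g p')).1,
          ρ' • (coordMap x₀ (exitPoint g p')).2) := by
      rw [Prod.dist_eq, Prod.dist_eq, coordMap_scale, coordMap_scale,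
        dist_boundaryTail (hexit p hp).2.2 (hexit p' hp').2.2]
    have h3 : dist (exitTime g p) (exitTime g p')
        = dist (c + exitTime g p) (c + exitTime g p') := (dist_add_left _ _ _).symm
    rw [Prod.dist_eq]
    refine add_le_add ?_ ?_
    · exact mul_le_mul_of_nonneg_left (h2.trans (le_max_right _ _)) (Real.exp_pos _).le
    · rw [h3]
      exact mul_le_mul_of_nonneg_left (le_max_left _ _) C.2
  · intro ρ hρ p hp
    have hρ0 : 0 < ρ := ha0.trans hρ.1
    obtain ⟨h1, h2, h3⟩ := hexit p hp
    have h4 := boundaryOfCoord_coordMap (x₀ := x₀) (p := scale ρ (exitPoint g p)) h2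
      (by rw [coordMap_scale]; exact h3)
    rw [coordMap_scale] at h4
    have hu : sqNorm g (exitPoint g p) = 1 := h1.2.1
    have hsq : sqNorm g (scale ρ (exitPoint g p)) = ρ ^ 2 := by rw [sqNorm_scale, hu, mul_one]
    refine ⟨hp.2.2.2.1, h4.1, ?_, ?_, ?_⟩
    · simp only [h4.2]
      change 0 < sqNorm g (scale ρ (exitPoint g p)) ∧ sqNorm g (scale ρ (exitPoint g p)) < 1
      rw [hsq]
      exact ⟨by positivity, by nlinarith [hρ.2]⟩
    · simp only [h4.2]
      rw [normalize_scale g hu hρ0]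
      exact h1
    · simp only [h4.2]
      rw [normalize_scale g hu hρ0]
      exact hp.2.2.2.2

/-- Almost every point of `SM` leaves the manifold outside of a given null set of `∂_+SM_T`. -/
lemma nullS_exit [CompactSpace M] (hconv : StrictlyConvexBoundary g) (hg : NonTrapping g)
    {T : ℝ} {B : Set (ℝ × TBundle n M)}
    (hB : timesInterval T ((boundaryVolume g).restrict (outgoing g)) B = 0) :
    NullS g {p | p ∈ sphereBundle g ∧ exitTime g p < T ∧ (exitTime g p, exitPoint g p) ∈ B} := by
  have hloc : ∀ q₀ : TBundle n M, q₀ ∈ outgoing g → ∃ ε > 0, ∃ V, IsOpen V ∧ q₀ ∈ V ∧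
      ∀ (T c : ℝ) (B : Set (ℝ × TBundle n M)), MeasurableSet B →
      timesInterval T ((boundaryVolume g).restrict (outgoing g)) B = 0 →
      NullS g {p | p ∈ sphereBundle g ∧ exitTime g p < ε ∧ exitPoint g p ∈ V ∧
        c + exitTime g p ∈ Ioo 0 T ∧ (c + exitTime g p, exitPoint g p) ∈ B} :=
    fun q₀ hq₀ ↦ exists_nullS_exit hconv hg hq₀.2.1
  choose! ε hε V hV hqV hnull using hloc
  obtain ⟨t, hto, htc, ht⟩ := TopologicalSpace.isOpen_biUnion_countable (outgoing g) V hV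
  have := htc.to_subtype
  have hB' := (measure_toMeasurable B).trans hB
  have hBm := measurableSet_toMeasurable
    (timesInterval T ((boundaryVolume g).restrict (outgoing g))) B
  have hBs := subset_toMeasurable (timesInterval T ((boundaryVolume g).restrict (outgoing g))) B
  refine (NullS.iUnion (ι := t × ℚ) fun i ↦
    nullS_flow hg (hnull _ (hto i.1.2) T (i.2 : ℝ) _ hBm hB') (i.2 : ℝ)).mono ?_
  rintro p ⟨hp, hpT, hpB⟩
  have hout := exit_mem_outgoing hconv hg hp
  have hmem : exitPoint g p ∈ ⋃ q ∈ t, V q := by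
    rw [ht]
    exact mem_iUnion₂.2 ⟨_, hout, hqV _ hout⟩
  obtain ⟨q, hq, hpq⟩ := mem_iUnion₂.1 hmem
  have he := exitTime_pos hg hp
  have he' := entryTime_pos hg hp
  -- The local lemma requires an exit time below `ε q`. This holds after the flow has run for a
  -- rational time `c` shortly before the exit, and `nullS_flow` returns to the starting point.
  obtain ⟨c, hc1, hc2⟩ := exists_rat_btwn (max_lt he (sub_lt_self (exitTime g p) (hε q (hto hq))))
  have hc0 : (0 : ℝ) < c := (le_max_left _ _).trans_lt hc1
  have hc3 : exitTime g p - ε q < c := (le_max_right _ _).trans_lt hc1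
  have hcm : (c : ℝ) ∈ Ioo (-entryTime g p) (exitTime g p) := ⟨by linarith, hc2⟩
  obtain ⟨h1, h2, h3⟩ := flow_shift hg hp hcm
  have h4 : (c : ℝ) + exitTime g (flow g c p) = exitTime g p := by rw [h2]; ring
  refine mem_iUnion.2 ⟨(⟨q, hq⟩, c), ⟨hp, hcm⟩, flow_mem hg hp hcm, ?_, ?_, ?_, ?_⟩
  · change exitTime g (flow g c p) < ε q
    rw [h2]
    linarith
  · rw [flow_exitPoint hg hp hcm]; exact hpq
  · change (c : ℝ) + exitTime g (flow g c p) ∈ _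
    rw [h4]
    exact ⟨he, hpT⟩
  · change ((c : ℝ) + exitTime g (flow g c p), exitPoint g (flow g c p)) ∈ _
    rw [h4, flow_exitPoint hg hp hcm]
    exact hBs hpB

end Charts

end

end Transport

namespace Transport

noncomputable section

open scoped NNReal

/-! ### Integral equations with a parameter -/

section Picard

variable {Ω : Type*} [MeasurableSpace Ω]

lemma measurable_setIntegral_Ioc {G : Ω × ℝ → ℝ} (hG : Measurable G) :
    Measurable fun q : Ω × ℝ ↦ ∫ r in Ioc 0 q.2, G (q.1, r) := by
  have h1 : Measurable fun x : (Ω × ℝ) × ℝ ↦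
      {x : (Ω × ℝ) × ℝ | 0 < x.2 ∧ x.2 ≤ x.1.2}.indicator (fun x ↦ G (x.1.1, x.2)) x := by
    refine (hG.comp (by fun_prop)).indicator ?_
    exact (measurableSet_lt measurable_const measurable_snd).inter
      (measurableSet_le measurable_snd (by fun_prop))
  have h2 := h1.stronglyMeasurable.integral_prod_right' (ν := (volume : Measure ℝ))
  convert h2.measurable using 2 with q
  rw [← integral_indicator measurableSet_Ioc]
  rfl

/-- The structure of the coefficients of the integral equations. -/
structure IsCoeff {X : Type*} [MeasurableSpace X] (k : X → ℝ → ℝ) (L : ℝ) : Prop where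
  nonneg : 0 ≤ L
  meas : ∀ y, Measurable fun q ↦ k q y
  lip : ∀ q y y', |k q y - k q y'| ≤ L * |y - y'|
  zero : ∀ q, k q 0 = 0

variable {k : Ω × ℝ → ℝ → ℝ} {L : ℝ}

lemma IsCoeff.abs_le {X : Type*} [MeasurableSpace X] {k : X → ℝ → ℝ} (hk : IsCoeff k L) (q : X)
    (y : ℝ) : |k q y| ≤ L * |y| := by
  have := hk.lip q y 0
  rwa [hk.zero, sub_zero, sub_zero] at this

lemma IsCoeff.measurable_comp {X : Type*} [MeasurableSpace X] {k : X → ℝ → ℝ} (hk : IsCoeff k L)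
    {W : X → ℝ} (hW : Measurable W) : Measurable fun q ↦ k q (W q) := by
  have h1 : ∀ q, Continuous (k q) := fun q ↦
    (LipschitzWith.of_dist_le_mul (K := ⟨L, hk.nonneg⟩) fun y y' ↦ hk.lip q y y').continuous
  have h2 : Measurable (Function.uncurry fun y q ↦ k q y) :=
    measurable_uncurry_of_continuous_of_measurable h1 hk.meas
  exact h2.comp (hW.prodMk measurable_id)

/-- The Picard iteration. -/
def picard (k : Ω × ℝ → ℝ → ℝ) (z : ℝ) : ℕ → Ω × ℝ → ℝ
  | 0 => fun _ ↦ z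
  | j + 1 => fun q ↦ z - ∫ r in Ioc 0 q.2, k (q.1, r) (picard k z j (q.1, r))

lemma measurable_picard (hk : IsCoeff k L) (z : ℝ) (j : ℕ) : Measurable (picard k z j) := by
  induction j with
  | zero => exact measurable_const
  | succ j ih => exact measurable_const.sub (measurable_setIntegral_Ioc (hk.measurable_comp ih))

lemma integrableOn_of_abs_le {f : ℝ → ℝ} (hf : Measurable f) {C s : ℝ}
    (h : ∀ r ∈ Ioc 0 s, |f r| ≤ C) : IntegrableOn f (Ioc 0 s) := by
  refine IntegrableOn.of_bound (C := C) (by simp) hf.aestronglyMeasurable.restrict ?_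
  exact (ae_restrict_iff' measurableSet_Ioc).2 (Eventually.of_forall h)

/-- With the weight `exp (2 * L * s)` the Picard map contracts by the factor `1 / 2` on intervals of
any length. -/
lemma setIntegral_exp_le {L s : ℝ} (hs : 0 ≤ s) :
    ∫ r in Ioc 0 s, L * Real.exp (2 * L * r) ≤ Real.exp (2 * L * s) / 2 := by
  have h : ∀ r ∈ uIcc 0 s, HasDerivAt (fun r ↦ Real.exp (2 * L * r) / 2)
      (L * Real.exp (2 * L * r)) r := by
    intro r _
    have h1 : HasDerivAt (fun r : ℝ ↦ 2 * L * r) (2 * L) r := by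
      simpa using (hasDerivAt_id r).const_mul (2 * L)
    exact (h1.exp.div_const 2).congr_deriv (by ring)
  rw [← intervalIntegral.integral_of_le hs,
    intervalIntegral.integral_eq_sub_of_hasDerivAt h (Continuous.intervalIntegrable (by fun_prop) _ _)]
  simp only [mul_zero, Real.exp_zero]
  linarith

/-- Both bounds are proved in one induction: the growth bound makes the integrands integrable, so
that the differences can be estimated by the Lipschitz constant; the growth bound itself is the
geometric sum of the differences. -/
lemma picard_sub_le (hk : IsCoeff k L) (z : ℝ) (j : ℕ) (p : Ω) {s : ℝ} (hs : 0 ≤ s) :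
    |picard k z (j + 1) (p, s) - picard k z j (p, s)| ≤
        |z| * (1 / 2) ^ j * Real.exp (2 * L * s) ∧
      |picard k z j (p, s)| ≤ |z| + 2 * |z| * (1 - (1 / 2) ^ j) * Real.exp (2 * L * s) := by
  induction j generalizing s with
  | zero =>
    refine ⟨?_, by simp [picard]⟩
    have h1 : |∫ r in Ioc 0 s, k (p, r) z| ≤ L * |z| * s := by
      have := norm_setIntegral_le_of_norm_le_const (μ := volume) (s := Ioc 0 s) (C := L * |z|)
        (f := fun r ↦ k (p, r) z) (by simp) fun r _ ↦ hk.abs_le _ _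
      simpa [hs] using this
    have h2 : 2 * L * s + 1 ≤ Real.exp (2 * L * s) := Real.add_one_le_exp _
    simp only [picard, sub_sub_cancel_left, abs_neg, pow_zero, mul_one]
    refine h1.trans ?_
    have := mul_nonneg hk.nonneg hs
    nlinarith [abs_nonneg z]
  | succ j ih =>
    have hbound : ∀ i, (∀ {r : ℝ}, 0 ≤ r → |picard k z i (p, r)| ≤
        |z| + 2 * |z| * (1 - (1 / 2) ^ i) * Real.exp (2 * L * r)) →
        IntegrableOn (fun r ↦ k (p, r) (picard k z i (p, r))) (Ioc 0 s) := by
      intro i hi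
      refine integrableOn_of_abs_le (C := L * (|z| + 2 * |z| * (1 - (1 / 2) ^ i) *
        Real.exp (2 * L * s))) ((hk.measurable_comp (measurable_picard hk z i)).comp
          measurable_prodMk_left) fun r hr ↦ ?_
      refine (hk.abs_le _ _).trans (mul_le_mul_of_nonneg_left ((hi hr.1.le).trans ?_) hk.nonneg)
      have h1 : (1 / 2 : ℝ) ^ i ≤ 1 := pow_le_one₀ (by norm_num) (by norm_num)
      have h2 : Real.exp (2 * L * r) ≤ Real.exp (2 * L * s) :=
        Real.exp_le_exp.2 (mul_le_mul_of_nonneg_left hr.2 (by linarith [hk.nonneg]))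
      have h3 : 0 ≤ 2 * |z| * (1 - (1 / 2) ^ i) := by
        have := abs_nonneg z
        have h4 : 0 ≤ 1 - (1 / 2 : ℝ) ^ i := by linarith
        positivity
      nlinarith
    have hb : ∀ {r : ℝ}, 0 ≤ r → |picard k z (j + 1) (p, r)| ≤
        |z| + 2 * |z| * (1 - (1 / 2) ^ (j + 1)) * Real.exp (2 * L * r) := by
      intro r hr
      have h1 := (ih hr).1
      have h2 := (ih hr).2
      have h3 := abs_sub_abs_le_abs_sub (picard k z (j + 1) (p, r)) (picard k z j (p, r))
      rw [pow_succ]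
      nlinarith
    refine ⟨?_, hb hs⟩
    have h1 : picard k z (j + 1 + 1) (p, s) - picard k z (j + 1) (p, s) =
        -∫ r in Ioc 0 s, (k (p, r) (picard k z (j + 1) (p, r))
          - k (p, r) (picard k z j (p, r))) := by
      rw [integral_sub (hbound _ hb) (hbound _ fun hr ↦ (ih hr).2)]
      simp only [picard]
      ring
    rw [h1, abs_neg]
    have h2 : |∫ r in Ioc 0 s, (k (p, r) (picard k z (j + 1) (p, r))
          - k (p, r) (picard k z j (p, r)))| ≤
        ∫ r in Ioc 0 s, |z| * (1 / 2) ^ j * (L * Real.exp (2 * L * r)) := by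
      have hi : IntegrableOn (fun r : ℝ ↦ |z| * (1 / 2) ^ j * (L * Real.exp (2 * L * r)))
          (Ioc 0 s) := Continuous.integrableOn_Ioc (by fun_prop)
      rw [← Real.norm_eq_abs]
      refine norm_integral_le_of_norm_le hi ?_
      refine (ae_restrict_iff' measurableSet_Ioc).2 (Eventually.of_forall fun r hr ↦ ?_)
      refine (hk.lip _ _ _).trans ?_
      have := mul_le_mul_of_nonneg_left (ih hr.1.le).1 hk.nonneg
      linarith
    refine h2.trans ?_
    rw [integral_const_mul, pow_succ]
    have h3 := mul_le_mul_of_nonneg_left (setIntegral_exp_le (L := L) hs)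
      (by positivity : 0 ≤ |z| * (1 / 2) ^ j)
    linarith

/-- Solutions of integral equations that depend measurably on a parameter. -/
lemma exists_solution (hk : IsCoeff k L) (z : ℝ) : ∃ W : Ω × ℝ → ℝ, Measurable W ∧
    (∀ p s, 0 ≤ s → |W (p, s)| ≤ 3 * |z| * Real.exp (2 * L * s)) ∧
    ∀ p s, 0 ≤ s → W (p, s) = z - ∫ r in 0..s, k (p, r) (W (p, r)) := by
  have hbd : ∀ j p s, 0 ≤ s → |picard k z j (p, s)| ≤ 3 * |z| * Real.exp (2 * L * s) := by
    intro j p s hs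
    refine (picard_sub_le hk z j p hs).2.trans ?_
    have h1 : 0 ≤ (1 / 2 : ℝ) ^ j := by positivity
    have h2 : 1 ≤ Real.exp (2 * L * s) := Real.one_le_exp (by have := hk.nonneg; positivity)
    have h3 : 0 ≤ |z| * (1 / 2 : ℝ) ^ j * Real.exp (2 * L * s) := by positivity
    nlinarith [abs_nonneg z]
  -- The truncation `max 0 q.2` makes the iteration converge at every parameter, which makes the
  -- limit measurable on the whole space.
  have hcauchy : ∀ q : Ω × ℝ, ∃ w, Tendsto (fun j ↦ picard k z j (q.1, max 0 q.2)) atTop (𝓝 w) := by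
    intro q
    refine cauchySeq_tendsto_of_complete (cauchySeq_of_le_geometric (1 / 2)
      (|z| * Real.exp (2 * L * max 0 q.2)) (by norm_num) fun j ↦ ?_)
    rw [dist_comm, Real.dist_eq]
    exact (picard_sub_le hk z j q.1 (le_max_left _ _)).1.trans_eq (by ring)
  choose W hW using hcauchy
  have hmax : ∀ {s : ℝ}, 0 ≤ s → max 0 s = s := fun h ↦ max_eq_right h
  have hWm : Measurable W := measurable_of_tendsto_metrizable
    (fun j ↦ (measurable_picard hk z j).comp (by fun_prop)) (tendsto_pi_nhds.2 hW)
  have hWb : ∀ p s, 0 ≤ s → |W (p, s)| ≤ 3 * |z| * Real.exp (2 * L * s) := fun p s hs ↦ by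
    have h := hW (p, s)
    simp only [hmax hs] at h
    exact le_of_tendsto h.abs (Eventually.of_forall fun j ↦ hbd j p s hs)
  refine ⟨W, hWm, hWb, fun p s hs ↦ ?_⟩
  have h1 := hW (p, s)
  simp only [hmax hs] at h1
  have h2 : Tendsto (fun j ↦ picard k z (j + 1) (p, s)) atTop
      (𝓝 (z - ∫ r in Ioc 0 s, k (p, r) (W (p, r)))) := by
    refine tendsto_const_nhds.sub ?_
    refine tendsto_integral_of_dominated_convergence
      (fun _ ↦ L * (3 * |z| * Real.exp (2 * L * s))) (fun j ↦ ?_) (integrable_const _) (fun j ↦ ?_) ?_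
    · exact ((hk.measurable_comp (measurable_picard hk z j)).comp
        measurable_prodMk_left).aestronglyMeasurable
    · refine (ae_restrict_iff' measurableSet_Ioc).2 (Eventually.of_forall fun r hr ↦ ?_)
      refine (hk.abs_le _ _).trans (mul_le_mul_of_nonneg_left ((hbd j p r hr.1.le).trans ?_)
        hk.nonneg)
      refine mul_le_mul_of_nonneg_left (Real.exp_le_exp.2 ?_) (by positivity)
      exact mul_le_mul_of_nonneg_left hr.2 (by linarith [hk.nonneg])
    · refine (ae_restrict_iff' measurableSet_Ioc).2 (Eventually.of_forall fun r hr ↦ ?_)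
      have h3 := hW (p, r)
      simp only [hmax hr.1.le] at h3
      have hc : Continuous (k (p, r)) := (LipschitzWith.of_dist_le_mul (K := ⟨L, hk.nonneg⟩)
        fun y y' ↦ hk.lip (p, r) y y').continuous
      exact (hc.tendsto _).comp h3
  rw [intervalIntegral.integral_of_le hs]
  exact tendsto_nhds_unique ((tendsto_add_atTop_iff_nat 1).2 h1) h2

end Picard

/-! ### Uniqueness and comparison for integral equations -/

/-- Grönwall's inequality. -/
lemma eq_zero_of_abs_le_integral {u : ℝ → ℝ} {a b L : ℝ} (hu : ContinuousOn u (Icc a b))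
    (h : ∀ s ∈ Icc a b, |u s| ≤ L * ∫ r in a..s, |u r|) : ∀ s ∈ Icc a b, u s = 0 := by
  intro s hs
  have hab : a ≤ b := hs.1.trans hs.2
  -- A globally continuous extension makes the primitive differentiable at every point, including
  -- the end points.
  set v : ℝ → ℝ := IccExtend hab ((Icc a b).domRestrict u) with hv
  have huv : ∀ r ∈ Icc a b, v r = u r := fun r hr ↦ IccExtend_of_mem hab _ hr
  have hc : Continuous fun r ↦ |v r| :=
    ((continuousOn_iff_continuous_domRestrict.1 hu).Icc_extend' (h := hab)).abs
  have hint : ∀ s ∈ Icc a b, ∫ r in a..s, |v r| = ∫ r in a..s, |u r| := fun s hs ↦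
    intervalIntegral.integral_congr fun r hr ↦ by
      rw [uIcc_of_le hs.1] at hr
      simp only [huv r ⟨hr.1, hr.2.trans hs.2⟩]
  have hderiv : ∀ s, HasDerivAt (fun s ↦ ∫ r in a..s, |v r|) |v s| s := fun s ↦
    intervalIntegral.integral_hasDerivAt_right (hc.intervalIntegrable _ _)
      hc.stronglyMeasurable.stronglyMeasurableAtFilter hc.continuousAt
  have hnn : ∀ s ∈ Icc a b, 0 ≤ ∫ r in a..s, |v r| := fun s hs ↦
    intervalIntegral.integral_nonneg hs.1 fun r _ ↦ abs_nonneg _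
  have h1 := norm_le_gronwallBound_of_norm_deriv_right_le (f := fun s ↦ ∫ r in a..s, |v r|)
    (f' := fun s ↦ |v s|) (δ := 0) (K := L) (ε := 0) (a := a) (b := b)
    (fun s _ ↦ (hderiv s).continuousAt.continuousWithinAt)
    (fun s _ ↦ (hderiv s).hasDerivWithinAt) (by simp)
    (fun s hs ↦ by
      have hs' := Ico_subset_Icc_self hs
      have := h s hs'
      rw [Real.norm_of_nonneg (abs_nonneg _), Real.norm_of_nonneg (hnn s hs'), huv s hs',
        hint s hs']
      linarith) s hs
  rw [gronwallBound_ε0_δ0, norm_le_zero_iff, hint s hs] at h1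
  have h2 := h s hs
  rw [h1, mul_zero] at h2
  exact abs_nonpos_iff.1 h2

/-- `w` solves the equation `w' = -κ(s, w)` on `[a, b]`. -/
structure IsSol (κ : ℝ → ℝ → ℝ) (w : ℝ → ℝ) (a b : ℝ) : Prop where
  meas : Measurable w
  bound : ∃ C, ∀ s ∈ Icc a b, |w s| ≤ C
  eq : ∀ s ∈ Icc a b, w s = w a - ∫ r in a..s, κ r (w r)

section IsSol

variable {κ : ℝ → ℝ → ℝ} {L : ℝ} {w w' : ℝ → ℝ} {a b : ℝ}

lemma IsSol.intervalIntegrable (hκ : IsCoeff κ L) (h : IsSol κ w a b) {s t : ℝ} (hs : s ∈ Icc a b)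
    (ht : t ∈ Icc a b) : IntervalIntegrable (fun r ↦ κ r (w r)) volume s t := by
  obtain ⟨C, hC⟩ := h.bound
  refine IntervalIntegrable.mono_fun' (g := fun _ ↦ L * C) intervalIntegrable_const
    (hκ.measurable_comp h.meas).aestronglyMeasurable ?_
  refine (ae_restrict_iff' measurableSet_uIoc).2 (Eventually.of_forall fun r hr ↦ ?_)
  have hr' : r ∈ Icc a b := (ordConnected_Icc.uIcc_subset hs ht) (uIoc_subset_uIcc hr)
  exact (hκ.abs_le _ _).trans (mul_le_mul_of_nonneg_left (hC r hr') hκ.nonneg)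

lemma IsSol.sub_eq (hκ : IsCoeff κ L) (h : IsSol κ w a b) {s t : ℝ} (hs : s ∈ Icc a b)
    (ht : t ∈ Icc a b) : w t = w s - ∫ r in s..t, κ r (w r) := by
  have ha : a ∈ Icc a b := ⟨le_rfl, hs.1.trans hs.2⟩
  have := intervalIntegral.integral_add_adjacent_intervals (h.intervalIntegrable hκ ha hs)
    (h.intervalIntegrable hκ hs ht)
  rw [h.eq t ht, h.eq s hs, ← this]
  ring

lemma IsSol.mono (hκ : IsCoeff κ L) (h : IsSol κ w a b) {a' b' : ℝ} (ha : a ≤ a') (hb : b' ≤ b) :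
    IsSol κ w a' b' := by
  obtain ⟨C, hC⟩ := h.bound
  have hsub : Icc a' b' ⊆ Icc a b := Icc_subset_Icc ha hb
  exact ⟨h.meas, ⟨C, fun s hs ↦ hC s (hsub hs)⟩, fun s hs ↦
    h.sub_eq hκ (hsub ⟨le_rfl, hs.1.trans hs.2⟩) (hsub hs)⟩

lemma IsSol.lipschitz (hκ : IsCoeff κ L) (h : IsSol κ w a b) :
    ∃ K : ℝ≥0, LipschitzOnWith K w (Icc a b) := by
  obtain ⟨C, hC⟩ := h.bound
  refine ⟨Real.toNNReal (L * C), LipschitzOnWith.of_dist_le_mul fun s hs t ht ↦ ?_⟩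
  have h1 := intervalIntegral.norm_integral_le_of_norm_le_const (a := s) (b := t) (C := L * C)
    (f := fun r ↦ κ r (w r)) fun r hr ↦ by
      have hr' : r ∈ Icc a b := (ordConnected_Icc.uIcc_subset hs ht) (uIoc_subset_uIcc hr)
      exact (hκ.abs_le _ _).trans (mul_le_mul_of_nonneg_left (hC r hr') hκ.nonneg)
  rw [h.sub_eq hκ hs ht, Real.dist_eq, sub_sub_cancel, Real.dist_eq, abs_sub_comm s t]
  exact h1.trans (mul_le_mul_of_nonneg_right (Real.le_coe_toNNReal _) (abs_nonneg _))

lemma IsSol.continuousOn (hκ : IsCoeff κ L) (h : IsSol κ w a b) : ContinuousOn w (Icc a b) :=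
  (h.lipschitz hκ).choose_spec.continuousOn

lemma IsSol.ae_hasDerivAt (hκ : IsCoeff κ L) (h : IsSol κ w a b) :
    ∀ᵐ s, s ∈ Ioo a b → HasDerivAt w (-κ s (w s)) s := by
  rcases le_or_gt a b with hab | hab
  · have h1 := (h.intervalIntegrable hκ ⟨le_rfl, hab⟩ ⟨hab, le_rfl⟩).ae_hasDerivAt_integral
    filter_upwards [h1] with s hs hsm
    rw [uIcc_of_le hab] at hs
    have h2 := (hs (Ioo_subset_Icc_self hsm) a ⟨le_rfl, hab⟩).const_sub (w a)
    refine h2.congr_of_eventuallyEq ?_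
    filter_upwards [Icc_mem_nhds hsm.1 hsm.2] with t ht
    exact h.eq t ht
  · exact Eventually.of_forall fun s hs ↦ absurd (hs.1.trans hs.2) hab.not_gt

/-- Solutions that meet agreed before. -/
lemma IsSol.eq_left (hκ : IsCoeff κ L) (h : IsSol κ w a b) (h' : IsSol κ w' a b)
    (heq : w b = w' b) : ∀ s ∈ Icc a b, w s = w' s := by
  intro s hs
  have hab : a ≤ b := hs.1.trans hs.2
  have hb : b ∈ Icc a b := ⟨hab, le_rfl⟩
  have hc : ContinuousOn (fun r ↦ w r - w' r) (Icc a b) :=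
    (h.continuousOn hκ).sub (h'.continuousOn hκ)
  have hmem : ∀ r ∈ Icc 0 (b - a), b - r ∈ Icc a b := fun r hr ↦
    ⟨by linarith [hr.2], by linarith [hr.1]⟩
  -- Grönwall's inequality in the reversed time `b - r`.
  have key := eq_zero_of_abs_le_integral (u := fun r ↦ w (b - r) - w' (b - r)) (a := 0) (b := b - a)
    (L := L) (hc.comp (by fun_prop) hmem) (fun r hr ↦ by
      have hr' := hmem r hr
      have e1 : w (b - r) - w' (b - r)
          = ∫ x in (b - r)..b, (κ x (w x) - κ x (w' x)) := by
        rw [intervalIntegral.integral_sub (h.intervalIntegrable hκ hr' hb)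
          (h'.intervalIntegrable hκ hr' hb)]
        have h1 := h.sub_eq hκ hr' hb
        have h2 := h'.sub_eq hκ hr' hb
        linarith
      have e2 : ∫ x in (0)..r, |w (b - x) - w' (b - x)| = ∫ x in (b - r)..b, |w x - w' x| := by
        rw [intervalIntegral.integral_comp_sub_left (fun x ↦ |w x - w' x|) b, sub_zero]
      rw [e1, e2, ← intervalIntegral.integral_const_mul]
      refine intervalIntegral.norm_integral_le_of_norm_le (E := ℝ) (g := fun x ↦ L * |w x - w' x|)
        hr'.2 ?_ ?_
      · exact Eventually.of_forall fun x _ ↦ hκ.lip _ _ _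
      · refine ContinuousOn.intervalIntegrable ?_
        refine (continuousOn_const.mul hc.abs).mono ?_
        rw [uIcc_of_le hr'.2]
        exact Icc_subset_Icc_left hr'.1) (b - s) ⟨by linarith [hs.2], by linarith [hs.1]⟩
  simp only [sub_sub_cancel] at key
  linarith

/-- Comparison of solutions. -/
lemma IsSol.lt (hκ : IsCoeff κ L) (h : IsSol κ w a b) (h' : IsSol κ w' a b) (hab : a ≤ b)
    (hlt : w a < w' a) : w b < w' b := by
  by_contra! hcon
  have hc : ContinuousOn (fun r ↦ w r - w' r) (Icc a b) :=
    (h.continuousOn hκ).sub (h'.continuousOn hκ)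
  -- If the order were lost, the solutions would meet, and then they would have agreed at `a`.
  obtain ⟨c, hc, h0⟩ := intermediate_value_Icc hab hc
    (show (0 : ℝ) ∈ Icc (w a - w' a) (w b - w' b) from ⟨by linarith, by linarith⟩)
  have := (h.mono hκ le_rfl hc.2).eq_left hκ (h'.mono hκ le_rfl hc.2) (sub_eq_zero.1 h0) a
    ⟨le_rfl, hc.1⟩
  exact hlt.ne this

lemma isSol_zero (hκ : IsCoeff κ L) (a b : ℝ) : IsSol κ (fun _ ↦ 0) a b :=
  ⟨measurable_const, ⟨0, by simp⟩, fun s _ ↦ by simp [hκ.zero]⟩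

lemma IsSol.pos (hκ : IsCoeff κ L) (h : IsSol κ w a b) (h0 : 0 < w a) {s : ℝ} (hs : s ∈ Icc a b) :
    0 < w s :=
  (isSol_zero hκ a s).lt hκ (h.mono hκ le_rfl hs.2) hs.1 h0

lemma IsSol.shift {t : ℝ} (h : IsSol (fun r y ↦ κ (t + r) y) w 0 (b - t)) :
    IsSol κ (fun r ↦ w (r - t)) t b := by
  obtain ⟨C, hC⟩ := h.bound
  have hmem : ∀ s ∈ Icc t b, s - t ∈ Icc 0 (b - t) := fun s hs ↦
    ⟨by linarith [hs.1], by linarith [hs.2]⟩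
  refine ⟨h.meas.comp (by fun_prop), ⟨C, fun s hs ↦ hC _ (hmem s hs)⟩, fun s hs ↦ ?_⟩
  have h1 := h.eq _ (hmem s hs)
  have h2 := intervalIntegral.integral_comp_sub_right
    (fun r ↦ κ (t + r) (w r)) t (a := t) (b := s)
  simp only [add_sub_cancel, sub_self] at h2
  rw [h1, sub_self, h2]

end IsSol

end

end Transport

namespace Transport

noncomputable section

open scoped NNReal

section Charts

variable {n : ℕ} {M : Type*} [TopologicalSpace M] [ChartedSpace (EuclideanHalfSpace (n + 1)) M]
  [IsManifold (𝓡∂ (n + 1)) ∞ M]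

/-! ### The flow and null sets -/

/-- The geodesic flow, extended by the identity outside of its domain. -/
def flowMap (g : RMetric n M) (q : ℝ × TBundle n M) : TBundle n M :=
  open Classical in if q ∈ flowDomain g then flow g q.1 q.2 else q.2

lemma flowMap_of_mem {g : RMetric n M} {q : ℝ × TBundle n M} (hq : q ∈ flowDomain g) :
    flowMap g q = flow g q.1 q.2 := if_pos hq

variable [T2Space M] [CompactSpace M] {g : RMetric n M} (hg : NonTrapping g)

include hg

lemma measurable_flowMap : Measurable (flowMap g) := by
  classical
  exact (continuousOn_flow_prod hg).measurable_piecewise (g := Prod.snd) (by fun_prop)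
    (measurableSet_flowDomain hg)

lemma measurable_exitTime : Measurable ((sphereBundle g).indicator (exitTime g)) := by
  refine measurable_of_Ioi fun s ↦ ?_
  rcases lt_or_ge s 0 with hs | hs
  · convert MeasurableSet.univ
    refine eq_univ_of_forall fun p ↦ ?_
    refine hs.trans_le (indicator_nonneg (fun p hp ↦ (exitTime_pos hg hp).le) p)
  · convert (measurableSet_flowDomain hg).preimage (measurable_prodMk_left (x := s)) using 1
    ext p
    simp only [mem_preimage, mem_Ioi]
    by_cases hp : p ∈ sphereBundle g
    · rw [indicator_of_mem hp]
      exact ⟨fun h ↦ ⟨hp, by linarith [entryTime_pos hg hp], h⟩, fun h ↦ h.2.2⟩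
    · rw [indicator_of_notMem hp]
      exact ⟨fun h ↦ absurd h hs.not_gt, fun h ↦ absurd h.1 hp⟩

lemma measurableSet_flowDomain_inter {A : Set (TBundle n M)} (hA : MeasurableSet A) :
    MeasurableSet {q | q ∈ flowDomain g ∧ flow g q.1 q.2 ∈ A} :=
  measurableSet_inter_preimage (continuousOn_flow_prod hg) (measurableSet_flowDomain hg) hA

/-- Almost every orbit stays off a given null set at almost every time. -/
lemma ae_ae_flow {Z : Set (TBundle n M)} (hZ : sphereVolume g Z = 0) :
    ∀ᵐ p ∂sphereVolume g, ∀ᵐ s : ℝ, (s, p) ∈ flowDomain g → flow g s p ∉ Z := by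
  set Z' := toMeasurable (sphereVolume g) Z with hZ'
  have hm : MeasurableSet Z' := measurableSet_toMeasurable _ _
  have hnull : NullS g Z' := NullS.of_sphereVolume ((measure_toMeasurable Z).trans hZ)
  have hB := measurableSet_flowDomain_inter hg hm
  have key : ∀ᵐ s : ℝ, ∀ᵐ p ∂sphereVolume g, ¬((s, p) ∈ flowDomain g ∧ flow g s p ∈ Z') := by
    refine Eventually.of_forall fun s ↦ ?_
    have h1 := (sphereVolume_null_iff g (hB.preimage (measurable_prodMk_left (x := s)))).2
      (nullS_flow hg hnull s)
    exact measure_eq_zero_iff_ae_notMem.1 h1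
  -- Fubini's theorem exchanges the roles of the times and the starting points.
  filter_upwards [(Measure.ae_ae_comm hB.compl).1 key] with p hp
  filter_upwards [hp] with s hs h1 h2
  exact hs ⟨h1, subset_toMeasurable _ _ h2⟩

/-- A measurable set is a null set if almost every orbit stays off it at almost every positive
time. -/
lemma null_of_ae_ae_flow {Z : Set (TBundle n M)} (hZ : MeasurableSet Z)
    (h : ∀ᵐ p ∂sphereVolume g, ∀ᵐ s : ℝ, s ∈ Ioo 0 (exitTime g p) → flow g s p ∉ Z) :
    sphereVolume g Z = 0 := by
  have hB : MeasurableSet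
      {q : ℝ × TBundle n M | 0 < q.1 ∧ q ∈ flowDomain g ∧ flow g q.1 q.2 ∈ Z} :=
    (measurableSet_lt measurable_const measurable_fst).inter (measurableSet_flowDomain_inter hg hZ)
  have h1 : ∀ᵐ p ∂sphereVolume g, ∀ᵐ s : ℝ,
      ¬(0 < s ∧ (s, p) ∈ flowDomain g ∧ flow g s p ∈ Z) := by
    filter_upwards [h] with p hp
    filter_upwards [hp] with s hs h2
    exact hs ⟨h2.1, h2.2.1.2.2⟩ h2.2.2
  have h2 := (Measure.ae_ae_comm hB.compl).2 h1
  -- By Fubini's theorem there are arbitrarily small times `s` for which the set of points that are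
  -- carried into `Z` is null.
  have h3 : ∀ k : ℕ, ∃ s : ℝ, 0 < s ∧ s < 1 / (k + 1) ∧
      NullS g {p | (s, p) ∈ flowDomain g ∧ flow g s p ∈ Z} := by
    intro k
    obtain ⟨s, hs, hs0, hsk⟩ := (Measure.dense_of_ae h2).exists_between
      (show (0 : ℝ) < 1 / (k + 1) by positivity)
    refine ⟨s, hs0, hsk, NullS.of_sphereVolume (measure_eq_zero_iff_ae_notMem.2 ?_)⟩
    filter_upwards [hs] with p hp h4
    exact hp ⟨hs0, h4⟩
  choose s hs0 hsk hsn using h3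
  -- Each point of `Z` in the sphere bundle has a past, so it is obtained by flowing for some time
  -- `s k` from one of these null sets; `nullS_flow` for the time `-s k` applies.
  have h4 := NullS.iUnion fun k ↦ nullS_flow hg (hsn k) (-s k)
  have h5 : sphereVolume g (Z ∩ sphereBundle g) = 0 := by
    refine (sphereVolume_null_iff g (hZ.inter (measurableSet_sphereBundle g))).2 (h4.mono ?_)
    rintro q ⟨hqZ, hq⟩
    obtain ⟨k, hk⟩ := exists_nat_one_div_lt (entryTime_pos hg hq)
    have hmem : -s k ∈ Ioo (-entryTime g q) (exitTime g q) :=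
      ⟨by linarith [hsk k], by linarith [hs0 k, exitTime_pos hg hq]⟩
    obtain ⟨e1, e2, e3⟩ := flow_shift hg hq hmem
    have e4 := e3 0 ⟨by linarith [entryTime_pos hg hq], (exitTime_pos hg hq).le⟩
    rw [zero_sub, neg_neg, flow_zero hg hq] at e4
    refine mem_iUnion.2 ⟨k, ⟨hq, hmem⟩, ⟨flow_mem hg hq hmem, ?_⟩, ?_⟩
    · rw [e1, e2]
      constructor <;> dsimp only
      · linarith [hs0 k, hsk k]
      · linarith [exitTime_pos hg hq]
    · rw [e4]
      exact hqZ
  refine measure_mono_null (t := Z ∩ sphereBundle g ∪ (sphereBundle g)ᶜ) (fun q hq ↦ ?_)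
    (measure_union_null h5 (sphereVolume_compl g))
  by_cases h : q ∈ sphereBundle g
  exacts [Or.inl ⟨hq, h⟩, Or.inr h]

end Charts

/-! ### Lipschitz continuous coefficients with the given values near zero -/

/-- An analytic map into `L^∞` is Lipschitz near zero, and the Lipschitz bound holds at almost every
point for all pairs of rational arguments, hence for all arguments by continuity of `N p`.
Truncating the argument makes the coefficient globally Lipschitz without changing it near zero. -/
lemma exists_isCoeff {X : Type*} [MeasurableSpace X] {μ : Measure X} {σ : X → ℝ} {N : X → ℝ → ℝ}
    (hσ : AEStronglyMeasurable σ μ) {σ₀ : ℝ} (hσ₀ : ∀ᵐ p ∂μ, 0 ≤ σ p ∧ σ p ≤ σ₀)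
    (hN : ∀ᵐ p ∂μ, AnalyticOnNhd ℝ (N p) univ) {F : ℝ → Lp ℝ ∞ μ} (hF : AnalyticAt ℝ F 0)
    (hFN : ∀ z, F z =ᵐ[μ] fun p ↦ N p z) (hN0 : ∀ᵐ p ∂μ, N p 0 = 0) :
    ∃ ρ > 0, ∃ (L : ℝ) (G : X → ℝ → ℝ), IsCoeff G L ∧
      ∀ᵐ p ∂μ, ∀ y, |y| ≤ ρ → G p y = σ p * y + N p y := by
  obtain ⟨K, t, ht, hK⟩ := hF.contDiffAt.exists_lipschitzOnWith
  obtain ⟨ε, hε, hεt⟩ := Metric.mem_nhds_iff.1 ht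
  have h1 : ∀ᵐ p ∂μ, ∀ y : ℚ, F y p = N p y := ae_all_iff.2 fun y ↦ hFN y
  -- Rational arguments keep the exceptional null sets countable in number.
  have h2 : ∀ᵐ p ∂μ, ∀ y y' : ℚ, (y : ℝ) ∈ Metric.ball (0 : ℝ) ε → (y' : ℝ) ∈ Metric.ball (0 : ℝ) ε →
      |F y p - F y' p| ≤ K * |(y : ℝ) - y'| := by
    refine ae_all_iff.2 fun y ↦ ae_all_iff.2 fun y' ↦ ?_
    by_cases hy : (y : ℝ) ∈ Metric.ball (0 : ℝ) ε ∧ (y' : ℝ) ∈ Metric.ball (0 : ℝ) ε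
    · filter_upwards [ae_le_lpNorm_exponent_top (Lp.memLp (F y - F y')), Lp.coeFn_sub (F y) (F y')] with p hp hp' _ _
      rw [hp', Pi.sub_apply, Real.norm_eq_abs, ← toReal_eLpNorm (Lp.aestronglyMeasurable _),
        ← Lp.norm_def] at hp
      have := hK.dist_le_mul _ (hεt hy.1) _ (hεt hy.2)
      rw [dist_eq_norm, Real.dist_eq] at this
      exact hp.trans this
    · exact Eventually.of_forall fun p h h' ↦ absurd ⟨h, h'⟩ hy
  have h3 := hσ.ae_eq_mk
  set bad : Set X := {p | ¬((∀ y : ℚ, F y p = N p y) ∧ (∀ y y' : ℚ, (y : ℝ) ∈ Metric.ball (0 : ℝ) ε →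
    (y' : ℝ) ∈ Metric.ball (0 : ℝ) ε → |F y p - F y' p| ≤ K * |(y : ℝ) - y'|) ∧ σ p = hσ.mk σ p ∧
    (0 ≤ σ p ∧ σ p ≤ σ₀) ∧ AnalyticOnNhd ℝ (N p) univ ∧ N p 0 = 0)} with hbad
  have hbad0 : μ bad = 0 := by
    filter_upwards [h1, h2, h3, hσ₀, hN, hN0] with p a1 a2 a3 a4 a5 a6
    exact ⟨a1, a2, a3, a4, a5, a6⟩
  set Z := toMeasurable μ bad with hZ
  have hZm : MeasurableSet Z := measurableSet_toMeasurable _ _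
  have hgood : ∀ p ∉ Z, (∀ y : ℚ, F y p = N p y) ∧ (∀ y y' : ℚ, (y : ℝ) ∈ Metric.ball (0 : ℝ) ε →
      (y' : ℝ) ∈ Metric.ball (0 : ℝ) ε → |F y p - F y' p| ≤ K * |(y : ℝ) - y'|) ∧
      σ p = hσ.mk σ p ∧ (0 ≤ σ p ∧ σ p ≤ σ₀) ∧ AnalyticOnNhd ℝ (N p) univ ∧ N p 0 = 0 :=
    fun p hp ↦ not_not.1 fun h ↦ hp (subset_toMeasurable _ _ h)
  have hlip : ∀ p ∉ Z, LipschitzOnWith K (N p) (Metric.ball 0 ε) := by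
    intro p hp
    obtain ⟨a1, a2, -, -, a5, -⟩ := hgood p hp
    have b1 : LipschitzOnWith K (N p) (Metric.ball 0 ε ∩ range ((↑) : ℚ → ℝ)) := by
      refine LipschitzOnWith.of_dist_le_mul ?_
      rintro _ ⟨hy, y, rfl⟩ _ ⟨hy', y', rfl⟩
      rw [Real.dist_eq, Real.dist_eq, ← a1, ← a1]
      exact a2 y y' hy hy'
    exact (LipschitzOnWith.closure (a5.continuousOn.mono (subset_univ _)) b1).mono
      (Rat.denseRange_cast.open_subset_closure_inter Metric.isOpen_ball)
  set ρ := ε / 2 with hρ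
  -- The projection of `ℝ` onto `[-ρ, ρ]`, where `ρ < ε`.
  set cl : ℝ → ℝ := fun y ↦ max (-ρ) (min ρ y) with hcl
  have hcl1 : ∀ y y', |cl y - cl y'| ≤ |y - y'| := fun y y' ↦ by
    have := ((LipschitzWith.id (α := ℝ)).const_min ρ).const_max (-ρ) |>.dist_le_mul y y'
    rwa [NNReal.coe_one, one_mul] at this
  have hρ0 : 0 < ρ := half_pos hε
  have hcl2 : ∀ y, cl y ∈ Metric.ball (0 : ℝ) ε := fun y ↦ by
    rw [mem_ball_zero_iff, Real.norm_eq_abs, abs_lt]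
    have c1 : -ρ ≤ cl y := le_max_left _ _
    have c2 : cl y ≤ ρ := max_le (by linarith) (min_le_left _ _)
    constructor <;> linarith
  have hcl3 : ∀ y, |y| ≤ ρ → cl y = y := fun y hy ↦ by
    rw [abs_le] at hy
    simp only [hcl, min_eq_right hy.2, max_eq_right hy.1]
  -- Setting `G` to zero on a measurable null set makes the conditions of `IsCoeff` hold at every
  -- point.
  set G : X → ℝ → ℝ := fun p y ↦ Zᶜ.indicator (fun p ↦ hσ.mk σ p * y + N p (cl y)) p with hG
  have hG1 : ∀ p ∉ Z, ∀ y, G p y = hσ.mk σ p * y + N p (cl y) := fun p hp y ↦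
    indicator_of_mem (s := Zᶜ) hp _
  have hG2 : ∀ p ∈ Z, ∀ y, G p y = 0 := fun p hp y ↦
    indicator_of_notMem (s := Zᶜ) (fun h ↦ h hp) _
  refine ⟨ρ, hρ0, |σ₀| + K, G, ⟨by positivity, fun y ↦ ?_, fun p y y' ↦ ?_, fun p ↦ ?_⟩, ?_⟩
  · obtain ⟨r, hr, hrt⟩ := mem_closure_iff_seq_limit.1 (Rat.denseRange_cast (𝕜 := ℝ) (cl y))
    choose q hq using hr
    refine measurable_of_tendsto_metrizable
      (f := fun j ↦ Zᶜ.indicator fun p ↦ hσ.mk σ p * y + F (r j) p) (fun j ↦ ?_) ?_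
    · exact ((hσ.stronglyMeasurable_mk.measurable.mul_const y).add
        (Lp.stronglyMeasurable (F (r j))).measurable).indicator hZm.compl
    · refine tendsto_pi_nhds.2 fun p ↦ ?_
      by_cases hp : p ∈ Z
      · rw [hG2 p hp]
        simp [hp]
      · rw [hG1 p hp]
        simp only [indicator_of_mem (show p ∈ Zᶜ from hp)]
        refine tendsto_const_nhds.add ?_
        have := (((hgood p hp).2.2.2.2.1 (cl y) (mem_univ _)).continuousAt.tendsto).comp hrt
        refine this.congr fun j ↦ ?_
        rw [Function.comp_apply, ← hq j, (hgood p hp).1]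
  · by_cases hp : p ∈ Z
    · rw [hG2 p hp, hG2 p hp, sub_self, abs_zero]
      positivity
    · rw [hG1 p hp, hG1 p hp]
      obtain ⟨-, -, a3, a4, -, -⟩ := hgood p hp
      have b1 := (hlip p hp).dist_le_mul _ (hcl2 y) _ (hcl2 y')
      rw [Real.dist_eq, Real.dist_eq] at b1
      have b2 : |hσ.mk σ p| ≤ |σ₀| := by
        rw [← a3]
        exact abs_le_abs_of_nonneg a4.1 a4.2
      calc |hσ.mk σ p * y + N p (cl y) - (hσ.mk σ p * y' + N p (cl y'))|
          = |hσ.mk σ p * (y - y') + (N p (cl y) - N p (cl y'))| := by ring_nf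
        _ ≤ |hσ.mk σ p| * |y - y'| + |N p (cl y) - N p (cl y')| := by
          rw [← abs_mul]
          exact abs_add_le _ _
        _ ≤ |σ₀| * |y - y'| + K * |y - y'| :=
          add_le_add (mul_le_mul_of_nonneg_right b2 (abs_nonneg _))
            (b1.trans (mul_le_mul_of_nonneg_left (hcl1 y y') K.2))
        _ = (|σ₀| + K) * |y - y'| := by ring
  · by_cases hp : p ∈ Z
    · exact hG2 p hp 0
    · rw [hG1 p hp, hcl3 0 (by simpa using hρ0.le), (hgood p hp).2.2.2.2.2]
      simp
  · have : ∀ᵐ p ∂μ, p ∉ Z := measure_eq_zero_iff_ae_notMem.1 ((measure_toMeasurable _).trans hbad0)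
    filter_upwards [this] with p hp y hy
    rw [hG1 p hp, hcl3 y hy, (hgood p hp).2.2.1]

end

end Transport

namespace Transport

noncomputable section

open scoped NNReal

section Charts

variable {n : ℕ} {M : Type*} [TopologicalSpace M] [ChartedSpace (EuclideanHalfSpace (n + 1)) M]
  [IsManifold (𝓡∂ (n + 1)) ∞ M]

/-! ### Existence of solutions with constant initial values -/

/-- The coefficient along the orbits of the geodesic flow. -/
def orbitCoeff (g : RMetric n M) (G : TBundle n M → ℝ → ℝ) (q : TBundle n M × ℝ) (y : ℝ) : ℝ :=
  {q : TBundle n M × ℝ | q.swap ∈ flowDomain g}.indicator (fun q ↦ G (flowMap g q.swap) y) q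

/-- `W(p, s)` is the value at time `s` of the solution along the orbit through `p` with initial value
`z`. -/
structure IsOrbitSol (g : RMetric n M) (G : TBundle n M → ℝ → ℝ) (L z : ℝ)
    (W : TBundle n M × ℝ → ℝ) : Prop where
  meas : Measurable W
  bound : ∀ p s, 0 ≤ s → |W (p, s)| ≤ 3 * |z| * Real.exp (2 * L * s)
  sol : ∀ p b, IsSol (fun r ↦ orbitCoeff g G (p, r)) (fun s ↦ W (p, s)) 0 b
  init : ∀ p, W (p, 0) = z

/-- The solution of the transport equation with vanishing incoming boundary values. -/
def wave (g : RMetric n M) (W : TBundle n M × ℝ → ℝ) (q : ℝ × TBundle n M) : ℝ :=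
  {q : ℝ × TBundle n M | 0 < q.1 ∧ (-q.1, q.2) ∈ flowDomain g}.indicator
    (fun q ↦ W (flowMap g (-q.1, q.2), q.1)) q

/-- The trace of the solution on the outgoing boundary. -/
def waveTrace (g : RMetric n M) (W : TBundle n M × ℝ → ℝ) (q : ℝ × TBundle n M) : ℝ :=
  open Classical in if q.1 < entryTime g q.2 then W (flow g (-q.1) q.2, q.1) else 0

lemma orbitCoeff_of_mem {g : RMetric n M} {G : TBundle n M → ℝ → ℝ} {p : TBundle n M} {s : ℝ}
    (h : (s, p) ∈ flowDomain g) (y : ℝ) : orbitCoeff g G (p, s) y = G (flow g s p) y := by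
  rw [orbitCoeff, indicator_of_mem (show (p, s) ∈ {q : TBundle n M × ℝ | q.swap ∈ flowDomain g}
    from h), Prod.swap_prod_mk, flowMap_of_mem h]

lemma orbitCoeff_of_notMem {g : RMetric n M} {G : TBundle n M → ℝ → ℝ} {p : TBundle n M} {s : ℝ}
    (h : (s, p) ∉ flowDomain g) (y : ℝ) : orbitCoeff g G (p, s) y = 0 := by
  have h' : (p, s) ∉ {q : TBundle n M × ℝ | q.swap ∈ flowDomain g} := h
  rw [orbitCoeff, indicator_of_notMem h']

lemma wave_of_mem {g : RMetric n M} {W : TBundle n M × ℝ → ℝ} {p : TBundle n M} {t : ℝ} (ht : 0 < t)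
    (h : (-t, p) ∈ flowDomain g) : wave g W (t, p) = W (flow g (-t) p, t) := by
  rw [wave, indicator_of_mem (show (t, p) ∈ {q : ℝ × TBundle n M | 0 < q.1 ∧
    (-q.1, q.2) ∈ flowDomain g} from ⟨ht, h⟩), flowMap_of_mem h]

lemma wave_of_notMem {g : RMetric n M} {W : TBundle n M × ℝ → ℝ} {p : TBundle n M} {t : ℝ}
    (h : (-t, p) ∉ flowDomain g) : wave g W (t, p) = 0 := by
  have h' : (t, p) ∉ {q : ℝ × TBundle n M | 0 < q.1 ∧ (-q.1, q.2) ∈ flowDomain g} :=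
    fun h' ↦ h h'.2
  rw [wave, indicator_of_notMem h']

lemma measurableSet_incoming [CompactSpace M] (g : RMetric n M) : MeasurableSet (incoming g) := by
  have h : incoming g = scale (-1) ⁻¹' outgoing g := by
    ext p
    rw [mem_preimage, mem_incoming_iff, mem_outgoing_iff, sqNorm_scale]
    refine and_congr_right fun _ ↦ and_congr (by norm_num) ?_
    change _ ↔ (coordMap p.1 (scale (-1) p)).2 0 < 0
    rw [coordMap_neg_snd, neg_lt_zero]
  rw [h]
  exact (continuous_scale (-1)).measurable (measurableSet_outgoing g)

variable [T2Space M] {g : RMetric n M} (hg : NonTrapping g) {G : TBundle n M → ℝ → ℝ} {L z : ℝ}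
  {W : TBundle n M × ℝ → ℝ}

include hg

lemma flowDomain_shift {p : TBundle n M} (hp : p ∈ sphereBundle g) {s : ℝ}
    (hs : s ∈ Ioo (-entryTime g p) (exitTime g p)) (r : ℝ) :
    (r, flow g s p) ∈ flowDomain g ↔ (s + r, p) ∈ flowDomain g := by
  obtain ⟨h1, h2, -⟩ := flow_shift hg hp hs
  simp only [flowDomain, mem_ofPred_eq, h1, h2, mem_Ioo, hp, flow_mem hg hp hs, true_and]
  constructor <;> rintro ⟨a, b⟩ <;> constructor <;> linarith

lemma flow_flow {p : TBundle n M} {s r : ℝ} (hs : (s, p) ∈ flowDomain g)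
    (hr : (s + r, p) ∈ flowDomain g) : flow g r (flow g s p) = flow g (s + r) p := by
  have := (flow_shift hg hs.1 hs.2).2.2 (s + r) (Ioo_subset_Icc_self hr.2)
  rwa [add_sub_cancel_left] at this

lemma orbitCoeff_shift {p : TBundle n M} {s : ℝ} (hs : (s, p) ∈ flowDomain g) (r y : ℝ) :
    orbitCoeff g G (flow g s p, r) y = orbitCoeff g G (p, s + r) y := by
  by_cases h : (s + r, p) ∈ flowDomain g
  · rw [orbitCoeff_of_mem h, orbitCoeff_of_mem ((flowDomain_shift hg hs.1 hs.2 r).2 h),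
      flow_flow hg hs h]
  · rw [orbitCoeff_of_notMem h, orbitCoeff_of_notMem
      (fun h' ↦ h ((flowDomain_shift hg hs.1 hs.2 r).1 h'))]

/-- The orbit that passes `p` at time `t` was at `flow g (-t) p` at time zero, and the wave is
transported from there. -/
lemma wave_flow {p : TBundle n M} {t s : ℝ} (ht : (-t, p) ∈ flowDomain g)
    (hs : (s, p) ∈ flowDomain g) (hts : 0 < t + s) :
    wave g W (t + s, flow g s p) = W (flow g (-t) p, t + s) := by
  have e : s + -(t + s) = -t := by ring
  have h1 : (-(t + s), flow g s p) ∈ flowDomain g := by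
    rwa [flowDomain_shift hg hs.1 hs.2, e]
  rw [wave_of_mem hts h1, flow_flow hg hs (by rwa [e]), e]

/-- The orbit entered through the boundary at a nonnegative time, where the incoming value is zero.
-/
lemma wave_flow_zero {p : TBundle n M} {t s : ℝ} (ht : entryTime g p ≤ t)
    (hs : (s, p) ∈ flowDomain g) : wave g W (t + s, flow g s p) = 0 := by
  refine wave_of_notMem fun h ↦ ?_
  rw [flowDomain_shift hg hs.1 hs.2] at h
  have := h.2.1
  dsimp only at this
  linarith

variable [CompactSpace M]

lemma isCoeff_orbitCoeff (hG : IsCoeff G L) : IsCoeff (orbitCoeff g G) L := by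
  have hm : MeasurableSet {q : TBundle n M × ℝ | q.swap ∈ flowDomain g} :=
    (measurableSet_flowDomain hg).preimage measurable_swap
  refine ⟨hG.nonneg, fun y ↦ ?_, fun q y y' ↦ ?_, fun q ↦ ?_⟩
  · exact ((hG.meas y).comp ((measurable_flowMap hg).comp measurable_swap)).indicator hm
  · by_cases h : q.swap ∈ flowDomain g
    · rw [orbitCoeff_of_mem (p := q.1) (s := q.2) h, orbitCoeff_of_mem (p := q.1) (s := q.2) h]
      exact hG.lip _ _ _
    · rw [orbitCoeff_of_notMem (p := q.1) (s := q.2) h,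
        orbitCoeff_of_notMem (p := q.1) (s := q.2) h, sub_self, abs_zero]
      exact mul_nonneg hG.nonneg (abs_nonneg _)
  · by_cases h : q.swap ∈ flowDomain g
    · rw [orbitCoeff_of_mem (p := q.1) (s := q.2) h]
      exact hG.zero _
    · exact orbitCoeff_of_notMem (p := q.1) (s := q.2) h _

lemma isCoeff_orbit (hG : IsCoeff G L) (p : TBundle n M) :
    IsCoeff (fun r ↦ orbitCoeff g G (p, r)) L := by
  have h := isCoeff_orbitCoeff hg hG
  exact ⟨h.nonneg, fun y ↦ (h.meas y).comp measurable_prodMk_left, fun q ↦ h.lip _,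
    fun q ↦ h.zero _⟩

lemma exists_isOrbitSol (hG : IsCoeff G L) (z : ℝ) : ∃ W, IsOrbitSol g G L z W := by
  obtain ⟨W, hW, hb, heq⟩ := exists_solution (isCoeff_orbitCoeff hg hG) z
  have h0 : ∀ p, W (p, 0) = z := fun p ↦ by rw [heq p 0 le_rfl]; simp
  refine ⟨W, hW, hb, fun p b ↦ ⟨hW.comp measurable_prodMk_left,
    ⟨3 * |z| * Real.exp (2 * L * b), fun s hs ↦ (hb p s hs.1).trans ?_⟩, fun s hs ↦ ?_⟩, h0⟩
  · refine mul_le_mul_of_nonneg_left (Real.exp_le_exp.2 ?_) (by positivity)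
    exact mul_le_mul_of_nonneg_left hs.2 (mul_nonneg zero_le_two hG.nonneg)
  · rw [h0]
    exact heq p s hs.1

omit [T2Space M] [CompactSpace M] hg in
lemma IsOrbitSol.continuousOn (hk : ∀ p, IsCoeff (fun r ↦ orbitCoeff g G (p, r)) L)
    (hW : IsOrbitSol g G L z W) (p : TBundle n M) (b : ℝ) :
    ContinuousOn (fun s ↦ W (p, s)) (Icc 0 b) := (hW.sol p b).continuousOn (hk p)

variable {B ρ : ℝ} (hB : ∀ p ∈ sphereBundle g, exitTime g p ≤ B)
  (hρ : 3 * |z| * Real.exp (2 * L * B) ≤ ρ)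

include hB hρ

-- Small initial values keep the solution below `ρ` until all orbits have left, so that the
-- truncation of the coefficient is never felt.
omit [T2Space M] [CompactSpace M] hg hB in
lemma IsOrbitSol.abs_le (hG : IsCoeff G L) (hW : IsOrbitSol g G L z W) {p : TBundle n M} {s : ℝ}
    (hs : s ∈ Icc 0 B) : |W (p, s)| ≤ ρ := by
  refine (hW.bound p s hs.1).trans (le_trans ?_ hρ)
  refine mul_le_mul_of_nonneg_left (Real.exp_le_exp.2 ?_) (by positivity)
  exact mul_le_mul_of_nonneg_left hs.2 (mul_nonneg zero_le_two hG.nonneg)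

/-- If the orbit was in the manifold at time zero, the wave along it is a shifted solution of the
integral equation. Otherwise it vanishes, which is a solution because `G` vanishes at zero. -/
lemma wave_orbit (hG : IsCoeff G L) (hW : IsOrbitSol g G L z W) {p : TBundle n M}
    (hp : p ∈ sphereBundle g) {t : ℝ} (ht : 0 < t) :
    ∃ (v : ℝ → ℝ) (K : ℝ≥0), (∀ s, (s, p) ∈ flowDomain g → -t < s →
        wave g W (t + s, flow g s p) = v s ∧ |v s| ≤ ρ) ∧
      LipschitzOnWith K v {s | (s, p) ∈ flowDomain g ∧ -t < s} ∧
      ∀ᵐ s, (s, p) ∈ flowDomain g → -t < s → HasDerivAt v (-G (flow g s p) (v s)) s := by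
  have hρ0 : 0 ≤ ρ := le_trans (by positivity) hρ
  rcases lt_or_ge t (entryTime g p) with h | h
  · have hmem : (-t, p) ∈ flowDomain g :=
      ⟨hp, by dsimp only; linarith, by have := exitTime_pos hg hp; dsimp only; linarith⟩
    have hexit := (flow_shift hg hp hmem.2).2.1
    have hexitB := hB _ (flow_mem hg hp hmem.2)
    rw [hexit, sub_neg_eq_add] at hexitB
    have hk := isCoeff_orbit hg hG (flow g (-t) p)
    have hsol := hW.sol (flow g (-t) p) B
    obtain ⟨K, hK⟩ := hsol.lipschitz hk
    have hm : ∀ s, (s, p) ∈ flowDomain g → -t < s → t + s ∈ Ioo 0 B := fun s hs hts ↦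
      ⟨by linarith, by have := hs.2.2; dsimp only at this; linarith⟩
    refine ⟨fun s ↦ W (flow g (-t) p, t + s), K, fun s hs hts ↦ ?_, ?_, ?_⟩
    · exact ⟨wave_flow hg hmem hs (by linarith), hW.abs_le hρ hG (Ioo_subset_Icc_self (hm s hs hts))⟩
    · refine LipschitzOnWith.of_dist_le_mul fun s hs s' hs' ↦ ?_
      have := hK.dist_le_mul _ (Ioo_subset_Icc_self (hm s hs.1 hs.2)) _
        (Ioo_subset_Icc_self (hm s' hs'.1 hs'.2))
      rwa [dist_add_left] at this
    · have h1 := (measurePreserving_add_left (volume : Measure ℝ) t).quasiMeasurePreserving.ae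
        (hsol.ae_hasDerivAt hk)
      filter_upwards [h1] with s hs h2 h3
      have h4 := (hs (hm s h2 h3)).comp_const_add t s
      refine h4.congr_deriv ?_
      rw [← orbitCoeff_of_mem (G := G) h2, orbitCoeff_shift hg hmem, neg_add_cancel_left]
  · refine ⟨fun _ ↦ 0, 0, fun s hs hts ↦ ⟨wave_flow_zero hg h hs, by simpa using hρ0⟩, ?_, ?_⟩
    · exact LipschitzOnWith.of_dist_le_mul fun s _ s' _ ↦ by simp
    · refine Eventually.of_forall fun s _ _ ↦ ?_
      rw [hG.zero, neg_zero]
      exact hasDerivAt_const _ _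

end Charts

end

end Transport

namespace Transport

noncomputable section

open scoped NNReal

section Charts

variable {n : ℕ} {M : Type*} [TopologicalSpace M] [ChartedSpace (EuclideanHalfSpace (n + 1)) M]
  [IsManifold (𝓡∂ (n + 1)) ∞ M]

/-! ### The measurement of a solution with constant initial values -/

variable [T2Space M] [CompactSpace M] {g : RMetric n M} (hg : NonTrapping g)
  {G : TBundle n M → ℝ → ℝ} {L z : ℝ} {W : TBundle n M × ℝ → ℝ}

omit [T2Space M] [CompactSpace M] in
lemma ae_timesInterval_fst (T : ℝ) (m : Measure (TBundle n M)) :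
    ∀ᵐ q ∂timesInterval T m, q.1 ∈ Ioo 0 T :=
  Measure.quasiMeasurePreserving_fst.ae (ae_restrict_mem measurableSet_Ioo)

omit [T2Space M] [CompactSpace M] in
lemma ae_timesInterval_snd (T : ℝ) {m : Measure (TBundle n M)} {P : TBundle n M → Prop}
    (h : ∀ᵐ p ∂m, P p) : ∀ᵐ q ∂timesInterval T m, P q.2 :=
  Measure.quasiMeasurePreserving_snd.ae h

section

include hg

lemma measurable_wave (hW : Measurable W) : Measurable (wave g W) := by
  have h1 : Measurable fun q : ℝ × TBundle n M ↦ (-q.1, q.2) := by fun_prop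
  refine (hW.comp (((measurable_flowMap hg).comp h1).prodMk measurable_fst)).indicator ?_
  exact (measurableSet_lt measurable_const measurable_fst).inter ((measurableSet_flowDomain hg).preimage h1)

variable {B ρ : ℝ} (hB : ∀ p ∈ sphereBundle g, exitTime g p ≤ B)
  (hρ : 3 * |z| * Real.exp (2 * L * B) ≤ ρ) (hG : IsCoeff G L) (hW : IsOrbitSol g G L z W)

include hB hρ hG hW

omit [CompactSpace M] in
lemma abs_wave_le (q : ℝ × TBundle n M) : |wave g W q| ≤ ρ := by
  by_cases h : 0 < q.1 ∧ (-q.1, q.2) ∈ flowDomain g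
  · rw [wave_of_mem (t := q.1) (p := q.2) h.1 h.2]
    have h1 := (flow_shift hg h.2.1 h.2.2).2.1
    have h2 := exitTime_pos hg h.2.1
    have h3 := hB _ (flow_mem hg h.2.1 h.2.2)
    dsimp only at h1 h2 h3
    exact hW.abs_le hρ hG ⟨h.1.le, by linarith⟩
  · have h' : q ∉ {q : ℝ × TBundle n M | 0 < q.1 ∧ (-q.1, q.2) ∈ flowDomain g} := h
    rw [wave, indicator_of_notMem h', abs_zero]
    exact le_trans (by positivity) hρ

lemma isSolution_wave (hconv : StrictlyConvexBoundary g) {σ : TBundle n M → ℝ}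
    {N : TBundle n M → ℝ → ℝ}
    (hGN : ∀ᵐ p ∂sphereVolume g, ∀ y, |y| ≤ ρ → G p y = σ p * y + N p y) (T : ℝ) :
    IsSolution g T σ N (fun _ ↦ z) 0 (wave g W) := by
  refine ⟨?_, ?_, ?_, ?_⟩
  · exact memLp_top_of_bound (measurable_wave hg hW.meas).aestronglyMeasurable ρ
      (Eventually.of_forall (abs_wave_le hg hB hρ hG hW))
  · filter_upwards [ae_timesInterval_fst T _, ae_timesInterval_snd T (sphereVolume_compl g),
      -- The identity between `G` and the given coefficients fails only on a null set, which almost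
      -- every orbit avoids at almost every time.
      ae_timesInterval_snd T (ae_ae_flow hg hGN)] with q hq hqS hqf c a b hc
    obtain ⟨rfl, rfl, hcf⟩ := hc.eq_flow hqS
    obtain ⟨v, K, h1, h2, h3⟩ := wave_orbit hg hB hρ hG hW hqS hq.1
    set I := Ioo (max (-entryTime g q.2) (-q.1)) (min (exitTime g q.2) (T - q.1)) with hI
    have hmem : ∀ s ∈ I, (s, q.2) ∈ flowDomain g ∧ -q.1 < s := fun s hs ↦
      ⟨⟨hqS, (le_max_left _ _).trans_lt hs.1, hs.2.trans_le (min_le_left _ _)⟩,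
        (le_max_right _ _).trans_lt hs.1⟩
    have hcs : ∀ s ∈ I, c s = flow g s q.2 := fun s hs ↦ hcf (Ioo_subset_Icc_self (hmem s hs).1.2)
    have hv : ∀ s ∈ I, wave g W (q.1 + s, c s) = v s := fun s hs ↦ by
      rw [hcs s hs]
      exact (h1 s (hmem s hs).1 (hmem s hs).2).1
    constructor
    · intro s₁ hs₁ s₂ hs₂
      refine LipschitzOnWith.absolutelyContinuousOnInterval (K := K) ?_
      have hsub : uIcc s₁ s₂ ⊆ I := ordConnected_Ioo.uIcc_subset hs₁ hs₂
      refine LipschitzOnWith.of_dist_le_mul fun s hs s' hs' ↦ ?_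
      rw [hv s (hsub hs), hv s' (hsub hs')]
      exact h2.dist_le_mul _ (hmem s (hsub hs)) _ (hmem s' (hsub hs'))
    · filter_upwards [h3, hqf] with s hs hsf hsI
      have h4 := hs (hmem s hsI).1 (hmem s hsI).2
      have h5 := not_not.1 (hsf (hmem s hsI).1) (v s) (h1 s (hmem s hsI).1 (hmem s hsI).2).2
      have h6 : (fun s ↦ wave g W (q.1 + s, c s)) =ᶠ[𝓝 s] v := by
        filter_upwards [isOpen_Ioo.mem_nhds hsI] with s' hs'
        exact hv s' hs'
      refine (h4.congr_of_eventuallyEq h6).congr_deriv ?_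
      rw [hv s hsI, hcs s hsI, h5]
      ring
  · filter_upwards [sphereVolume_compl g] with p hp c a b hc
    obtain ⟨rfl, rfl, hcf⟩ := hc.eq_flow hp
    have hpos := exitTime_pos hg hp
    have hpos' := entryTime_pos hg hp
    have h1 : ContinuousWithinAt (fun s ↦ W (p, s)) (Icc 0 (exitTime g p)) 0 :=
      hW.continuousOn (isCoeff_orbit hg hG) p _ 0 ⟨le_rfl, hpos.le⟩
    rw [ContinuousWithinAt, hW.init] at h1
    have h2 : 𝓝[>] (0 : ℝ) ≤ 𝓝[Icc 0 (exitTime g p)] 0 := by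
      rw [← nhdsWithin_Ioo_eq_nhdsGT hpos]
      exact nhdsWithin_mono _ Ioo_subset_Icc_self
    refine (h1.mono_left h2).congr' ?_
    filter_upwards [Ioo_mem_nhdsGT hpos] with s hs
    have h0 : (-0, p) ∈ flowDomain g := ⟨hp, by dsimp only; linarith, by dsimp only; linarith⟩
    have hsd : (s, p) ∈ flowDomain g := ⟨hp, by dsimp only; linarith [hs.1], hs.2⟩
    have h3 := wave_flow (W := W) hg h0 hsd (by linarith [hs.1])
    rw [neg_zero, flow_zero hg hp, zero_add] at h3
    rw [hcf ⟨by linarith [hs.1], hs.2.le⟩, h3]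
  · filter_upwards [ae_timesInterval_fst T _,
      ae_timesInterval_snd T (ae_restrict_mem (measurableSet_incoming g))] with q hq hqi c a b hc
    obtain ⟨rfl, hb⟩ := hc.left_eq_zero hconv hqi
    -- Orbits that have just entered at a positive time cannot be followed back to time zero, so the
    -- wave vanishes on them.
    refine tendsto_const_nhds.congr' ?_
    filter_upwards [Ioo_mem_nhdsGT hb] with s hs
    have h1 := hc.mem_sphereBundle (mem_incoming_iff.1 hqi).2.1 hs
    have h2 := ((hc.shift (Ioo_subset_Icc_self hs)).eq_flow h1).1
    refine (wave_of_notMem fun h ↦ ?_).symm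
    have h3 := h.2.1
    dsimp only at h3
    linarith [hq.1]

omit hB hρ in
lemma isOutgoingTrace_wave (hconv : StrictlyConvexBoundary g) (T : ℝ) :
    IsOutgoingTrace g T (wave g W) (waveTrace g W) := by
  filter_upwards [ae_timesInterval_fst T _,
    ae_timesInterval_snd T (ae_restrict_mem (measurableSet_outgoing g))] with q hq hqo c a b hc
  obtain ⟨rfl, ha⟩ := hc.right_eq_zero hconv hqo
  have hunit := (mem_outgoing_iff.1 hqo).2.1
  -- `eq_flow` concerns vectors over the interior. At an outgoing vector both geodesics end at time
  -- zero, and `unique_left` identifies them.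
  obtain ⟨-, ha'⟩ := hc.flow_spec.right_eq_zero hconv hqo
  obtain ⟨rfl, hcf⟩ := hc.unique_left hc.flow_spec hunit ha ha'
  have key : ∀ s ∈ Ioo (-entryTime g q.2) 0, c s ∈ sphereBundle g ∧
      -entryTime g q.2 - s = -entryTime g (c s) ∧ 0 - s = exitTime g (c s) ∧
      ∀ r ∈ Icc (-entryTime g q.2 - s) (0 - s), c (s + r) = flow g r (c s) := fun s hs ↦ by
    have h1 := hc.mem_sphereBundle hunit hs
    obtain ⟨e1, e2, e3⟩ := (hc.shift (Ioo_subset_Icc_self hs)).eq_flow h1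
    exact ⟨h1, e1, e2, e3⟩
  by_cases ht : q.1 < entryTime g q.2
  · have h1 : ContinuousWithinAt (fun s ↦ W (flow g (-q.1) q.2, s)) (Icc 0 q.1) q.1 :=
      hW.continuousOn (isCoeff_orbit hg hG) _ _ q.1 ⟨hq.1.le, le_rfl⟩
    have h2 : Tendsto (fun s ↦ q.1 + s) (𝓝[<] 0) (𝓝[Icc 0 q.1] q.1) := by
      refine tendsto_nhdsWithin_iff.2 ⟨?_, ?_⟩
      · have h3 : Tendsto (fun s ↦ q.1 + s) (𝓝 0) (𝓝 (q.1 + 0)) :=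
          (continuous_const.add continuous_id).tendsto 0
        rw [add_zero] at h3
        exact h3.mono_left nhdsWithin_le_nhds
      · filter_upwards [Ioo_mem_nhdsLT (neg_lt_zero.2 hq.1)] with s hs
        exact ⟨by linarith [hs.1], by linarith [hs.2]⟩
    rw [waveTrace, if_pos ht]
    refine (Tendsto.comp h1 h2).congr' ?_
    filter_upwards [Ioo_mem_nhdsLT ha, Ioo_mem_nhdsLT (neg_lt_zero.2 hq.1)] with s hs hs'
    obtain ⟨k1, k2, k3, k4⟩ := key s hs
    have h5 : (-(q.1 + s), c s) ∈ flowDomain g := by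
      refine ⟨k1, ?_, ?_⟩
      · rw [← k2]
        dsimp only
        linarith
      · rw [← k3]
        dsimp only
        linarith [hq.1]
    rw [wave_of_mem (by linarith [hs'.1]) h5, ← k4 _ ⟨by linarith, by linarith [hq.1]⟩,
      Function.comp_apply]
    have e : s + -(q.1 + s) = -q.1 := by ring
    rw [e, hcf ⟨by linarith, by linarith [hq.1]⟩]
  · rw [waveTrace, if_neg ht]
    refine tendsto_const_nhds.congr' ?_
    filter_upwards [Ioo_mem_nhdsLT ha] with s hs
    refine (wave_of_notMem fun h ↦ ht ?_).symm
    have h3 := h.2.1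
    rw [← (key s hs).2.1] at h3
    dsimp only at h3
    linarith

end

-- Traced back from the exit point for the exit time, the orbit is at `p`, which is the starting
-- point used by `waveTrace`.
include hg in
omit [CompactSpace M] in
lemma waveTrace_exit (hconv : StrictlyConvexBoundary g) {p : TBundle n M}
    (hp : p ∈ sphereBundle g) : waveTrace g W (exitTime g p, exitPoint g p) = W (p, exitTime g p) := by
  have hpos := exitTime_pos hg hp
  have hpos' := entryTime_pos hg hp
  have ho := exit_mem_outgoing hconv hg hp
  have h := (isMaxGeodesic_flow hg hp).shift (t := exitTime g p) ⟨by linarith, le_rfl⟩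
  obtain ⟨-, h2⟩ := h.flow_spec.right_eq_zero hconv ho
  obtain ⟨h3, h4⟩ := h.unique_left h.flow_spec (mem_outgoing_iff.1 ho).2.1 (by linarith) h2
  have h5 := h4 (x := -exitTime g p) ⟨by linarith, by linarith⟩
  dsimp only at h5
  rw [add_neg_cancel, flow_zero hg hp] at h5
  rw [waveTrace, exitPoint, if_pos (by dsimp only; linarith), ← h5]

end Charts

end

end Transport

namespace Transport

noncomputable section

open scoped NNReal

section Charts

variable {n : ℕ} {M : Type*} [TopologicalSpace M] [ChartedSpace (EuclideanHalfSpace (n + 1)) M]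
  [IsManifold (𝓡∂ (n + 1)) ∞ M]

/-! ### Recovery of the coefficients -/

/-- If `y₁ < r < y₂` at some time, then also on an open set of times, which contains one where `hr`
provides `w₁` and `w₂`. Since solutions do not cross, `y₁ < w₁` and `w₂ < y₂` at the end; but there
`w₁ = w₂` and `y₁ = y₂`. -/
lemma IsSol.le_of_end_eq {κ₁ κ₂ : ℝ → ℝ → ℝ} {L₁ L₂ τ z : ℝ} {y₁ y₂ : ℝ → ℝ} (hκ₁ : IsCoeff κ₁ L₁)
    (hκ₂ : IsCoeff κ₂ L₂) (h₁ : IsSol κ₁ y₁ 0 τ) (h₂ : IsSol κ₂ y₂ 0 τ) (hτ : 0 < τ)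
    (hb₁ : ∀ s ∈ Icc 0 τ, |y₁ s| ≤ z) (hb₂ : ∀ s ∈ Icc 0 τ, |y₂ s| ≤ z) (hend : y₁ τ = y₂ τ)
    (hr : ∀ r : ℚ, |(r : ℝ)| ≤ z → ∀ᵐ s : ℝ, s ∈ Ioo 0 τ → ∃ w₁ w₂, IsSol κ₁ w₁ s τ ∧
      IsSol κ₂ w₂ s τ ∧ w₁ s = r ∧ w₂ s = r ∧ w₁ τ = w₂ τ) :
    ∀ s ∈ Icc 0 τ, y₂ s ≤ y₁ s := by
  intro s₀ hs₀
  by_contra! hlt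
  obtain ⟨r, hr1, hr2⟩ := exists_rat_btwn hlt
  have hrz : |(r : ℝ)| ≤ z := by
    have h3 := abs_le.1 (hb₁ s₀ hs₀)
    have h4 := abs_le.1 (hb₂ s₀ hs₀)
    exact abs_le.2 ⟨by linarith, by linarith⟩
  have hc₁ := h₁.continuousOn hκ₁
  have hc₂ := h₂.continuousOn hκ₂
  have hopen : IsOpen (Ioo 0 τ ∩ {s | y₁ s < r ∧ (r : ℝ) < y₂ s}) := by
    have o1 := (hc₁.mono Ioo_subset_Icc_self).isOpen_inter_preimage isOpen_Ioo
      (isOpen_Iio (a := (r : ℝ)))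
    have o2 := (hc₂.mono Ioo_subset_Icc_self).isOpen_inter_preimage isOpen_Ioo
      (isOpen_Ioi (a := (r : ℝ)))
    convert o1.inter o2 using 1
    ext s
    simp only [mem_inter_iff, mem_ofPred_eq, mem_preimage, mem_Iio, mem_Ioi]
    tauto
  have hne : (Ioo 0 τ ∩ {s | y₁ s < r ∧ (r : ℝ) < y₂ s}).Nonempty := by
    have e1 : ∀ᶠ s in 𝓝[Icc 0 τ] s₀, y₁ s < r := (hc₁ s₀ hs₀).eventually_lt_const hr1
    have e2 : ∀ᶠ s in 𝓝[Icc 0 τ] s₀, (r : ℝ) < y₂ s := (hc₂ s₀ hs₀).eventually_const_lt hr2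
    have hcl : s₀ ∈ closure (Ioo 0 τ) := by rwa [closure_Ioo hτ.ne]
    have := mem_closure_iff_nhdsWithin_neBot.1 hcl
    have e3 := (e1.and e2).filter_mono (nhdsWithin_mono s₀ (Ioo_subset_Icc_self (a := 0) (b := τ)))
    obtain ⟨s, hs, hs'⟩ := (e3.and self_mem_nhdsWithin).exists
    exact ⟨s, hs', hs⟩
  obtain ⟨s, ⟨hs, h3, h4⟩, h5⟩ := (Measure.dense_of_ae (hr r hrz)).inter_open_nonempty _ hopen hne
  obtain ⟨w₁, w₂, i1, i2, i3, i4, i5⟩ := h5 hs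
  have l1 := (h₁.mono hκ₁ hs.1.le le_rfl).lt hκ₁ i1 hs.2.le (by rwa [i3])
  have l2 := i2.lt hκ₂ (h₂.mono hκ₂ hs.1.le le_rfl) hs.2.le (by rwa [i4])
  linarith

/-- The identity theorem for analytic functions on the line, with the zeros of the difference
accumulating at zero. -/
lemma eq_of_tendsto_zero {σ₁ σ₂ : ℝ} {N₁ N₂ : ℝ → ℝ} (h₁ : AnalyticOnNhd ℝ N₁ univ)
    (h₂ : AnalyticOnNhd ℝ N₂ univ) {x : ℕ → ℝ} (hx : Tendsto x atTop (𝓝 0)) (hx0 : ∀ k, x k ≠ 0)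
    (heq : ∀ k, σ₁ * x k + N₁ (x k) = σ₂ * x k + N₂ (x k)) (y : ℝ) :
    σ₁ * y + N₁ y = σ₂ * y + N₂ y := by
  have hlin : ∀ σ : ℝ, AnalyticOnNhd ℝ (fun y ↦ σ * y) univ := fun σ ↦
    analyticOnNhd_const.mul analyticOnNhd_id
  have hx' : Tendsto x atTop (𝓝[≠] 0) :=
    tendsto_nhdsWithin_iff.2 ⟨hx, Eventually.of_forall hx0⟩
  have := ((hlin σ₁).add h₁).eq_of_frequently_eq ((hlin σ₂).add h₂)
    (hx'.frequently (Frequently.of_forall heq))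
  exact congrFun this y

variable [T2Space M] [CompactSpace M] {g : RMetric n M} (hg : NonTrapping g)

include hg

/-- Every orbit leaves before `T`, so by `nullS_exit` almost every starting point has an exit time
and exit point outside the null set where the traces differ. The indicator of the exit time serves
to show that the exceptional set is measurable. -/
lemma ae_exit_eq (hconv : StrictlyConvexBoundary g) {B T : ℝ}
    (hB : ∀ p ∈ sphereBundle g, exitTime g p ≤ B) (hBT : B < T) {W₁ W₂ : TBundle n M × ℝ → ℝ}
    (hW₁ : Measurable W₁) (hW₂ : Measurable W₂)
    (h : waveTrace g W₁ =ᵐ[timesInterval T ((boundaryVolume g).restrict (outgoing g))]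
      waveTrace g W₂) :
    ∀ᵐ p ∂sphereVolume g, p ∈ sphereBundle g → W₁ (p, exitTime g p) = W₂ (p, exitTime g p) := by
  have h1 : NullS g {p | p ∈ sphereBundle g ∧ W₁ (p, exitTime g p) ≠ W₂ (p, exitTime g p)} := by
    refine (nullS_exit hconv hg (ae_iff.1 h)).mono fun p hp ↦ ⟨hp.1, (hB p hp.1).trans_lt hBT, ?_⟩
    change ¬waveTrace g W₁ (exitTime g p, exitPoint g p) =
      waveTrace g W₂ (exitTime g p, exitPoint g p)
    rw [waveTrace_exit hg hconv hp.1, waveTrace_exit hg hconv hp.1]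
    exact hp.2
  have hm : MeasurableSet (sphereBundle g ∩
      {p | W₁ (p, (sphereBundle g).indicator (exitTime g) p) ≠
        W₂ (p, (sphereBundle g).indicator (exitTime g) p)}) := by
    have h2 := measurable_id.prodMk (measurable_exitTime hg)
    exact (measurableSet_sphereBundle g).inter
      (measurableSet_eq_fun (hW₁.comp h2) (hW₂.comp h2)).compl
  have heq : {p | p ∈ sphereBundle g ∧ W₁ (p, exitTime g p) ≠ W₂ (p, exitTime g p)} =
      sphereBundle g ∩ {p | W₁ (p, (sphereBundle g).indicator (exitTime g) p) ≠
        W₂ (p, (sphereBundle g).indicator (exitTime g) p)} := by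
    ext p
    refine and_congr_right fun hp ↦ ?_
    simp only [mem_ofPred_eq, indicator_of_mem hp]
  rw [heq] at h1
  have h3 := measure_eq_zero_iff_ae_notMem.1 ((sphereVolume_null_iff g hm).2 h1)
  rw [← heq] at h3
  filter_upwards [h3] with p hp hps
  exact not_not.1 fun h4 ↦ hp ⟨hps, h4⟩

variable {G₁ G₂ : TBundle n M → ℝ → ℝ} {L₁ L₂ B : ℝ} (hG₁ : IsCoeff G₁ L₁) (hG₂ : IsCoeff G₂ L₂)
  (hB : ∀ p ∈ sphereBundle g, exitTime g p ≤ B)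

-- As the coefficient does not depend on time, a solution that starts at `flow g s p` continues the
-- orbit of `p` from the time `s` on. This yields comparison solutions that start at interior times
-- with prescribed values.
omit [CompactSpace M] in
lemma IsOrbitSol.restart {G : TBundle n M → ℝ → ℝ} {L z : ℝ} {W : TBundle n M × ℝ → ℝ}
    (hW : IsOrbitSol g G L z W) {p : TBundle n M} {s : ℝ} (hs : (s, p) ∈ flowDomain g) (b : ℝ) :
    IsSol (fun r ↦ orbitCoeff g G (p, r)) (fun r ↦ W (flow g s p, r - s)) s b := by
  have h1 : (fun r ↦ orbitCoeff g G (flow g s p, r)) =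
      fun r y ↦ (fun r ↦ orbitCoeff g G (p, r)) (s + r) y := by
    ext r y
    exact orbitCoeff_shift hg hs r y
  have h2 := hW.sol (flow g s p) (b - s)
  rw [h1] at h2
  exact IsSol.shift (κ := fun r ↦ orbitCoeff g G (p, r)) h2

include hG₁ hG₂ hB

/-- If the exit values agree for all small constant initial values, then the coefficients agree
along the solutions. -/
lemma ae_ae_coeff_eq {z₁ z : ℝ} (hz1 : 3 * |z| * Real.exp (2 * L₁ * B) ≤ z₁)
    (hz2 : 3 * |z| * Real.exp (2 * L₂ * B) ≤ z₁) (hz : |z| ≤ z₁)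
    (hexit : ∀ z, |z| ≤ z₁ → ∀ W₁ W₂, IsOrbitSol g G₁ L₁ z W₁ → IsOrbitSol g G₂ L₂ z W₂ →
      ∀ᵐ p ∂sphereVolume g, p ∈ sphereBundle g → W₁ (p, exitTime g p) = W₂ (p, exitTime g p))
    {W₁ : TBundle n M × ℝ → ℝ} (hW₁ : IsOrbitSol g G₁ L₁ z W₁) :
    ∀ᵐ p ∂sphereVolume g, ∀ᵐ s : ℝ, s ∈ Ioo 0 (exitTime g p) →
      G₁ (flow g s p) (W₁ (p, s)) = G₂ (flow g s p) (W₁ (p, s)) := by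
  obtain ⟨W₂, hW₂⟩ := exists_isOrbitSol hg hG₂ z
  choose V₁ hV₁ using fun r : ℚ ↦ exists_isOrbitSol hg hG₁ (r : ℝ)
  choose V₂ hV₂ using fun r : ℚ ↦ exists_isOrbitSol hg hG₂ (r : ℝ)
  -- The exit identity for a rational initial value holds off a null set, which almost every orbit
  -- avoids at almost every time. Only countably many values occur.
  have hr : ∀ᵐ p ∂sphereVolume g, ∀ r : ℚ, |(r : ℝ)| ≤ z₁ → ∀ᵐ s : ℝ, (s, p) ∈ flowDomain g →
      V₁ r (flow g s p, exitTime g (flow g s p)) = V₂ r (flow g s p, exitTime g (flow g s p)) := by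
    refine ae_all_iff.2 fun r ↦ ?_
    by_cases hrz : |(r : ℝ)| ≤ z₁
    · filter_upwards [ae_ae_flow hg (hexit r hrz _ _ (hV₁ r) (hV₂ r))] with p hp _
      filter_upwards [hp] with s hs hsd
      exact not_not.1 (hs hsd) (flow_mem hg hsd.1 hsd.2)
    · exact Eventually.of_forall fun p h ↦ absurd h hrz
  filter_upwards [hexit z hz _ _ hW₁ hW₂, hr, sphereVolume_compl g] with p hp hpr hps
  have hτ := exitTime_pos hg hps
  have hdom : ∀ s ∈ Ioo 0 (exitTime g p), (s, p) ∈ flowDomain g := fun s hs ↦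
    ⟨hps, by have := entryTime_pos hg hps; dsimp only; linarith [hs.1], hs.2⟩
  have hk₁ := isCoeff_orbit hg hG₁ p
  have hk₂ := isCoeff_orbit hg hG₂ p
  have hs₁ := hW₁.sol p (exitTime g p)
  have hs₂ := hW₂.sol p (exitTime g p)
  have hsub : Icc 0 (exitTime g p) ⊆ Icc 0 B := Icc_subset_Icc_right (hB p hps)
  have hb₁ : ∀ s ∈ Icc 0 (exitTime g p), |W₁ (p, s)| ≤ z₁ := fun s hs ↦ hW₁.abs_le hz1 hG₁ (hsub hs)
  have hb₂ : ∀ s ∈ Icc 0 (exitTime g p), |W₂ (p, s)| ≤ z₁ := fun s hs ↦ hW₂.abs_le hz2 hG₂ (hsub hs)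
  have hrs : ∀ r : ℚ, |(r : ℝ)| ≤ z₁ → ∀ᵐ s : ℝ, s ∈ Ioo 0 (exitTime g p) → ∃ w₁ w₂,
      IsSol (fun r ↦ orbitCoeff g G₁ (p, r)) w₁ s (exitTime g p) ∧
      IsSol (fun r ↦ orbitCoeff g G₂ (p, r)) w₂ s (exitTime g p) ∧ w₁ s = r ∧ w₂ s = r ∧
      w₁ (exitTime g p) = w₂ (exitTime g p) := by
    intro r hrz
    filter_upwards [hpr r hrz] with s hs hsm
    refine ⟨_, _, (hV₁ r).restart hg (hdom s hsm) _, (hV₂ r).restart hg (hdom s hsm) _, ?_, ?_, ?_⟩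
    · rw [sub_self, (hV₁ r).init]
    · rw [sub_self, (hV₂ r).init]
    · have := hs (hdom s hsm)
      rwa [(flow_shift hg hps (hdom s hsm).2).2.1] at this
  -- Both inequalities come from the comparison argument, with the roles of the two equations
  -- exchanged.
  have heq : ∀ s ∈ Icc 0 (exitTime g p), W₁ (p, s) = W₂ (p, s) := by
    intro s hs
    refine le_antisymm ?_ (hs₁.le_of_end_eq hk₁ hk₂ hs₂ hτ hb₁ hb₂ (hp hps) hrs s hs)
    refine hs₂.le_of_end_eq hk₂ hk₁ hs₁ hτ hb₂ hb₁ (hp hps).symm (fun r hrz ↦ ?_) s hs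
    filter_upwards [hrs r hrz] with s hs hsm
    obtain ⟨w₁, w₂, i1, i2, i3, i4, i5⟩ := hs hsm
    exact ⟨w₂, w₁, i2, i1, i4, i3, i5.symm⟩
  filter_upwards [hs₁.ae_hasDerivAt hk₁, hs₂.ae_hasDerivAt hk₂] with s h1 h2 hs
  have h3 : (fun s ↦ W₁ (p, s)) =ᶠ[𝓝 s] fun s ↦ W₂ (p, s) := by
    filter_upwards [Icc_mem_nhds hs.1 hs.2] with s' hs'
    exact heq s' hs'
  have h4 := (h1 hs).unique ((h2 hs).congr_of_eventuallyEq h3)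
  rw [neg_inj, orbitCoeff_of_mem (hdom s hs), orbitCoeff_of_mem (hdom s hs),
    ← heq s (Ioo_subset_Icc_self hs)] at h4
  exact h4

/-- The initial values `z₂ / (m + 1)` give, at almost every time along almost every orbit, positive
arguments tending to zero at which the two coefficients agree. The identity theorem applies at these
points of the orbit, and `null_of_ae_ae_flow` leads back to almost every point of the sphere bundle.
-/
lemma ae_coeff_eq {ρ z₁ z₂ : ℝ} (hz₂ : 0 < z₂) (hz1 : 3 * z₂ * Real.exp (2 * L₁ * B) ≤ z₁)
    (hz2 : 3 * z₂ * Real.exp (2 * L₂ * B) ≤ z₁) (hz : z₂ ≤ z₁) (hz1ρ : z₁ ≤ ρ)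
    (hexit : ∀ z, |z| ≤ z₁ → ∀ W₁ W₂, IsOrbitSol g G₁ L₁ z W₁ → IsOrbitSol g G₂ L₂ z W₂ →
      ∀ᵐ p ∂sphereVolume g, p ∈ sphereBundle g → W₁ (p, exitTime g p) = W₂ (p, exitTime g p))
    {σ₁ σ₂ : TBundle n M → ℝ} {N₁ N₂ : TBundle n M → ℝ → ℝ}
    (hN₁ : ∀ᵐ p ∂sphereVolume g, AnalyticOnNhd ℝ (N₁ p) univ)
    (hN₂ : ∀ᵐ p ∂sphereVolume g, AnalyticOnNhd ℝ (N₂ p) univ)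
    (hGN₁ : ∀ᵐ p ∂sphereVolume g, ∀ y, |y| ≤ ρ → G₁ p y = σ₁ p * y + N₁ p y)
    (hGN₂ : ∀ᵐ p ∂sphereVolume g, ∀ y, |y| ≤ ρ → G₂ p y = σ₂ p * y + N₂ p y) :
    ∀ᵐ p ∂sphereVolume g, ∀ y, σ₁ p * y + N₁ p y = σ₂ p * y + N₂ p y := by
  have hρ : 0 < ρ := hz₂.trans_le (hz.trans hz1ρ)
  have hgood := hN₁.and (hN₂.and (hGN₁.and hGN₂))
  have hseq : Tendsto (fun m : ℕ ↦ z₂ / (m + 1)) atTop (𝓝 0) := by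
    have := (tendsto_one_div_add_atTop_nhds_zero_nat (𝕜 := ℝ)).const_mul z₂
    simpa [div_eq_mul_inv] using this
  have hpos : ∀ m : ℕ, 0 < z₂ / (m + 1) := fun m ↦ by positivity
  have hle : ∀ m : ℕ, |z₂ / (m + 1)| ≤ z₂ := fun m ↦ by
    rw [abs_of_pos (hpos m)]
    exact div_le_self hz₂.le (by linarith [(Nat.cast_nonneg m : (0 : ℝ) ≤ m)])
  have hmul : ∀ (m : ℕ) (L : ℝ), 3 * |z₂ / (m + 1)| * Real.exp (2 * L * B) ≤
      3 * z₂ * Real.exp (2 * L * B) := fun m L ↦ by gcongr; exact hle m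
  choose W hW using fun m : ℕ ↦ exists_isOrbitSol hg hG₁ (z₂ / (m + 1))
  have h1 : ∀ᵐ p ∂sphereVolume g, ∀ m : ℕ, ∀ᵐ s : ℝ, s ∈ Ioo 0 (exitTime g p) →
      G₁ (flow g s p) (W m (p, s)) = G₂ (flow g s p) (W m (p, s)) :=
    ae_all_iff.2 fun m ↦ ae_ae_coeff_eq hg hG₁ hG₂ hB ((hmul m L₁).trans hz1)
      ((hmul m L₂).trans hz2) ((hle m).trans hz) hexit (hW m)
  -- Measurability of the exceptional set is required, so it is stated with `G₁`, `G₂` and rational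
  -- arguments.
  set bad : Set (TBundle n M) := ⋃ r : ℚ, {p | |(r : ℝ)| ≤ ρ ∧ G₁ p r ≠ G₂ p r} with hbad
  have hbadm : MeasurableSet bad := MeasurableSet.iUnion fun r ↦
    (MeasurableSet.const _).inter (measurableSet_eq_fun (hG₁.meas r) (hG₂.meas r)).compl
  have h2 : sphereVolume g bad = 0 := by
    refine null_of_ae_ae_flow hg hbadm ?_
    filter_upwards [h1, ae_ae_flow hg hgood, sphereVolume_compl g] with p hp hpg hps
    filter_upwards [ae_all_iff.2 hp, hpg] with s hs hsg hsm
    have hdom : (s, p) ∈ flowDomain g :=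
      ⟨hps, by have := entryTime_pos hg hps; dsimp only; linarith [hsm.1], hsm.2⟩
    obtain ⟨a1, a2, a3, a4⟩ := not_not.1 (hsg hdom)
    have hsB : s ∈ Icc 0 B := ⟨hsm.1.le, hsm.2.le.trans (hB p hps)⟩
    have hWle : ∀ m, |W m (p, s)| ≤ ρ := fun m ↦
      (hW m).abs_le (((hmul m L₁).trans hz1).trans hz1ρ) hG₁ hsB
    have hWt : Tendsto (fun m ↦ W m (p, s)) atTop (𝓝 0) := by
      have h3 := ((hseq.abs.const_mul 3).mul_const (Real.exp (2 * L₁ * s)))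
      rw [abs_zero, mul_zero, zero_mul] at h3
      exact squeeze_zero_norm (fun m ↦ (hW m).bound p s hsm.1.le) h3
    have hWp : ∀ m, W m (p, s) ≠ 0 := fun m ↦
      (((hW m).sol p s).pos (isCoeff_orbit hg hG₁ p) (by rw [(hW m).init]; exact hpos m)
        ⟨hsm.1.le, le_rfl⟩).ne'
    have key := eq_of_tendsto_zero a1 a2 hWt hWp fun m ↦ by
      rw [← a3 _ (hWle m), ← a4 _ (hWle m)]
      exact hs m hsm
    intro hmem
    obtain ⟨r, hr1, hr2⟩ := mem_iUnion.1 hmem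
    exact hr2 (by rw [a3 _ hr1, a4 _ hr1, key])
  filter_upwards [hgood, measure_eq_zero_iff_ae_notMem.1 h2] with p ⟨a1, a2, a3, a4⟩ hp
  obtain ⟨k, hk⟩ := exists_nat_one_div_lt hρ
  -- Off the bad set the coefficients agree at rationals in `[-ρ, ρ]`; the index is shifted by `k`
  -- so that the whole sequence lies there.
  have hx : Tendsto (fun m : ℕ ↦ (1 : ℝ) / ((m + k : ℕ) + 1)) atTop (𝓝 0) :=
    (tendsto_one_div_add_atTop_nhds_zero_nat (𝕜 := ℝ)).comp (tendsto_add_atTop_nat k)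
  refine eq_of_tendsto_zero a1 a2 hx (fun m ↦ by positivity) fun m ↦ ?_
  have hm : |(1 : ℝ) / ((m + k : ℕ) + 1)| ≤ ρ := by
    rw [abs_of_pos (by positivity)]
    refine le_trans ?_ hk.le
    gcongr
    exact_mod_cast Nat.le_add_left k m
  rw [← a3 _ hm, ← a4 _ hm]
  by_contra hne
  refine hp (mem_iUnion.2 ⟨1 / ((m + k : ℕ) + 1), ?_⟩)
  push_cast at hm hne ⊢
  exact ⟨hm, hne⟩

end Charts

end

end Transport

/-! ### Recovery of the absorption coefficient and the nonlinearity from the measurements -/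

theorem theorem1p3 {n : ℕ} (hn : 1 ≤ n) {M : Type*} [TopologicalSpace M] [T2Space M]
    [CompactSpace M] [ChartedSpace (EuclideanHalfSpace (n + 1)) M]
    [IsManifold (𝓡∂ (n + 1)) ∞ M] (g : Transport.RMetric n M)
    (hconvex : Transport.StrictlyConvexBoundary g) (hnontrapping : Transport.NonTrapping g) :
    ∃ T₀ : ℝ, 0 < T₀ ∧ ∀ T : ℝ, T₀ ≤ T →
      ∀ (σ₁ σ₂ : Transport.TBundle n M → ℝ) (N₁ N₂ : Transport.TBundle n M → ℝ → ℝ),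
        Transport.IsAbsorption g σ₁ → Transport.IsAbsorption g σ₂ →
        Transport.IsNonlinearity g N₁ → Transport.IsNonlinearity g N₂ →
        ∀ δ : ℝ, 0 < δ → Transport.SameMeasurements g T σ₁ N₁ σ₂ N₂ δ →
          σ₁ =ᵐ[Transport.sphereVolume g] σ₂ ∧
            ∀ᵐ p ∂Transport.sphereVolume g, ∀ z : ℝ, N₁ p z = N₂ p z := by
  obtain ⟨B, hB⟩ := Transport.exists_exitTime_le hconvex hnontrapping
  have hB' : ∀ p ∈ Transport.sphereBundle g, Transport.exitTime g p ≤ max B 0 := fun p hp ↦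
    (hB p hp).trans (le_max_left _ _)
  have hB0 : 0 ≤ max B 0 := le_max_right _ _
  generalize max B 0 = B' at hB' hB0
  -- The added one makes all exit times strictly smaller than `T` and keeps `T₀` positive.
  refine ⟨B' + 1, by linarith, fun T hT σ₁ σ₂ N₁ N₂ hσ₁ hσ₂ hN₁ hN₂ δ hδ hsame ↦ ?_⟩
  obtain ⟨s₁, -, hs₁⟩ := hσ₁.2
  obtain ⟨s₂, -, hs₂⟩ := hσ₂.2
  obtain ⟨F₁, hF₁, hFN₁⟩ := hN₁.analytic_Linfty
  obtain ⟨F₂, hF₂, hFN₂⟩ := hN₂.analytic_Linfty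
  obtain ⟨ρ₁, hρ₁, L₁, G₁, hG₁, hGN₁⟩ := Transport.exists_isCoeff hσ₁.1.aestronglyMeasurable hs₁
    hN₁.analytic (hF₁ 0 (mem_univ _)) hFN₁ hN₁.zero
  obtain ⟨ρ₂, hρ₂, L₂, G₂, hG₂, hGN₂⟩ := Transport.exists_isCoeff hσ₂.1.aestronglyMeasurable hs₂
    hN₂.analytic (hF₂ 0 (mem_univ _)) hFN₂ hN₂.zero
  set ρ := min ρ₁ ρ₂
  have hρ : 0 < ρ := lt_min hρ₁ hρ₂
  have hGN₁' : ∀ᵐ p ∂Transport.sphereVolume g, ∀ y, |y| ≤ ρ → G₁ p y = σ₁ p * y + N₁ p y :=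
    hGN₁.mono fun p hp y hy ↦ hp y (hy.trans (min_le_left _ _))
  have hGN₂' : ∀ᵐ p ∂Transport.sphereVolume g, ∀ y, |y| ≤ ρ → G₂ p y = σ₂ p * y + N₂ p y :=
    hGN₂.mono fun p hp y hy ↦ hp y (hy.trans (min_le_right _ _))
  -- Division by `E` absorbs the growth factors `3 * exp (2 * L * B')` of both equations; the
  -- summand `1` ensures that the quotient is not larger than the bound itself.
  set E := 1 + 3 * Real.exp (2 * L₁ * B') + 3 * Real.exp (2 * L₂ * B') with hE
  have e1 := Real.exp_pos (2 * L₁ * B')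
  have e2 := Real.exp_pos (2 * L₂ * B')
  have hE0 : 0 < E := by positivity
  have hdiv : ∀ r x : ℝ, 0 ≤ x → x ≤ r / E → 3 * x * Real.exp (2 * L₁ * B') ≤ r ∧
      3 * x * Real.exp (2 * L₂ * B') ≤ r ∧ x ≤ r := by
    intro r x hx hxr
    rw [le_div_iff₀ hE0, hE] at hxr
    have := mul_nonneg hx e1.le
    have := mul_nonneg hx e2.le
    refine ⟨?_, ?_, ?_⟩ <;> nlinarith
  set z₁ := min δ (ρ / E) with hz₁
  have hz₁0 : 0 < z₁ := lt_min hδ (div_pos hρ hE0)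
  have hexit : ∀ z, |z| ≤ z₁ → ∀ W₁ W₂, Transport.IsOrbitSol g G₁ L₁ z W₁ →
      Transport.IsOrbitSol g G₂ L₂ z W₂ → ∀ᵐ p ∂Transport.sphereVolume g,
        p ∈ Transport.sphereBundle g →
          W₁ (p, Transport.exitTime g p) = W₂ (p, Transport.exitTime g p) := by
    intro z hz W₁ W₂ hW₁ hW₂
    obtain ⟨b1, b2, -⟩ := hdiv ρ |z| (abs_nonneg z) (hz.trans (min_le_right _ _))
    refine Transport.ae_exit_eq hnontrapping hconvex hB' (by linarith) hW₁.meas hW₂.meas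
      (hsame (fun _ ↦ z) (memLp_top_const z) ?_ _ _
      ⟨Transport.wave g W₁, ?_, ?_⟩ ⟨Transport.wave g W₂, ?_, ?_⟩)
    · rw [eLpNorm_exponent_top]
      exact eLpNormEssSup_le_of_ae_bound (Eventually.of_forall fun _ ↦ hz.trans (min_le_left _ _))
    · exact Transport.isSolution_wave hnontrapping hB' b1 hG₁ hW₁ hconvex hGN₁' T
    · exact Transport.isOutgoingTrace_wave hnontrapping hG₁ hW₁ hconvex T
    · exact Transport.isSolution_wave hnontrapping hB' b2 hG₂ hW₂ hconvex hGN₂' T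
    · exact Transport.isOutgoingTrace_wave hnontrapping hG₂ hW₂ hconvex T
  -- A second, smaller threshold: solutions with initial values up to `z₁ / E` stay below `z₁`, so
  -- the rational values between them are admissible initial values again.
  obtain ⟨c1, c2, c3⟩ := hdiv z₁ (z₁ / E) (div_pos hz₁0 hE0).le le_rfl
  obtain ⟨-, -, c4⟩ := hdiv ρ z₁ hz₁0.le (min_le_right _ _)
  have key := Transport.ae_coeff_eq hnontrapping hG₁ hG₂ hB' (div_pos hz₁0 hE0) c1 c2 c3 c4 hexit
    hN₁.analytic hN₂.analytic hGN₁' hGN₂'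
  -- The derivative of `σ y + N(y)` at `y = 0` is `σ`.
  have hσ : σ₁ =ᵐ[Transport.sphereVolume g] σ₂ := by
    filter_upwards [key, hN₁.analytic, hN₂.analytic, hN₁.deriv_zero, hN₂.deriv_zero]
      with p hp a1 a2 d1 d2
    have h1 := ((hasDerivAt_id (0 : ℝ)).const_mul (σ₁ p)).add
      (a1 0 (mem_univ _)).differentiableAt.hasDerivAt
    have h2 := ((hasDerivAt_id (0 : ℝ)).const_mul (σ₂ p)).add
      (a2 0 (mem_univ _)).differentiableAt.hasDerivAt
    rw [d1, mul_one, add_zero] at h1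
    rw [d2, mul_one, add_zero] at h2
    exact h1.unique (h2.congr_of_eventuallyEq (Eventually.of_forall hp))
  refine ⟨hσ, ?_⟩
  filter_upwards [key, hσ] with p hp hps y
  have := hp y
  rw [hps] at this
  exact add_left_cancel this
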